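/- Let $\mathcal A$ be a finite set of atomic propositions. A Markov chain $M=(S,P,s_0,L)$ consists of a countable set $S$ of states, transition probabilities $P:S\times S\to[0,1]$ with $\sum_{t}P(s,t)=1$ for all $s$, an initial state $s_0$, and a labelling $L:S\to 2^{\mathcal A}$. Formulae of the fragment $\mathbf F_q,\mathbf G_1$ of PCTL are given by $$\Phi ::= a \mid \neg a \mid \Phi\wedge\Phi \mid \mathbf F_{\rhd q}\Phi \mid \mathbf G_{\ge 1}\Phi ,\qquad a\in\mathcal A,\ q\in[0,1]\cap\mathbb Q,\ \rhd\in\{\ge,>\}.$$ Literals and conjunction have their usual meaning at a state $s$, and $M,s\models\mathbf F_{\rhd q}\varphi$ (resp. $M,s\models\mathbf G_{\ge 1}\varphi$) iff the probability that a run of the chain started in $s$ visits some state satisfying $\varphi$ is $\rhd q$ (resp. that all its states satisfy $\varphi$ is $\ge 1$). $M$ is a model of $\varphi$ if $M,s_0\models\varphi$; $\varphi$ is (finitely) satisfiable if it has a (finite) model. The length $|\varphi|$ is the number of occurrences of literals, conjunctions and temporal operators in $\varphi$. A chain is a tree with back edges if its states form a tree with root $s_0$ all of whose parent-to-child edges are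 transitions of positive probability, and every other transition of positive probability leads from a state to itself or to one of its ancestors; its height is the largest number of states on a branch of the tree. 1. Every satisfiable $\mathbf F_q,\mathbf G_1$-formula $\varphi$ has a model that is a tree with back edges of height at most $|\varphi|$, in which every state has at most $|\varphi|+2$ immediate successors, and which has at most $(|\varphi|+2)^{|\varphi|}$ states. 2. An $\mathbf F_q,\mathbf G_1$-formula is finitely satisfiable if and only if it is satisfiable. 3. Satisfiability and finite satisfiability of $\mathbf F_q,\mathbf G_1$-formulae are decidable: there is an algorithm which, given (a standard encoding of) such a formula, with the atomic propositions numbered by natural numbers, decides whether it is satisfiable, equivalently whether it is finitely satisfiable. -/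

import Mathlib

open MeasureTheory ProbabilityTheory

universe u

namespace PCTL

/-- The two comparisons that may occur in a probabilistic operator. -/
inductive Cmp where
  | ge
  | gt

/-- `c.Holds p q` is the comparison of a probability `p` with the bound `q`. -/
def Cmp.Holds : Cmp → ℝ → ℝ → Prop
  | .ge, p, q => q ≤ p
  | .gt, p, q => q < p

/-- Formulae of PCTL(F, G) in negation normal form over the atomic propositions `A`;
the probability bounds are rational numbers in `[0, 1]`. -/
inductive Formula (A : Type u) : Type u where
  | atom (a : A)
  | negAtom (a : A)
  | and (φ ψ : Formula A)
  | or (φ ψ : Formula A)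
  | future (c : Cmp) (q : Set.Icc (0 : ℚ) 1) (φ : Formula A)
  | globally (c : Cmp) (q : Set.Icc (0 : ℚ) 1) (φ : Formula A)

namespace Formula

variable {A : Type u}

/-- The length `|φ|`: the number of occurrences of literals, Boolean connectives and temporal
operators in `φ`, where a literal `a` or `¬ a` counts as one symbol. -/
def length : Formula A → ℕ
  | atom _ => 1
  | negAtom _ => 1
  | and φ ψ => φ.length + ψ.length + 1
  | or φ ψ => φ.length + ψ.length + 1
  | future _ _ φ => φ.length + 1
  | globally _ _ φ => φ.length + 1

/-- The fragment `F_q, G_1`: no disjunction, and `G` only with the bound `≥ 1`. -/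
def InFqG1 : Formula A → Prop
  | atom _ => True
  | negAtom _ => True
  | and φ ψ => φ.InFqG1 ∧ ψ.InFqG1
  | or _ _ => False
  | future _ _ φ => φ.InFqG1
  | globally c q φ => c = Cmp.ge ∧ (q : ℚ) = 1 ∧ φ.InFqG1

/-- The code of a comparison in a written formula. -/
def cmpCode : Cmp → ℕ
  | .ge => 0
  | .gt => 1

/-- A formula written as a word over `ℕ` in prefix (Polish) notation, when the atomic proposition
`a` has the number `name a`. A bound is written as its numerator followed by its denominator. -/
def encode (name : A → ℕ) : Formula A → List ℕ
  | atom a => [0, name a]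
  | negAtom a => [1, name a]
  | and φ ψ => 2 :: (φ.encode name ++ ψ.encode name)
  | or φ ψ => 3 :: (φ.encode name ++ ψ.encode name)
  | future c q φ => 4 :: cmpCode c :: (q : ℚ).num.toNat :: (q : ℚ).den :: φ.encode name
  | globally c q φ => 5 :: cmpCode c :: (q : ℚ).num.toNat :: (q : ℚ).den :: φ.encode name

theorem cmpCode_injective : Function.Injective cmpCode := by
  intro c d h
  cases c <;> cases d <;> simp_all [cmpCode]

theorem bound_ext {q r : Set.Icc (0 : ℚ) 1} (hn : (q : ℚ).num.toNat = (r : ℚ).num.toNat)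
    (hd : (q : ℚ).den = (r : ℚ).den) : q = r := by
  have hq := Rat.num_nonneg.2 q.2.1
  have hr := Rat.num_nonneg.2 r.2.1
  exact Subtype.ext (Rat.ext (by omega) hd)

/-- The notation can be read in only one way. -/
theorem encode_append_inj {name : A → ℕ} (hname : Function.Injective name) (φ : Formula A) :
    ∀ (ψ : Formula A) (v w : List ℕ),
      φ.encode name ++ v = ψ.encode name ++ w → φ = ψ ∧ v = w := by
  induction φ with
  | atom a => intro ψ v w h; cases ψ <;> simp_all [encode, hname.eq_iff]
  | negAtom a => intro ψ v w h; cases ψ <;> simp_all [encode, hname.eq_iff]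
  | and φ₁ φ₂ ih₁ ih₂ =>
    intro ψ v w h
    cases ψ <;> simp [encode, List.append_assoc] at h
    obtain ⟨rfl, h'⟩ := ih₁ _ _ _ h
    obtain ⟨rfl, rfl⟩ := ih₂ _ _ _ h'
    exact ⟨rfl, rfl⟩
  | or φ₁ φ₂ ih₁ ih₂ =>
    intro ψ v w h
    cases ψ <;> simp [encode, List.append_assoc] at h
    obtain ⟨rfl, h'⟩ := ih₁ _ _ _ h
    obtain ⟨rfl, rfl⟩ := ih₂ _ _ _ h'
    exact ⟨rfl, rfl⟩
  | future c q φ ih =>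
    intro ψ v w h
    cases ψ <;> simp only [encode, List.cons_append, List.cons.injEq] at h <;>
      try (exact absurd h.1 (by decide))
    obtain ⟨-, hc, hn, hd, h'⟩ := h
    obtain ⟨rfl, rfl⟩ := ih _ _ _ h'
    obtain rfl := cmpCode_injective hc
    obtain rfl := bound_ext hn hd
    exact ⟨rfl, rfl⟩
  | globally c q φ ih =>
    intro ψ v w h
    cases ψ <;> simp only [encode, List.cons_append, List.cons.injEq] at h <;>
      try (exact absurd h.1 (by decide))
    obtain ⟨-, hc, hn, hd, h'⟩ := h
    obtain ⟨rfl, rfl⟩ := ih _ _ _ h'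
    obtain rfl := cmpCode_injective hc
    obtain rfl := bound_ext hn hd
    exact ⟨rfl, rfl⟩

theorem encode_injective {name : A → ℕ} (hname : Function.Injective name) :
    Function.Injective (encode name) := fun φ ψ h =>
  (encode_append_inj hname φ ψ [] [] (by simpa using h)).1

end Formula

/-- A (discrete-time, labelled) Markov chain with a countable set of states. Row `s` of the
transition matrix is the probability mass function `P s`, so `P s t` is the probability of the
transition from `s` to `t`. -/
structure MarkovChain (A : Type u) : Type (max 1 u) where
  /-- the states -/
  S : Type
  countable : Countable S
  /-- the transition probabilities -/
  P : S → PMF S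
  /-- the initial state -/
  s₀ : S
  /-- the labelling -/
  L : S → Set A

namespace MarkovChain

variable {A : Type u} (M : MarkovChain A)

instance : Countable M.S := M.countable

/-- Every set of states is measurable. The `σ`-algebra on runs `ℕ → M.S` is the product one, that
is, the one generated by the cylinders. -/
instance : MeasurableSpace M.S := ⊤

instance : DiscreteMeasurableSpace M.S := ⟨fun _ => trivial⟩

/-- The transition matrix as a Markov kernel. -/
noncomputable def kernel : Kernel M.S M.S := Kernel.ofFunOfCountable fun s => (M.P s).toMeasure

instance : IsMarkovKernel M.kernel :=
  ⟨fun s => inferInstanceAs (IsProbabilityMeasure (M.P s).toMeasure)⟩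

/-- The distribution of the state at time `n + 1`, given the states up to time `n`. -/
noncomputable def stepKernel (n : ℕ) : Kernel (Finset.Iic n → M.S) M.S :=
  M.kernel.comap (fun x => x ⟨n, Finset.mem_Iic.2 le_rfl⟩) (measurable_pi_apply _)

instance (n : ℕ) : IsMarkovKernel (M.stepKernel n) :=
  inferInstanceAs (IsMarkovKernel (M.kernel.comap _ _))

/-- The probability measure on the runs `ℕ → M.S` of the chain started in `s`. -/
noncomputable def runMeasure (s : M.S) : Measure (ℕ → M.S) :=
  Kernel.trajMeasure (X := fun _ => M.S) (Measure.dirac s) M.stepKernel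

instance (s : M.S) : IsProbabilityMeasure (M.runMeasure s) := by
  unfold runMeasure; infer_instance

/-- The measure of a cylinder is the product of the transition probabilities. -/
theorem runMeasure_cylinder (s : M.S) (ρ : ℕ → M.S) (hρ : ρ 0 = s) (n : ℕ) :
    M.runMeasure s {π | ∀ i ≤ n, π i = ρ i} = ∏ i ∈ Finset.range n, M.P (ρ i) (ρ (i + 1)) := by
  have hcyl : ∀ n, {π : ℕ → M.S | ∀ i ≤ n, π i = ρ i} =
      Preorder.frestrictLe (π := fun _ => M.S) n ⁻¹' {Preorder.frestrictLe n ρ} := by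
    intro n
    ext π
    simp [funext_iff]
  induction n with
  | zero =>
    have h0 : {π : ℕ → M.S | ∀ i ≤ 0, π i = ρ i} = (fun π => π 0) ⁻¹' {s} := by
      ext π; simp [hρ]
    have hm : (M.runMeasure s).map (fun π => π 0) = Measure.dirac s := by
      unfold runMeasure Kernel.trajMeasure
      rw [Measure.map_dirac' (MeasurableEquiv.measurable _),
        Measure.dirac_bind (Kernel.measurable _)]
      have := Kernel.traj_map_frestrictLe_apply (X := fun _ => M.S) (κ := M.stepKernel) 0 0
        ((MeasurableEquiv.piUnique fun _ : Finset.Iic 0 => M.S).symm s)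
      rw [Kernel.partialTraj_self, Kernel.id_apply] at this
      have h2 := congrArg (Measure.map fun x => x ⟨0, by simp⟩) this
      rw [Measure.map_map (by fun_prop) (by fun_prop), Measure.map_dirac' (by fun_prop)] at h2
      exact h2
    rw [h0, ← Measure.map_apply (by fun_prop) (MeasurableSet.singleton s), hm]
    simp
  | succ n ih =>
    have key := Kernel.map_frestrictLe_trajMeasure_compProd_eq_map_trajMeasure
      (X := fun _ => M.S) (μ₀ := Measure.dirac s) (κ := M.stepKernel) (a := n)
    change (M.runMeasure s).map _ ⊗ₘ _ = (M.runMeasure s).map _ at key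
    have h1 : {π : ℕ → M.S | ∀ i ≤ n + 1, π i = ρ i} =
        (fun π => (Preorder.frestrictLe (π := fun _ => M.S) n π, π (n + 1))) ⁻¹'
          ({Preorder.frestrictLe n ρ} ×ˢ {ρ (n + 1)}) := by
      ext π
      simp [funext_iff, Nat.le_succ_iff, or_imp, forall_and]
    rw [h1, ← Measure.map_apply (by fun_prop) (by measurability), ← key,
      Measure.compProd_apply_prod (by measurability) (by measurability),
      Measure.restrict_singleton, lintegral_smul_measure, lintegral_dirac,
      Measure.map_apply (by fun_prop) (by measurability), ← hcyl, ih, Finset.prod_range_succ]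
    congr 1
    exact (M.P (ρ n)).toMeasure_apply_singleton _ (MeasurableSet.singleton _)

/-- `M.Sat φ s` is `M, s ⊨ φ`. -/
def Sat : Formula A → M.S → Prop
  | .atom a, s => a ∈ M.L s
  | .negAtom a, s => a ∉ M.L s
  | .and φ ψ, s => Sat φ s ∧ Sat ψ s
  | .or φ ψ, s => Sat φ s ∨ Sat ψ s
  | .future c q φ, s =>
      c.Holds ((M.runMeasure s).real {π | ∃ i, Sat φ (π i)}) ((q : ℚ) : ℝ)
  | .globally c q φ, s =>
      c.Holds ((M.runMeasure s).real {π | ∀ i, Sat φ (π i)}) ((q : ℚ) : ℝ)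

/-- `M` is a model of `φ`. -/
def IsModel (φ : Formula A) : Prop := M.Sat φ M.s₀

/-- The immediate successors of a state. -/
def post (s : M.S) : Set M.S := {t | M.P s t ≠ 0}

/-- The functions `parent` and `depth` exhibit `M` as a tree with back edges: the states form a
tree with root `s₀` (whose `parent` is by convention itself), every edge of this tree is a
transition of `M`, and every other transition of `M` leads from a state to itself or to one of
its ancestors. -/
structure IsTreeWithBackEdges (parent : M.S → M.S) (depth : M.S → ℕ) : Prop where
  parent_root : parent M.s₀ = M.s₀
  depth_root : depth M.s₀ = 0
  depth_parent : ∀ t, t ≠ M.s₀ → depth t = depth (parent t) + 1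
  tree_edge : ∀ t, t ≠ M.s₀ → t ∈ M.post (parent t)
  edge : ∀ s, ∀ t ∈ M.post s, (t ≠ M.s₀ ∧ parent t = s) ∨ ∃ k : ℕ, parent^[k] s = t

/-- `M` is a tree with back edges of height at most `h`, where the height is the number of states
on a longest branch of the tree. (So a branch has at most `h - 1` edges.) -/
def HeightAtMost (h : ℕ) : Prop :=
  ∃ (parent : M.S → M.S) (depth : M.S → ℕ),
    M.IsTreeWithBackEdges parent depth ∧ ∀ s, depth s + 1 ≤ h

/-- Every state has at most `b` immediate successors. -/
def BranchingAtMost (b : ℕ) : Prop := ∀ s, (M.post s).encard ≤ b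

/-- `M` has at most `n` states. -/
def SizeAtMost (n : ℕ) : Prop := Finite M.S ∧ Nat.card M.S ≤ n

end MarkovChain

/-- (General) satisfiability: there is a countable model. -/
def Satisfiable {A : Type u} (φ : Formula A) : Prop := ∃ M : MarkovChain A, M.IsModel φ

/-- Finite satisfiability: there is a finite model. -/
def FinitelySatisfiable {A : Type u} (φ : Formula A) : Prop :=
  ∃ M : MarkovChain A, Finite M.S ∧ M.IsModel φ

end PCTL

/-!
A satisfiable formula of the fragment has a small *certificate*, and a certificate is both a finite
model and an object that an algorithm can search for.

**Certificates.** A lasso is a word of letters with a position to loop back to; each letter names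
the formulas claimed there. A certificate is a finite family of weighted lassos with a common first
letter (`IsCertificate`). It describes the Markov chain that draws a lasso and runs along it forever:
the states are the nodes of the prefix tree of the words, so this chain is a tree with back edges.
Literals, conjunctions and `G` are checked along single lassos, and a claim `F_{▷q} χ` at a node
compares the weight of the lassos through the node that visit `χ` later with the weight of all the
lassos through it. The claims are true in the chain (`Certificate.sat_of_claim`): one step of the
chain averages these conditional weights, so they form a subharmonic function, and in a finite chain
such a function is a lower bound of the hitting probability (`MarkovChain.le_hit_of_subharmonic`).

**From models to certificates.** A model is unfolded from its initial state
(`Certificate.exists_realizes`). A node carries the formulas that have to hold now, the bodies of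
`F`-formulas that have to be visited later, and the bodies of the `G`-formulas that hold from now on.
As long as there is something to be visited, consider where the original run first satisfies one of
the pending bodies. The vector of the visiting probabilities is a countable subconvex combination of
the vectors for these first states; by convexity (`exists_finite_subconvex`) a combination with
new weights and at most one more term than there are pending bodies has the same value. Its terms
become the children of the node; one of them may be zero, which stands for a child that only keeps
up the `G`-formulas. In every other child some pending body has become true, so in all children the
total length of the obligations has decreased; this bounds the height by the length of the
formula. If nothing is pending, the run goes on to a state after which no new
`G`-formula becomes true and then loops through one witness for each `F`-formula below the `G`s
(`Certificate.exists_realizes_of_no_pending`). Every such `F`-formula then holds with probability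
`1` at all nodes above, unless its bound is trivial.

**Decidability.** Claims are words over `ℕ`, and lassos of bounded length over the subformulas form
a finite search space. The conditions on the weights are homogeneous linear inequalities with integer
coefficients, so by Fourier–Motzkin elimination (`exists_small_solution`) they have a solution in
natural numbers of bounded size, and a lasso of weight `m` can be listed `m` times. Hence a bounded
search through lists of lassos decides satisfiability, and it is primitive recursive
(`primrecPred_hasCertificate`).
-/

namespace PCTL

/-! ### Hitting probabilities -/

namespace MarkovChain

variable {A : Type u} (M : MarkovChain A)

/-- The run that starts in `s` and continues with `π`. -/
def consRun (s : M.S) (π : ℕ → M.S) : ℕ → M.S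
  | 0 => s
  | n + 1 => π n

theorem measurable_consRun (s : M.S) : Measurable (M.consRun s) := by
  refine measurable_pi_lambda _ fun n => ?_
  cases n with
  | zero => exact measurable_const
  | succ n => exact measurable_pi_apply n

/-- The runs that agree with `ρ` up to time `n`. -/
def cyl (ρ : ℕ → M.S) (n : ℕ) : Set (ℕ → M.S) := {π | ∀ i ≤ n, π i = ρ i}

theorem measurableSet_cyl (ρ : ℕ → M.S) (n : ℕ) : MeasurableSet (M.cyl ρ n) := by
  have : M.cyl ρ n = ⋂ i, ⋂ (_ : i ≤ n), (fun π : ℕ → M.S => π i) ⁻¹' {ρ i} := by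
    ext π; simp [cyl]
  rw [this]
  exact MeasurableSet.iInter fun i => MeasurableSet.iInter fun _ =>
    measurable_pi_apply i (MeasurableSet.singleton _)

theorem runMeasure_cyl_self (s : M.S) : M.runMeasure s {π | π 0 = s} = 1 := by
  have := M.runMeasure_cylinder s (fun _ => s) rfl 0
  simpa using this

theorem runMeasure_cyl_of_ne {s : M.S} {ρ : ℕ → M.S} (h : ρ 0 ≠ s) (n : ℕ) :
    M.runMeasure s (M.cyl ρ n) = 0 := by
  have hm : MeasurableSet {π : ℕ → M.S | π 0 = s} :=
    measurable_pi_apply (X := fun _ : ℕ => M.S) 0 (MeasurableSet.singleton s)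
  have h0 : M.runMeasure s {π | π 0 = s}ᶜ = 0 := by
    rw [prob_compl_eq_zero_iff hm, runMeasure_cyl_self]
  refine measure_mono_null (fun π hπ => ?_) h0
  have := hπ 0 (Nat.zero_le n)
  simpa [this] using h

theorem isPiSystem_cyl : IsPiSystem (Set.range fun p : (ℕ → M.S) × ℕ => M.cyl p.1 p.2) := by
  rintro _ ⟨⟨ρ, n⟩, rfl⟩ _ ⟨⟨σ, m⟩, rfl⟩ ⟨π, hπ⟩
  refine ⟨⟨π, max n m⟩, ?_⟩
  ext τ
  simp only [cyl, Set.mem_inter_iff, Set.mem_ofPred_eq] at hπ ⊢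
  constructor
  · intro h
    exact ⟨fun i hi => (h i (le_max_of_le_left hi)).trans (hπ.1 i hi),
      fun i hi => (h i (le_max_of_le_right hi)).trans (hπ.2 i hi)⟩
  · rintro ⟨h1, h2⟩ i hi
    rcases le_max_iff.1 hi with hi | hi
    · rw [h1 i hi, hπ.1 i hi]
    · rw [h2 i hi, hπ.2 i hi]

theorem generateFrom_cyl : (MeasurableSpace.pi : MeasurableSpace (ℕ → M.S)) =
    MeasurableSpace.generateFrom (Set.range fun p : (ℕ → M.S) × ℕ => M.cyl p.1 p.2) := by
  apply le_antisymm
  · refine iSup_le fun n => ?_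
    rintro _ ⟨B, -, rfl⟩
    have : (fun π : ℕ → M.S => π n) ⁻¹' B =
        ⋃ x : {x : Fin (n + 1) → M.S // x (Fin.last n) ∈ B},
          M.cyl (fun i => x.1 ⟨min i n, by omega⟩) n := by
      ext π
      simp only [Set.mem_preimage, Set.mem_iUnion, cyl, Set.mem_ofPred_eq, Subtype.exists]
      constructor
      · intro h
        refine ⟨fun i => π i, by simpa using h, fun i hi => by simp [hi]⟩
      · rintro ⟨x, hx, h⟩
        rw [h n le_rfl]
        simpa [Fin.last] using hx
    rw [this]
    exact MeasurableSet.iUnion fun x => MeasurableSpace.measurableSet_generateFrom ⟨⟨_, _⟩, rfl⟩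
  · apply MeasurableSpace.generateFrom_le
    rintro _ ⟨⟨ρ, n⟩, rfl⟩
    exact M.measurableSet_cyl ρ n

/-- The Markov property at time `1`. -/
theorem runMeasure_eq_sum (s : M.S) : M.runMeasure s =
    Measure.sum fun t => M.P s t • (M.runMeasure t).map (M.consRun s) := by
  have hmc := M.measurable_consRun s
  refine ext_of_generate_finite _ M.generateFrom_cyl M.isPiSystem_cyl ?_ ?_
  · rintro _ ⟨⟨ρ, n⟩, rfl⟩
    have hm := M.measurableSet_cyl ρ n
    simp only
    rw [Measure.sum_apply _ hm]
    simp only [Measure.smul_apply, Measure.map_apply hmc hm, smul_eq_mul]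
    by_cases hs : ρ 0 = s
    · cases n with
      | zero =>
        have h1 : M.consRun s ⁻¹' M.cyl ρ 0 = Set.univ := by
          ext π; simp [cyl, consRun, hs]
        have h2 : M.cyl ρ 0 = {π | π 0 = s} := by
          ext π; simp [cyl, hs]
        rw [h1, h2, runMeasure_cyl_self]
        simp [(M.P s).tsum_coe]
      | succ n =>
        have h1 : M.consRun s ⁻¹' M.cyl ρ (n + 1) = M.cyl (fun i => ρ (i + 1)) n := by
          ext π
          simp only [cyl, Set.mem_preimage, Set.mem_ofPred_eq]
          constructor
          · intro h i hi
            exact h (i + 1) (by omega)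
          · intro h i hi
            cases i with
            | zero => exact hs.symm
            | succ i => exact h i (by omega)
        rw [h1, tsum_eq_single (ρ 1) (fun t ht => by
          rw [M.runMeasure_cyl_of_ne (s := t) (by simpa using ht.symm), mul_zero])]
        rw [cyl, cyl, M.runMeasure_cylinder s ρ hs (n + 1),
          M.runMeasure_cylinder (ρ 1) (fun i => ρ (i + 1)) rfl n, Finset.prod_range_succ', hs,
          mul_comm]
    · rw [M.runMeasure_cyl_of_ne hs, eq_comm, ENNReal.tsum_eq_zero]
      intro t
      have : M.consRun s ⁻¹' M.cyl ρ n = ∅ := by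
        ext π
        simp only [cyl, Set.mem_preimage, Set.mem_ofPred_eq, Set.mem_empty_iff_false, iff_false]
        intro h
        exact hs (h 0 (Nat.zero_le n)).symm
      rw [this]; simp
  · rw [Measure.sum_apply _ MeasurableSet.univ]
    simp [Measure.map_apply hmc MeasurableSet.univ, (M.P s).tsum_coe]

theorem runMeasure_apply (s : M.S) {E : Set (ℕ → M.S)} (hE : MeasurableSet E) :
    M.runMeasure s E = ∑' t, M.P s t * M.runMeasure t (M.consRun s ⁻¹' E) := by
  conv_lhs => rw [M.runMeasure_eq_sum s]
  rw [Measure.sum_apply _ hE]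
  simp [Measure.map_apply (M.measurable_consRun s) hE]

/-- The runs that reach `B` and visit only states of `D` before. -/
def untilRuns (D B : Set M.S) : Set (ℕ → M.S) := {π | ∃ n, π n ∈ B ∧ ∀ m < n, π m ∈ D}

theorem measurableSet_coord (n : ℕ) (B : Set M.S) : MeasurableSet {π : ℕ → M.S | π n ∈ B} :=
  measurable_pi_apply (X := fun _ : ℕ => M.S) n (by trivial)

theorem measurableSet_untilRuns (D B : Set M.S) : MeasurableSet (M.untilRuns D B) := by
  have : M.untilRuns D B =
      ⋃ n, ({π | π n ∈ B} ∩ ⋂ m, ⋂ (_ : m < n), {π : ℕ → M.S | π m ∈ D}) := by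
    ext π; simp [untilRuns]
  rw [this]
  exact MeasurableSet.iUnion fun n => (M.measurableSet_coord n B).inter
    (MeasurableSet.iInter fun m => MeasurableSet.iInter fun _ => M.measurableSet_coord m D)

theorem untilRuns_of_mem {D B : Set M.S} {s : M.S} (hs : s ∈ B) :
    M.runMeasure s (M.untilRuns D B) = 1 := by
  rw [M.runMeasure_apply s (M.measurableSet_untilRuns D B)]
  have : M.consRun s ⁻¹' M.untilRuns D B = Set.univ :=
    Set.eq_univ_of_forall fun π => ⟨0, hs, fun m hm => absurd hm (Nat.not_lt_zero m)⟩
  simp [this, (M.P s).tsum_coe]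

theorem untilRuns_step {D B : Set M.S} {s : M.S} (hB : s ∉ B) (hD : s ∈ D) :
    M.runMeasure s (M.untilRuns D B) = ∑' t, M.P s t * M.runMeasure t (M.untilRuns D B) := by
  rw [M.runMeasure_apply s (M.measurableSet_untilRuns D B)]
  have : M.consRun s ⁻¹' M.untilRuns D B = M.untilRuns D B := by
    ext π
    simp only [untilRuns, Set.mem_preimage, Set.mem_ofPred_eq]
    constructor
    · rintro ⟨n, hn, hn'⟩
      cases n with
      | zero => exact absurd hn hB
      | succ n => exact ⟨n, hn, fun m hm => hn' (m + 1) (by omega)⟩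
    · rintro ⟨n, hn, hn'⟩
      refine ⟨n + 1, hn, fun m hm => ?_⟩
      cases m with
      | zero => exact hD
      | succ m => exact hn' m (by omega)
  rw [this]

/-- The probability that a run started in `s` visits `B`. -/
noncomputable def hit (B : Set M.S) (s : M.S) : ENNReal := M.runMeasure s {π | ∃ i, π i ∈ B}

theorem untilRuns_univ (B : Set M.S) : M.untilRuns Set.univ B = {π | ∃ i, π i ∈ B} := by
  simp [untilRuns]

theorem measurableSet_visit (B : Set M.S) : MeasurableSet {π : ℕ → M.S | ∃ i, π i ∈ B} := by
  rw [← untilRuns_univ]; exact M.measurableSet_untilRuns _ _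

theorem hit_of_mem {B : Set M.S} {s : M.S} (hs : s ∈ B) : M.hit B s = 1 := by
  rw [hit, ← untilRuns_univ, M.untilRuns_of_mem hs]

theorem hit_step {B : Set M.S} {s : M.S} (hs : s ∉ B) :
    M.hit B s = ∑' t, M.P s t * M.hit B t := by
  simp only [hit, ← untilRuns_univ]
  exact M.untilRuns_step hs trivial

theorem hit_le_one (B : Set M.S) (s : M.S) : M.hit B s ≤ 1 := prob_le_one

/-- The hitting probability is the least solution of its one-step equation: a function `g` bounds
it from above if, at every state, `g` is superharmonic or the bound is already known. -/
theorem hit_le_of_superharmonic {B : Set M.S} {g : M.S → ENNReal}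
    (hg : ∀ s, M.hit B s ≤ g s ∨ (s ∉ B ∧ ∑' t, M.P s t * g t ≤ g s)) (s : M.S) :
    M.hit B s ≤ g s := by
  have hmeas : ∀ n, MeasurableSet {π : ℕ → M.S | ∃ i ≤ n, π i ∈ B} := fun n => by
    have : {π : ℕ → M.S | ∃ i ≤ n, π i ∈ B} = ⋃ i, ⋃ (_ : i ≤ n), {π | π i ∈ B} := by
      ext π; simp
    rw [this]
    exact MeasurableSet.iUnion fun i => MeasurableSet.iUnion fun _ => M.measurableSet_coord i B
  have hstep : ∀ n s, M.runMeasure s {π | ∃ i ≤ n, π i ∈ B} ≤ g s := by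
    intro n
    induction n with
    | zero =>
      intro s
      rcases hg s with h | ⟨hs, -⟩
      · refine le_trans (measure_mono ?_) h
        rintro π ⟨i, -, hi⟩
        exact ⟨i, hi⟩
      · refine le_trans (le_of_eq ?_) (zero_le)
        rw [M.runMeasure_apply s (hmeas 0)]
        have : M.consRun s ⁻¹' {π | ∃ i ≤ 0, π i ∈ B} = ∅ := by
          ext π; simpa [consRun] using hs
        simp only [this, measure_empty, mul_zero, tsum_zero]
    | succ n ih =>
      intro s
      rcases hg s with h | ⟨hs, h⟩
      · refine le_trans (measure_mono ?_) h
        rintro π ⟨i, -, hi⟩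
        exact ⟨i, hi⟩
      · refine le_trans ?_ h
        rw [M.runMeasure_apply s (hmeas (n + 1))]
        have : M.consRun s ⁻¹' {π | ∃ i ≤ n + 1, π i ∈ B} = {π | ∃ i ≤ n, π i ∈ B} := by
          ext π
          simp only [Set.mem_preimage, Set.mem_ofPred_eq]
          constructor
          · rintro ⟨i, hi, hi'⟩
            cases i with
            | zero => exact absurd hi' hs
            | succ i => exact ⟨i, by omega, hi'⟩
          · rintro ⟨i, hi, hi'⟩
            exact ⟨i + 1, by omega, hi'⟩
        rw [this]
        gcongr with t
        exact ih t
  have hU : {π : ℕ → M.S | ∃ i, π i ∈ B} = ⋃ n, {π | ∃ i ≤ n, π i ∈ B} := by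
    ext π
    simp only [Set.mem_ofPred_eq, Set.mem_iUnion]
    exact ⟨fun ⟨i, hi⟩ => ⟨i, i, le_rfl, hi⟩, fun ⟨_, i, _, hi⟩ => ⟨i, hi⟩⟩
  have hmono : Monotone fun n => {π : ℕ → M.S | ∃ i ≤ n, π i ∈ B} := by
    rintro m n hmn π ⟨i, hi, hi'⟩
    exact ⟨i, hi.trans hmn, hi'⟩
  rw [hit, hU, hmono.measure_iUnion]
  exact iSup_le fun n => hstep n s

/-- `t` can be reached from `s` by transitions of positive probability. -/
def Reach : M.S → M.S → Prop := Relation.ReflTransGen fun s t => M.P s t ≠ 0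

theorem hit_ne_zero_of_reach {B : Set M.S} {s t : M.S} (h : M.Reach s t) (ht : t ∈ B) :
    M.hit B s ≠ 0 := by
  induction h using Relation.ReflTransGen.head_induction_on with
  | refl => simp [M.hit_of_mem ht]
  | head h _ ih =>
    rename_i a c _
    by_cases ha : a ∈ B
    · simp [M.hit_of_mem ha]
    · rw [M.hit_step ha]
      intro h0
      rw [ENNReal.tsum_eq_zero] at h0
      rcases mul_eq_zero.1 (h0 c) with h1 | h1
      · exact h h1
      · exact ih h1

theorem hit_ne_zero_iff {B : Set M.S} {s : M.S} :
    M.hit B s ≠ 0 ↔ ∃ t ∈ B, M.Reach s t := by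
  classical
  refine ⟨fun h => ?_, fun ⟨t, ht, hst⟩ => M.hit_ne_zero_of_reach hst ht⟩
  by_contra hn
  apply h
  have := M.hit_le_of_superharmonic (B := B)
    (g := fun s => if ∃ t ∈ B, M.Reach s t then 1 else 0) (fun s => ?_) s
  · simpa [hn] using this
  · by_cases hs : ∃ t ∈ B, M.Reach s t
    · left; simpa [hs] using M.hit_le_one B s
    · right
      refine ⟨fun hB => hs ⟨s, hB, .refl⟩, ?_⟩
      simp only [hs, if_false, nonpos_iff_eq_zero, ENNReal.tsum_eq_zero]
      intro t
      by_cases hP : M.P s t = 0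
      · simp [hP]
      · have : ¬ ∃ r ∈ B, M.Reach t r := fun ⟨r, hr, htr⟩ => hs ⟨r, hr, .head hP htr⟩
        simp [this]

/-- `G_{≥1}` holds in a state if and only if its argument holds in all reachable states. -/
theorem always_iff (B : Set M.S) (s : M.S) :
    (1 : ℝ) ≤ (M.runMeasure s).real {π | ∀ i, π i ∈ B} ↔ ∀ t, M.Reach s t → t ∈ B := by
  have hc : {π : ℕ → M.S | ∀ i, π i ∈ B}ᶜ = {π | ∃ i, π i ∈ Bᶜ} := by
    ext π; simp
  have hm : MeasurableSet {π : ℕ → M.S | ∀ i, π i ∈ B} :=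
    MeasurableSet.of_compl (hc ▸ M.measurableSet_visit Bᶜ)
  have h1 : (1 : ℝ) ≤ (M.runMeasure s).real {π | ∀ i, π i ∈ B} ↔ M.hit Bᶜ s = 0 := by
    rw [hit, ← hc, prob_compl_eq_zero_iff hm]
    constructor
    · intro h
      have := le_antisymm measureReal_le_one h
      rw [measureReal_def] at this
      rwa [ENNReal.toReal_eq_one_iff] at this
    · intro h
      rw [measureReal_def, h]; simp
  rw [h1, ← not_iff_not, ← ne_eq, hit_ne_zero_iff]
  push Not
  exact ⟨fun ⟨t, h1, h2⟩ => ⟨t, h2, h1⟩, fun ⟨t, h1, h2⟩ => ⟨t, h2, h1⟩⟩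

/-- In a finite chain, a subharmonic function that is at most `1` on the target and positive only
where the target can be reached is a lower bound of the hitting probability: the difference cannot
have a negative minimum, because the minimum would propagate to the target. -/
theorem le_hit_of_subharmonic [Fintype M.S] {B : Set M.S} {f : M.S → ℝ}
    (hB : ∀ s ∈ B, f s ≤ 1) (hf : ∀ s ∉ B, f s ≤ ∑ t, (M.P s t).toReal * f t)
    (hr : ∀ s, 0 < f s → ∃ t ∈ B, M.Reach s t) (s : M.S) : f s ≤ (M.hit B s).toReal := by
  have hne : ∀ s, M.hit B s ≠ ⊤ := fun s => ne_top_of_le_ne_top ENNReal.one_ne_top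
    (M.hit_le_one B s)
  set D : M.S → ℝ := fun s => (M.hit B s).toReal - f s with hD
  have hsum : ∀ s, ∑ t, (M.P s t).toReal = 1 := fun s => by
    rw [← ENNReal.toReal_sum fun t _ => (M.P s).apply_ne_top t,
      ← tsum_fintype (L := .unconditional _), (M.P s).tsum_coe]
    simp
  have hDstep : ∀ s ∉ B, ∑ t, (M.P s t).toReal * D t ≤ D s := by
    intro s hs
    have h1 : (M.hit B s).toReal = ∑ t, (M.P s t).toReal * (M.hit B t).toReal := by
      rw [M.hit_step hs, tsum_fintype, ENNReal.toReal_sum]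
      · simp
      · exact fun t _ => ENNReal.mul_ne_top ((M.P s).apply_ne_top t) (hne t)
    simp only [hD, mul_sub, Finset.sum_sub_distrib]
    linarith [hf s hs]
  obtain ⟨m, -, hm⟩ := Finset.exists_min_image Finset.univ D ⟨s, Finset.mem_univ s⟩
  by_contra hlt
  push Not at hlt
  have hmneg : D m < 0 := lt_of_le_of_lt (hm s (Finset.mem_univ s)) (by simp only [hD]; linarith)
  have hfm : 0 < f m := by
    have : 0 ≤ (M.hit B m).toReal := ENNReal.toReal_nonneg
    simp only [hD] at hmneg; linarith
  obtain ⟨t, ht, hmt⟩ := hr m hfm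
  -- along a path to the target, the minimum is kept until the target is met
  have key : ∀ a, M.Reach a t → D a = D m → False := by
    intro a ha
    have hBD : ∀ b ∈ B, D b = D m → False := fun b hb hbD => by
      have h1 : D b = 1 - f b := by simp [hD, M.hit_of_mem hb]
      have := hB b hb
      linarith
    induction ha using Relation.ReflTransGen.head_induction_on with
    | refl => exact hBD t ht
    | head h _ ih =>
      rename_i a c _
      intro haD
      by_cases haB : a ∈ B
      · exact hBD a haB haD
      · apply ih
        have h1 := hDstep a haB
        have h2 : ∑ t, (M.P a t).toReal * (D t - D m) ≤ 0 := by
          simp only [mul_sub, Finset.sum_sub_distrib, ← Finset.sum_mul, hsum]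
          linarith
        have h3 : ∀ t ∈ Finset.univ, 0 ≤ (M.P a t).toReal * (D t - D m) := fun t _ =>
          mul_nonneg ENNReal.toReal_nonneg (sub_nonneg.2 (hm t (Finset.mem_univ t)))
        have h4 := (Finset.sum_eq_zero_iff_of_nonneg h3).1 (le_antisymm h2 (Finset.sum_nonneg h3)) c
          (Finset.mem_univ c)
        rcases mul_eq_zero.1 h4 with h5 | h5
        · exact absurd ((ENNReal.toReal_eq_zero_iff _).1 h5) (by simp [h, (M.P a).apply_ne_top])
        · linarith
  exact key m hmt rfl

/-- The probability that a run started in `s` visits `T`, and does so first in the state `t`. -/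
noncomputable def firstHit (T : Set M.S) (s t : M.S) : ENNReal :=
  M.runMeasure s (M.untilRuns Tᶜ (T ∩ {t}))

theorem firstHit_ne_zero {T : Set M.S} {s t : M.S} (h : M.firstHit T s t ≠ 0) :
    t ∈ T ∧ M.Reach s t := by
  have h1 : M.hit (T ∩ {t}) s ≠ 0 := fun h0 =>
    h (measure_mono_null (by rintro π ⟨n, hn, -⟩; exact ⟨n, hn⟩) h0)
  obtain ⟨r, ⟨hr, rfl⟩, hsr⟩ := M.hit_ne_zero_iff.1 h1
  exact ⟨hr, hsr⟩

theorem tsum_firstHit_le (T : Set M.S) (s : M.S) : ∑' t, M.firstHit T s t ≤ 1 := by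
  have hd : Pairwise (Function.onFun Disjoint fun t => M.untilRuns Tᶜ (T ∩ {t})) := by
    intro t r htr
    refine Set.disjoint_left.2 ?_
    rintro π ⟨n, ⟨hn, hnt⟩, hn'⟩ ⟨m, ⟨hm, hmr⟩, hm'⟩
    rcases lt_trichotomy n m with h | rfl | h
    · exact hm' n h hn
    · exact htr (hnt.symm.trans hmr)
    · exact hn' m h hm
  simp only [firstHit]
  rw [← measure_iUnion hd fun t => M.measurableSet_untilRuns _ _]
  exact prob_le_one

/-- Decomposition of a hitting probability at the first visit to a larger set. -/
theorem hit_le_tsum_firstHit {T B : Set M.S} (hBT : B ⊆ T) (s : M.S) :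
    M.hit B s ≤ ∑' t, M.firstHit T s t * M.hit B t := by
  refine M.hit_le_of_superharmonic (g := fun s => ∑' t, M.firstHit T s t * M.hit B t)
    (fun s => ?_) s
  by_cases hs : s ∈ T
  · left
    calc M.hit B s = M.firstHit T s s * M.hit B s := by
          rw [firstHit, M.untilRuns_of_mem (show s ∈ T ∩ {s} from ⟨hs, rfl⟩), one_mul]
      _ ≤ _ := ENNReal.le_tsum s
  · right
    refine ⟨fun h => hs (hBT h), le_of_eq ?_⟩
    have h1 : ∀ t, M.firstHit T s t = ∑' r, M.P s r * M.firstHit T r t := fun t =>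
      M.untilRuns_step (fun h => hs h.1) hs
    simp only [h1, ← ENNReal.tsum_mul_right, ← ENNReal.tsum_mul_left]
    rw [ENNReal.tsum_comm]
    simp only [mul_assoc]

end MarkovChain
end PCTL

namespace PCTL

/-! ### Finite convex combinations -/

/-- In finite dimension, a countable convex combination is a finite one. If it were not, a nonzero
functional would be nonnegative on all the points, hence zero on all those of positive weight, and
the dimension can be lowered. -/
theorem zero_mem_convexHull_of_hasSum {T : Type*} {c : T → ℝ} (hc : ∀ t, 0 ≤ c t)
    (hc1 : HasSum c 1) : ∀ (n : ℕ) (E : Type) [NormedAddCommGroup E] [NormedSpace ℝ E]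
    [FiniteDimensional ℝ E], Module.finrank ℝ E = n → ∀ w : T → E,
    HasSum (fun t => c t • w t) 0 → (0 : E) ∈ convexHull ℝ (w '' {t | c t ≠ 0}) := by
  intro n
  induction n using Nat.strong_induction_on with
  | _ n ih =>
  intro E _ _ _ hn w hw
  by_contra h0
  set S : Set E := convexHull ℝ (w '' {t | c t ≠ 0}) with hS
  have hwS : ∀ t, c t ≠ 0 → w t ∈ S := fun t ht => subset_convexHull ℝ _ ⟨t, ht, rfl⟩
  obtain ⟨t₀, ht₀⟩ : ∃ t, c t ≠ 0 := by
    by_contra hn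
    push Not at hn
    have : HasSum c 0 := by
      rw [show c = fun _ => 0 from funext hn]; exact hasSum_zero
    exact one_ne_zero (hc1.unique this)
  have key : ∃ f : E →L[ℝ] ℝ, f ≠ 0 ∧ ∀ t, c t ≠ 0 → f (w t) = 0 := by
    have hfsum : ∀ f : E →L[ℝ] ℝ, HasSum (fun t => c t * f (w t)) 0 := fun f => by
      simpa using f.hasSum hw
    by_cases hint : (interior S).Nonempty
    · obtain ⟨f, hf, hfS⟩ := geometric_hahn_banach_of_nonempty_interior_point
        (convex_convexHull ℝ _) (fun h => h0 (interior_subset h)) hint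
      refine ⟨f, hf, fun t ht => ?_⟩
      have h1 : HasSum (fun t => -(c t * f (w t))) 0 := by simpa using (hfsum f).neg
      have h2 : ∀ t, 0 ≤ -(c t * f (w t)) := fun t => by
        by_cases h : c t = 0
        · simp [h]
        · have := hfS _ (hwS t h)
          rw [map_zero] at this
          nlinarith [hc t]
      have h3 := (hasSum_zero_iff_of_nonneg h2).1 h1
      have := congrFun h3 t
      simpa [ht] using this
    · rw [(convex_convexHull ℝ _).interior_nonempty_iff_affineSpan_eq_top] at hint
      have hne : (affineSpan ℝ S : Set E).Nonempty := ⟨_, subset_affineSpan ℝ S (hwS t₀ ht₀)⟩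
      have hdir : (affineSpan ℝ S).direction < ⊤ := by
        rw [lt_top_iff_ne_top, ne_eq, AffineSubspace.direction_eq_top_iff_of_nonempty hne]
        exact hint
      obtain ⟨f, hf, hker⟩ := Submodule.exists_le_ker_of_lt_top _ hdir
      refine ⟨LinearMap.toContinuousLinearMap f, by simpa using hf, ?_⟩
      have hconst : ∀ t, c t ≠ 0 → f (w t) = f (w t₀) := fun t ht => by
        have := hker (AffineSubspace.vsub_mem_direction (subset_affineSpan ℝ S (hwS t ht))
          (subset_affineSpan ℝ S (hwS t₀ ht₀)))
        rw [LinearMap.mem_ker, vsub_eq_sub, map_sub, sub_eq_zero] at this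
        exact this
      have h1 := hfsum (LinearMap.toContinuousLinearMap f)
      have h2 : (fun t => c t * (LinearMap.toContinuousLinearMap f) (w t)) =
          fun t => c t * f (w t₀) := by
        funext t
        by_cases h : c t = 0
        · simp [h]
        · simp [hconst t h]
      rw [h2] at h1
      have h3 : f (w t₀) = 0 := by
        have := (hc1.mul_right (f (w t₀))).unique h1
        simpa using this
      intro t ht
      simp [hconst t ht, h3]
  obtain ⟨f, hf, hf0⟩ := key
  classical
  set K := LinearMap.ker (f : E →ₗ[ℝ] ℝ) with hK
  have hlt : Module.finrank ℝ K < n := by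
    rw [← hn]
    apply Submodule.finrank_lt
    intro h
    apply hf
    ext x
    have : x ∈ K := by rw [h]; trivial
    simpa [hK] using this
  let w' : T → K := fun t => if h : c t ≠ 0 then ⟨w t, by simpa [hK] using hf0 t h⟩ else 0
  have hw' : ∀ t, c t ≠ 0 → (w' t : E) = w t := fun t h => by simp [w', h]
  have hsum : HasSum (fun t => c t • w' t) 0 := by
    rw [← Topology.IsInducing.subtypeVal.hasSum_iff (g := K.subtype)]
    convert hw using 1
    funext t
    by_cases h : c t = 0
    · simp [h]
    · simp [hw' t h]
    · rfl
  have := ih _ hlt K rfl w' hsum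
  apply h0
  have h2 : K.subtype (0 : K) ∈ K.subtype '' convexHull ℝ (w' '' {t | c t ≠ 0}) := ⟨0, this, rfl⟩
  rw [LinearMap.image_convexHull] at h2
  rw [map_zero] at h2
  convert h2 using 2
  ext x
  simp only [Set.mem_image, Set.mem_ofPred_eq]
  constructor
  · rintro ⟨t, ht, rfl⟩
    exact ⟨w' t, ⟨t, ht, rfl⟩, hw' t ht⟩
  · rintro ⟨_, ⟨t, ht, rfl⟩, rfl⟩
    exact ⟨t, ht, (hw' t ht).symm⟩

theorem hasSum_option {T : Type*} {f : Option T → ℝ} {x : ℝ}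
    (h : HasSum (fun t => f (some t)) x) : HasSum f (f none + x) := by
  classical
  have h1 : HasSum (fun o => if o = none then 0 else f o) x := by
    rw [← (Option.some_injective T).hasSum_iff (fun o ho => by
      cases o with
      | none => simp
      | some t => exact absurd ⟨t, rfl⟩ ho)]
    simpa [Function.comp_def] using h
  convert (hasSum_ite_eq none (f none)).add h1 using 1
  funext o
  cases o <;> simp

/-- A countable subconvex combination of vectors of the unit cube is a convex combination of at
most `|κ| + 1` of them and zero (which is represented by `none`). -/
theorem exists_finite_subconvex {T : Type} {κ : Type} [Fintype κ] (c : T → ENNReal)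
    (hc : ∑' t, c t ≤ 1) (h : T → κ → ENNReal) (hh : ∀ t i, h t i ≤ 1) :
    ∃ m ≤ Fintype.card κ + 1, ∃ (τ : Fin m → Option T) (a : Fin m → ℝ),
      (∀ j, 0 < a j) ∧ ∑ j, a j = 1 ∧ (∀ j t, τ j = some t → c t ≠ 0) ∧
      ∀ i, (∑' t, c t * h t i).toReal =
        ∑ j, a j * ((τ j).elim 0 fun t => (h t i).toReal) := by
  classical
  have hcne : ∀ t, c t ≠ ⊤ := fun t =>
    ne_top_of_le_ne_top ENNReal.one_ne_top ((ENNReal.le_tsum t).trans hc)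
  have hctop : ∑' t, c t ≠ ⊤ := ne_top_of_le_ne_top ENNReal.one_ne_top hc
  set v : κ → ℝ := fun i => (∑' t, c t * h t i).toReal with hv
  let C : Option T → ℝ := fun o => o.elim (1 - (∑' t, c t).toReal) fun t => (c t).toReal
  let W : Option T → κ → ℝ := fun o i => o.elim 0 fun t => (h t i).toReal
  have hC : ∀ o, 0 ≤ C o := by
    rintro (_ | t)
    · simp only [C, Option.elim, sub_nonneg]
      exact ENNReal.toReal_le_of_le_ofReal zero_le_one (by simpa using hc)
    · exact ENNReal.toReal_nonneg
  have hsomeC : HasSum (fun t => (c t).toReal) (∑' t, c t).toReal :=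
    ENNReal.tsum_toReal_eq hcne ▸ ENNReal.hasSum_toReal hctop
  have hC1 : HasSum C 1 := by
    have := hasSum_option (f := C) hsomeC
    simpa [C] using this
  have hWi : ∀ i, HasSum (fun o => C o * W o i) (v i) := by
    intro i
    have hle : ∀ t, c t * h t i ≤ c t := fun t => mul_le_of_le_one_right' (hh t i)
    have hne : ∑' t, c t * h t i ≠ ⊤ := ne_top_of_le_ne_top hctop (ENNReal.tsum_le_tsum hle)
    have h1 := ENNReal.hasSum_toReal hne
    rw [← ENNReal.tsum_toReal_eq fun t => ne_top_of_le_ne_top (hcne t) (hle t)] at h1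
    have := hasSum_option (f := fun o => C o * W o i) (by simpa [C, W] using h1)
    simpa [C, W] using this
  have hW0 : HasSum (fun o => C o • (W o - v)) 0 := by
    rw [Pi.hasSum]
    intro i
    have := (hWi i).sub (hC1.mul_right (v i))
    simpa [mul_sub] using this
  have h0 := zero_mem_convexHull_of_hasSum hC hC1 _ (κ → ℝ) rfl (fun o => W o - v) hW0
  obtain ⟨ι, _, z, a, hz, hind, ha, ha1, haz⟩ := eq_pos_convex_span_of_mem_convexHull h0
  have hcard : Fintype.card ι ≤ Fintype.card κ + 1 := by
    refine hind.card_le_finrank_succ.trans ?_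
    gcongr
    exact (Submodule.finrank_le _).trans (by simp)
  choose o ho hoz using fun j : ι => hz ⟨j, rfl⟩
  let e := Fintype.equivFin ι
  refine ⟨Fintype.card ι, hcard, fun j => o (e.symm j), fun j => a (e.symm j),
    fun j => ha _, by rw [← ha1]; exact Equiv.sum_comp e.symm a, ?_, fun i => ?_⟩
  · intro j t ht h0
    have := ho (e.symm j)
    simp only at ht
    simp [ht, C, h0] at this
  · have h1 := congrFun haz i
    simp only [Finset.sum_apply, Pi.smul_apply, smul_eq_mul, Pi.zero_apply, ← hoz, Pi.sub_apply,
      mul_sub, Finset.sum_sub_distrib, ← Finset.sum_mul, ha1] at h1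
    have h2 : v i = ∑ j, a j * W (o j) i := by linarith
    change v i = _
    rw [h2, ← Equiv.sum_comp e.symm]
end PCTL

namespace PCTL

/-! ### Small solutions of linear inequalities -/

/-- The inequality `0 < v` if `b` is true, and `0 ≤ v` otherwise. -/
def SignHolds (b : Bool) (v : ℝ) : Prop := if b then 0 < v else 0 ≤ v

theorem SignHolds.mul_pos {b : Bool} {v d : ℝ} (hd : 0 < d) (h : SignHolds b v) :
    SignHolds b (d * v) := by
  cases b <;> simp only [SignHolds] at h ⊢ <;> simp at h ⊢ <;> positivity

theorem SignHolds.of_mul_pos {b : Bool} {v d : ℝ} (hd : 0 < d) (h : SignHolds b (d * v)) :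
    SignHolds b v := by
  have := h.mul_pos (inv_pos.2 hd)
  rwa [inv_mul_cancel_left₀ hd.ne'] at this

theorem signHolds_or_add {b b' : Bool} {v v' : ℝ} (h : SignHolds b v) (h' : SignHolds b' v') :
    SignHolds (b || b') (v + v') := by
  cases b <;> cases b' <;> simp [SignHolds] at h h' ⊢ <;> linarith

/-- A point that satisfies lower and upper bounds, some of them strict: the midpoint of the largest
lower and the smallest upper bound does, if each pair of bounds is consistent. -/
theorem signHolds_midpoint {α : Type*} {Lo Up : Set α} {L U : α → ℝ} {b : α → Bool}
    (h : ∀ r ∈ Lo, ∀ s ∈ Up, SignHolds (b r || b s) (U s - L r)) {r s : α} (hr : r ∈ Lo)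
    (hs : s ∈ Up) (hmax : ∀ r' ∈ Lo, L r' ≤ L r) (hmin : ∀ s' ∈ Up, U s ≤ U s') :
    (∀ r' ∈ Lo, SignHolds (b r') ((L r + U s) / 2 - L r')) ∧
      ∀ s' ∈ Up, SignHolds (b s') (U s' - (L r + U s) / 2) := by
  have hle : L r ≤ U s := by
    have := h r hr s hs
    cases hb : (b r || b s) <;> simp [SignHolds, hb] at this <;> linarith
  constructor
  · intro r' hr'
    have h1 := h r' hr' s hs
    have h2 := hmax r' hr'
    cases hb : b r' <;> simp [SignHolds, hb] at h1 ⊢ <;> linarith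
  · intro s' hs'
    have h1 := h r hr s' hs'
    have h2 := hmin s' hs'
    cases hb : b s' <;> simp [SignHolds, hb] at h1 ⊢ <;> linarith

theorem small_solution_bound (N K : ℕ) (hK : 1 ≤ K) :
    2 * K ^ 2 * (N + 1) * ((2 * (2 * K ^ 2) * (N + 1)) ^ 5 ^ N + 1) ≤
      (2 * K * (N + 2)) ^ 5 ^ (N + 1) := by
  set c := 2 * K * (N + 2) with hc
  have hc2 : 2 ≤ c := by nlinarith
  have h1 : 2 * (2 * K ^ 2) * (N + 1) ≤ c ^ 2 := by
    rw [hc]; nlinarith [Nat.zero_le (K ^ 2 * N), Nat.zero_le (K ^ 2 * N ^ 2), Nat.zero_le (K ^ 2)]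
  have h2 : (2 * (2 * K ^ 2) * (N + 1)) ^ 5 ^ N + 1 ≤ c ^ (2 * 5 ^ N + 1) := by
    have h3 : (2 * (2 * K ^ 2) * (N + 1)) ^ 5 ^ N ≤ c ^ (2 * 5 ^ N) := by
      rw [pow_mul]; exact Nat.pow_le_pow_left h1 _
    have h4 : 1 ≤ c ^ (2 * 5 ^ N) := Nat.one_le_pow _ _ (by omega)
    rw [pow_succ c]; nlinarith
  calc _ ≤ c ^ 2 * c ^ (2 * 5 ^ N + 1) := by
        apply Nat.mul_le_mul _ h2
        refine le_trans ?_ h1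
        nlinarith [Nat.zero_le (K ^ 2 * (N + 1))]
    _ = c ^ (2 * 5 ^ N + 3) := by rw [← pow_add]; congr 1; omega
    _ ≤ _ := Nat.pow_le_pow_right (by omega) (by
        rw [pow_succ]
        have := Nat.one_le_pow N 5 (by norm_num)
        omega)

/-- A solvable homogeneous system of integer inequalities in `N` unknowns with coefficients of
absolute value at most `K` has an integral solution of bounded size. This is Fourier–Motzkin
elimination: eliminating an unknown squares the bound of the coefficients, and a solution of the
reduced system extends to the unknown by the midpoint of its bounds, whose denominator is cleared
by homogeneity. -/
theorem exists_small_solution (N : ℕ) : ∀ (K : ℕ), 1 ≤ K → ∀ R : Set ((Fin N → ℤ) × Bool),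
    (∀ r ∈ R, ∀ j, |r.1 j| ≤ K) →
    (∃ x : Fin N → ℝ, ∀ r ∈ R, SignHolds r.2 (∑ j, (r.1 j : ℝ) * x j)) →
    ∃ y : Fin N → ℤ, (∀ j, |y j| ≤ ((2 * K * (N + 1)) ^ 5 ^ N : ℕ)) ∧
      ∀ r ∈ R, SignHolds r.2 (∑ j, (r.1 j : ℝ) * y j) := by
  induction N with
  | zero =>
    rintro K - R - ⟨x, hx⟩
    exact ⟨fun _ => 0, fun j => j.elim0, fun r hr => by simpa using hx r hr⟩
  | succ N ih =>
    rintro K hK R hR ⟨x, hx⟩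
    have hK' : (1 : ℤ) ≤ K := by exact_mod_cast hK
    set R' : Set ((Fin N → ℤ) × Bool) :=
      {q | ∃ r ∈ R, r.1 0 = 0 ∧ q = (fun j => r.1 j.succ, r.2)} ∪
      {q | ∃ r ∈ R, ∃ s ∈ R, 0 < r.1 0 ∧ s.1 0 < 0 ∧
        q = (fun j => r.1 0 * s.1 j.succ + -s.1 0 * r.1 j.succ, r.2 || s.2)} with hR'def
    have hR' : ∀ r ∈ R', ∀ j, |r.1 j| ≤ (2 * K ^ 2 : ℕ) := by
      rintro _ (⟨r, hr, -, rfl⟩ | ⟨r, hr, s, hs, -, -, rfl⟩) j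
      · refine (hR r hr _).trans ?_
        push_cast; nlinarith
      · have h1 : |r.1 0 * s.1 j.succ| ≤ K * K := by
          rw [abs_mul]
          exact mul_le_mul (hR r hr _) (hR s hs _) (abs_nonneg _) (by positivity)
        have h2 : |-s.1 0 * r.1 j.succ| ≤ K * K := by
          rw [abs_mul, abs_neg]
          exact mul_le_mul (hR s hs _) (hR r hr _) (abs_nonneg _) (by positivity)
        refine (abs_add_le _ _).trans ?_
        push_cast; linarith
    -- the value of the part of a row that does not involve the eliminated unknown
    have hcomb : ∀ (z : Fin N → ℝ) (r s : (Fin (N + 1) → ℤ) × Bool),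
        ∑ j, ((r.1 0 * s.1 j.succ + -s.1 0 * r.1 j.succ : ℤ) : ℝ) * z j =
          (r.1 0 : ℝ) * (∑ j, (s.1 j.succ : ℝ) * z j) +
            -(s.1 0 : ℝ) * ∑ j, (r.1 j.succ : ℝ) * z j := by
      intro z r s
      rw [Finset.mul_sum, Finset.mul_sum, ← Finset.sum_add_distrib]
      refine Finset.sum_congr rfl fun j _ => ?_
      push_cast; ring
    obtain ⟨y, hy, hyR⟩ := ih (2 * K ^ 2) (by nlinarith) R' hR' ⟨fun j => x j.succ, by
      rintro _ (⟨r, hr, h0, rfl⟩ | ⟨r, hr, s, hs, hr0, hs0, rfl⟩)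
      · have := hx r hr
        rw [Fin.sum_univ_succ, h0] at this
        simpa using this
      · simp only
        rw [hcomb]
        have h1 := (hx r hr).mul_pos (d := -(s.1 0 : ℝ)) (by exact_mod_cast neg_pos.2 hs0)
        have h2 := (hx s hs).mul_pos (d := (r.1 0 : ℝ)) (by exact_mod_cast hr0)
        rw [Fin.sum_univ_succ] at h1 h2
        have := signHolds_or_add h1 h2
        convert this using 1
        ring⟩
    set B := (2 * (2 * K ^ 2) * (N + 1)) ^ 5 ^ N with hB
    set V : (Fin (N + 1) → ℤ) × Bool → ℤ := fun r => ∑ j : Fin N, r.1 j.succ * y j with hV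
    have hVr : ∀ r, (V r : ℝ) = ∑ j : Fin N, (r.1 j.succ : ℝ) * y j := fun r => by simp [hV]
    have hVb : ∀ r ∈ R, |V r| ≤ N * K * B := fun r hr => by
      refine (Finset.abs_sum_le_sum_abs _ _).trans ?_
      have : ∀ j ∈ Finset.univ, |r.1 (Fin.succ j) * y j| ≤ K * B := fun j _ => by
        rw [abs_mul]
        exact mul_le_mul (hR r hr _) (hy j) (abs_nonneg _) (by positivity)
      refine (Finset.sum_le_card_nsmul _ _ _ this).trans (le_of_eq ?_)
      simp; ring
    have hbound : (2 * K ^ 2 * (N + 1) * (B + 1) : ℤ) ≤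
        ((2 * K * ((N + 1 : ℕ) + 1)) ^ 5 ^ (N + 1) : ℕ) := by
      exact_mod_cast small_solution_bound N K hK
    have hB0 : (0 : ℤ) ≤ B := by positivity
    -- it suffices to find a rational value of the eliminated unknown with a small denominator
    suffices h : ∃ (D Y : ℤ) (v : ℝ), 0 < D ∧ D ≤ 2 * K ^ 2 ∧ |Y| ≤ 2 * K ^ 2 * (N + 1) * (B + 1) ∧
        (Y : ℝ) = D * v ∧ ∀ r ∈ R, SignHolds r.2 (V r + r.1 0 * v) by
      obtain ⟨D, Y, v, hD, hDK, hY, hYD, hv⟩ := h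
      refine ⟨Fin.cons Y fun j => D * y j, fun j => ?_, fun r hr => ?_⟩
      · refine le_trans ?_ hbound
        refine Fin.cases ?_ (fun j => ?_) j
        · simpa using hY
        · simp only [Fin.cons_succ, abs_mul, abs_of_pos hD]
          calc D * |y j| ≤ 2 * K ^ 2 * B := mul_le_mul hDK (hy j) (abs_nonneg _) (by positivity)
            _ ≤ 2 * K ^ 2 * (N + 1) * (B + 1) := by
              rw [mul_assoc (2 * (K : ℤ) ^ 2)]
              refine mul_le_mul_of_nonneg_left ?_ (by positivity)
              nlinarith [mul_nonneg (Int.natCast_nonneg N) hB0]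
      · have := (hv r hr).mul_pos (d := (D : ℝ)) (by exact_mod_cast hD)
        convert this using 1
        rw [Fin.sum_univ_succ, Fin.cons_zero, hYD, hVr, mul_add, Finset.mul_sum, add_comm]
        congr 1
        · refine Finset.sum_congr rfl fun j _ => ?_
          simp only [Fin.cons_succ]; push_cast; ring
        · ring
    have hfin : R.Finite := by
      refine Set.Finite.subset (Set.Finite.prod (Set.Finite.pi' fun _ : Fin (N + 1) =>
        Set.finite_Icc (-(K : ℤ)) K) (Set.finite_univ (α := Bool))) fun r hr => ?_
      exact ⟨fun j => abs_le.1 (hR r hr j), trivial⟩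
    set Lo := {r | r ∈ R ∧ 0 < r.1 0} with hLo
    set Up := {r | r ∈ R ∧ r.1 0 < 0} with hUp
    set L : (Fin (N + 1) → ℤ) × Bool → ℝ := fun r => -V r / r.1 0 with hL
    have hLof : Lo.Finite := hfin.subset fun r hr => hr.1
    have hUpf : Up.Finite := hfin.subset fun r hr => hr.1
    have hzero : ∀ r ∈ R, r.1 0 = 0 → SignHolds r.2 (V r) := fun r hr h0 => by
      rw [hVr]; exact hyR _ (Or.inl ⟨r, hr, h0, rfl⟩)
    have hposv : ∀ r ∈ Lo, ∀ v, SignHolds r.2 (v - L r) → SignHolds r.2 (V r + r.1 0 * v) := by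
      rintro r ⟨-, hr⟩ v h
      have hr' : (0 : ℝ) < r.1 0 := by exact_mod_cast hr
      have := h.mul_pos hr'
      convert this using 1
      simp only [hL]; field_simp; ring
    have hnegv : ∀ r ∈ Up, ∀ v, SignHolds r.2 (L r - v) → SignHolds r.2 (V r + r.1 0 * v) := by
      rintro r ⟨-, hr⟩ v h
      have hr' : (r.1 0 : ℝ) < 0 := by exact_mod_cast hr
      have := h.mul_pos (neg_pos.2 hr')
      have hr0 := hr'.ne
      convert this using 1
      simp only [hL]; field_simp; ring
    have hpair : ∀ r ∈ Lo, ∀ s ∈ Up, SignHolds (r.2 || s.2) (L s - L r) := by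
      rintro r ⟨hr, hr0⟩ s ⟨hs, hs0⟩
      have hr' : (0 : ℝ) < r.1 0 := by exact_mod_cast hr0
      have hs' : (0 : ℝ) < -(s.1 0 : ℝ) := by exact_mod_cast neg_pos.2 hs0
      have h1 := hyR _ (Or.inr ⟨r, hr, s, hs, hr0, hs0, rfl⟩)
      simp only at h1
      rw [hcomb, ← hVr, ← hVr] at h1
      refine SignHolds.of_mul_pos (d := r.1 0 * -(s.1 0 : ℝ)) (by positivity) ?_
      convert h1 using 1
      have hs'' : (s.1 0 : ℝ) ≠ 0 := by linarith
      simp only [hL]; field_simp; ring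
    have hcases : ∀ v : ℝ, (∀ r ∈ Lo, SignHolds r.2 (v - L r)) →
        (∀ r ∈ Up, SignHolds r.2 (L r - v)) → ∀ r ∈ R, SignHolds r.2 (V r + r.1 0 * v) := by
      intro v h1 h2 r hr
      rcases lt_trichotomy (r.1 0) 0 with h0 | h0 | h0
      · exact hnegv r ⟨hr, h0⟩ v (h2 r ⟨hr, h0⟩)
      · simpa [h0] using hzero r hr h0
      · exact hposv r ⟨hr, h0⟩ v (h1 r ⟨hr, h0⟩)
    have hNB : (0 : ℤ) ≤ N * B := by positivity
    have hone : ∀ (b : Bool) (v : ℝ), 1 ≤ v → SignHolds b v := fun b v hv => by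
      cases b <;> simp [SignHolds] <;> linarith
    have hsmall : ∀ r ∈ R, |V r| + K ≤ 2 * K ^ 2 * (N + 1) * (B + 1) := fun r hr => by
      have h1 := hVb r hr
      have h2 : (K : ℤ) * (N * B + 1) ≤ K ^ 2 * (N * B + 1) :=
        mul_le_mul_of_nonneg_right (by nlinarith) (by linarith)
      nlinarith [mul_nonneg (sq_nonneg (K : ℤ)) hNB, mul_nonneg (sq_nonneg (K : ℤ)) hB0,
        mul_nonneg (sq_nonneg (K : ℤ)) (Int.natCast_nonneg N), sq_nonneg (K : ℤ)]
    rcases Lo.eq_empty_or_nonempty with hLe | hLn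
    · rcases Up.eq_empty_or_nonempty with hUe | hUn
      · refine ⟨1, 0, 0, one_pos, by nlinarith, by rw [abs_zero]; positivity, by simp, hcases 0 ?_
          ?_⟩
        · simp [hLe]
        · simp [hUe]
      · obtain ⟨s, hs, hmin⟩ := Set.exists_min_image Up L hUpf hUn
        have hsK := abs_le.1 (hR s hs.1 0)
        refine ⟨-s.1 0, V s + s.1 0, L s - 1, by linarith [hs.2], by nlinarith, ?_, ?_,
          hcases _ (by simp [hLe]) fun r hr => hone _ _ (by linarith [hmin r hr])⟩
        · exact (abs_add_le _ _).trans (by linarith [hsmall s hs.1, hR s hs.1 0])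
        · have : (s.1 0 : ℝ) ≠ 0 := by exact_mod_cast hs.2.ne
          simp only [hL]; push_cast; field_simp; ring
    · obtain ⟨r, hr, hmax⟩ := Set.exists_max_image Lo L hLof hLn
      have hrK := abs_le.1 (hR r hr.1 0)
      have hr0 : (r.1 0 : ℝ) ≠ 0 := by exact_mod_cast hr.2.ne'
      rcases Up.eq_empty_or_nonempty with hUe | hUn
      · refine ⟨r.1 0, -V r + r.1 0, L r + 1, hr.2, by nlinarith, ?_, ?_,
          hcases _ (fun s hs => hone _ _ (by linarith [hmax s hs])) (by simp [hUe])⟩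
        · exact (abs_add_le _ _).trans (by rw [abs_neg]; linarith [hsmall r hr.1, hR r hr.1 0])
        · simp only [hL]; push_cast; field_simp
      · obtain ⟨s, hs, hmin⟩ := Set.exists_min_image Up L hUpf hUn
        have hsK := abs_le.1 (hR s hs.1 0)
        have hs0 : (s.1 0 : ℝ) ≠ 0 := by exact_mod_cast hs.2.ne
        have hmid := signHolds_midpoint (b := fun r => r.2) hpair hr hs hmax hmin
        refine ⟨2 * (r.1 0 * -s.1 0), -V r * -s.1 0 + V s * r.1 0, (L r + L s) / 2, ?_, ?_, ?_, ?_,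
          hcases _ hmid.1 hmid.2⟩
        · have := mul_pos hr.2 (neg_pos.2 hs.2); linarith
        · have : r.1 0 * -s.1 0 ≤ K * K :=
            mul_le_mul hrK.2 (by linarith) (by linarith [hs.2]) (by positivity)
          nlinarith
        · have h1 : |-V r * -s.1 0| ≤ N * K * B * K := by
            rw [abs_mul, abs_neg, abs_neg]
            exact mul_le_mul (hVb r hr.1) (hR s hs.1 0) (abs_nonneg _) (by positivity)
          have h2 : |V s * r.1 0| ≤ N * K * B * K := by
            rw [abs_mul]
            exact mul_le_mul (hVb s hs.1) (hR r hr.1 0) (abs_nonneg _) (by positivity)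
          refine (abs_add_le _ _).trans ?_
          nlinarith [mul_nonneg (sq_nonneg (K : ℤ)) hB0,
            mul_nonneg (sq_nonneg (K : ℤ)) (Int.natCast_nonneg N), sq_nonneg (K : ℤ)]
        · simp only [hL]; push_cast; field_simp; ring
end PCTL

namespace PCTL

/-! ### Certificates -/

/-- A letter of a certificate describes a state: its number among its siblings and the encoded
formulas that are claimed to hold in it. -/
abbrev Letter := ℕ × List (List ℕ)

/-- A word of letters with a position in it: the run that reads the word and then forever repeats
the part from this position on. -/
abbrev Lasso := List Letter × ℕ

/-- The letter at a position of a word; beyond the end it claims nothing. -/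
def letterAt (l : List Letter) (j : ℕ) : Letter := l.getD j (0, [])

/-- The formula `y` is claimed somewhere on the run from position `m` on. -/
def Lasso.Visits (z : Lasso) (m : ℕ) (y : List ℕ) : Prop :=
  ∃ a ∈ z.1.drop (min m z.2), y ∈ a.2

/-- The conditions on a single lasso: the claims belong to `subs` and respect literals,
conjunctions and `G`. -/
structure Lasso.Coherent (subs : List (List ℕ)) (z : Lasso) : Prop where
  loop_lt : z.2 < z.1.length
  mem_subs : ∀ a ∈ z.1, ∀ y ∈ a.2, y ∈ subs
  literal : ∀ a ∈ z.1, ∀ y ∈ a.2, y.head? = some 1 → 0 :: y.drop 1 ∉ a.2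
  conj : ∀ a ∈ z.1, ∀ y ∈ a.2, y.head? = some 2 → ∃ u ∈ a.2, ∃ v ∈ a.2, y = 2 :: (u ++ v)
  always : ∀ j < z.1.length, ∀ y ∈ (letterAt z.1 j).2, y.head? = some 5 →
    ∀ b ∈ z.1.drop (min j z.2), y ∈ b.2 ∧ y.drop 4 ∈ b.2

/-- Every word of `subs` has the shape of an encoded formula whose immediate subformulas are again
in `subs`. By induction all words of `subs` encode formulas, so that conjunctions can be split
without parsing. -/
def SubClosed (subs : List (List ℕ)) : Prop :=
  ∀ y ∈ subs, (y.length = 2 ∧ (y.head? = some 0 ∨ y.head? = some 1)) ∨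
    (∃ u ∈ subs, ∃ v ∈ subs, y = 2 :: (u ++ v)) ∨
    (4 ≤ y.length ∧ (y.head? = some 4 ∨ y.head? = some 5) ∧ y.drop 4 ∈ subs)

/-- The inequality `H / N ▷ q` for the comparison and the bound of an encoded `F`-formula, without
division. -/
def FutureHolds (y : List ℕ) (N H : ℝ) : Prop :=
  (y.getD 1 0 = 0 → (y.getD 2 0 : ℝ) * N ≤ y.getD 3 0 * H) ∧
    (y.getD 1 0 = 1 → (y.getD 2 0 : ℝ) * N < y.getD 3 0 * H)

/-- The `i`-th lasso of a family begins with `x`. -/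
def Through {ι : Type} (z : ι → Lasso) (x : List Letter) (i : ι) : Prop :=
  (z i).1.take x.length = x

section
open Classical

variable {ι : Type} [Fintype ι] (z : ι → Lasso) (p : ι → ℝ)

/-- The weight of the lassos that begin with `x`. -/
noncomputable def prefixMass (x : List Letter) : ℝ :=
  ∑ i, if Through z x i then p i else 0

/-- The weight of the lassos that begin with `x` and claim `y` at the end of `x` or later. -/
noncomputable def visitMass (x : List Letter) (y : List ℕ) : ℝ :=
  ∑ i, if Through z x i ∧ (z i).Visits (x.length - 1) y then p i else 0

/-- A weighted family of lassos certifies the formulas claimed by its common first letter: they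
hold in the Markov chain that draws a lasso and runs along it. The lassos share a prefix tree, and a
claim `F_{▷q} χ` is a claim about the lassos that pass through the same node of this tree. -/
structure IsCertificate (subs : List (List ℕ)) : Prop where
  nonempty : Nonempty ι
  pos : ∀ i, 0 < p i
  subClosed : SubClosed subs
  coherent : ∀ i, (z i).Coherent subs
  root : ∀ i j, (z i).1.take 1 = (z j).1.take 1
  loop : ∀ i j, (z i).1.take ((z i).2 + 1) = (z j).1.take ((z i).2 + 1) → z i = z j
  future : ∀ i j, ∀ y ∈ (letterAt (z i).1 j).2, y.head? = some 4 →
    FutureHolds y (prefixMass z p ((z i).1.take (j + 1)))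
      (visitMass z p ((z i).1.take (j + 1)) (y.drop 4))
end

/-- A word of a closed list that is a prefix of a formula's code, or has it as a prefix, is this
code. So the code `2 :: (u ++ v)` of a conjunction determines `u` and `v`. -/
theorem SubClosed.eq_encode {A : Type u} {subs : List (List ℕ)} (h : SubClosed subs) (name : A → ℕ)
    (χ : Formula A) : ∀ y ∈ subs, ∀ v v' : List ℕ, y ++ v = χ.encode name ++ v' →
      y = χ.encode name := by
  induction χ with
  | atom a =>
    intro y hy v v' hv
    rcases h y hy with ⟨h2, h3⟩ | ⟨u, hu, w, hw, rfl⟩ | ⟨h2, h3, h4⟩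
    · match y, h2 with
      | [b, c], _ => simp [Formula.encode] at hv ⊢; exact ⟨hv.1, hv.2.1⟩
    · simp [Formula.encode] at hv
    · match y, h2 with
      | b :: c :: _, _ => simp [Formula.encode] at hv h3; omega
  | negAtom a =>
    intro y hy v v' hv
    rcases h y hy with ⟨h2, h3⟩ | ⟨u, hu, w, hw, rfl⟩ | ⟨h2, h3, h4⟩
    · match y, h2 with
      | [b, c], _ => simp [Formula.encode] at hv ⊢; exact ⟨hv.1, hv.2.1⟩
    · simp [Formula.encode] at hv
    · match y, h2 with
      | b :: c :: _, _ => simp [Formula.encode] at hv h3; omega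
  | and φ ψ ih₁ ih₂ =>
    intro y hy v v' hv
    rcases h y hy with ⟨h2, h3⟩ | ⟨u, hu, w, hw, rfl⟩ | ⟨h2, h3, h4⟩
    · match y, h2 with
      | [b, c], _ => simp [Formula.encode] at hv h3; omega
    · simp only [Formula.encode, List.cons_append, List.append_assoc, List.cons.injEq,
        true_and] at hv
      have h1 := ih₁ u hu _ _ hv
      rw [h1] at hv
      rw [Formula.encode, h1, ih₂ w hw _ _ (List.append_cancel_left hv)]
    · match y, h2 with
      | b :: c :: _, _ => simp [Formula.encode] at hv h3; omega
  | or φ ψ ih₁ ih₂ =>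
    intro y hy v v' hv
    rcases h y hy with ⟨h2, h3⟩ | ⟨u, hu, w, hw, rfl⟩ | ⟨h2, h3, h4⟩
    · match y, h2 with
      | [b, c], _ => simp [Formula.encode] at hv h3; omega
    · simp [Formula.encode] at hv
    · match y, h2 with
      | b :: c :: _, _ => simp [Formula.encode] at hv h3; omega
  | future c q φ ih =>
    intro y hy v v' hv
    rcases h y hy with ⟨h2, h3⟩ | ⟨u, hu, w, hw, rfl⟩ | ⟨h2, h3, h4⟩
    · match y, h2 with
      | [b, c], _ => simp [Formula.encode] at hv h3; omega
    · simp [Formula.encode] at hv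
    · match y, h2 with
      | b :: c :: d :: e :: y, _ =>
        simp [Formula.encode] at hv h4 ⊢
        obtain ⟨h5, h6, h7, h8, h9⟩ := hv
        exact ⟨h5, h6, h7, h8, ih y h4 _ _ h9⟩
  | globally c q φ ih =>
    intro y hy v v' hv
    rcases h y hy with ⟨h2, h3⟩ | ⟨u, hu, w, hw, rfl⟩ | ⟨h2, h3, h4⟩
    · match y, h2 with
      | [b, c], _ => simp [Formula.encode] at hv h3; omega
    · simp [Formula.encode] at hv
    · match y, h2 with
      | b :: c :: d :: e :: y, _ =>
        simp [Formula.encode] at hv h4 ⊢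
        obtain ⟨h5, h6, h7, h8, h9⟩ := hv
        exact ⟨h5, h6, h7, h8, ih y h4 _ _ h9⟩

theorem letterAt_take {l : List Letter} {n j : ℕ} (h : j < n) :
    letterAt (l.take n) j = letterAt l j := by
  simp [letterAt, List.getD_eq_getElem?_getD, h]

theorem letterAt_mem {l : List Letter} {j : ℕ} (h : j < l.length) : letterAt l j ∈ l := by
  simp [letterAt, List.getD_eq_getElem?_getD, h]

theorem letterAt_mem_drop {l : List Letter} {j m : ℕ} (h : j < l.length) (hm : m ≤ j) :
    letterAt l j ∈ l.drop m := by
  have : letterAt l j = letterAt (l.drop m) (j - m) := by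
    simp [letterAt, List.getD_eq_getElem?_getD, show m + (j - m) = j by omega]
  rw [this]
  exact letterAt_mem (by simp; omega)

theorem exists_letterAt_of_mem_drop {l : List Letter} {m : ℕ} {a : Letter} (h : a ∈ l.drop m) :
    ∃ j, m ≤ j ∧ j < l.length ∧ a = letterAt l j := by
  obtain ⟨j, hj, rfl⟩ := List.mem_iff_getElem.1 h
  simp only [List.length_drop] at hj
  exact ⟨m + j, by omega, by omega, by simp [letterAt, List.getD_eq_getElem?_getD,
    show m + j < l.length by omega]⟩

/-! ### The Markov chain of a certificate -/

namespace Certificate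
open Classical

variable {ι : Type} {z : ι → Lasso} {p : ι → ℝ}

/-- The states of the chain are the nodes of the prefix tree, that is, the nonempty prefixes of
the words. -/
abbrev State (z : ι → Lasso) : Type := {x : List Letter // x ≠ [] ∧ ∃ i, Through z x i}

/-- The prefix of length `m + 1` of the `i`-th word. -/
def node (z : ι → Lasso) (i : ι) (m : ℕ) (h : m < (z i).1.length) : State z :=
  ⟨(z i).1.take (m + 1), by
    have : 0 < (z i).1.length := by omega
    simp [List.take_eq_nil_iff]; exact List.ne_nil_of_length_pos this, i, by
    simp [Through]⟩

theorem node_length (i : ι) {m : ℕ} (h : m < (z i).1.length) : (node z i m h).1.length = m + 1 := by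
  simp [node]; omega

theorem through_node (i : ι) {m : ℕ} (h : m < (z i).1.length) : Through z (node z i m h).1 i := by
  simp [Through, node]

theorem length_le_of_through {x : List Letter} {i : ι} (h : Through z x i) :
    x.length ≤ (z i).1.length := by
  have := congrArg List.length h
  simp at this; omega

theorem State.length_pos (x : State z) : 0 < x.1.length := List.length_pos_of_ne_nil x.2.1

theorem eq_node {x : State z} {i : ι} (h : Through z x.1 i) :
    x = node z i (x.1.length - 1)
      (by have := length_le_of_through h; have := x.length_pos; omega) := by
  apply Subtype.ext
  have := x.length_pos
  simp only [node, show x.1.length - 1 + 1 = x.1.length by omega]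
  exact h.symm

/-- The formulas claimed in a state. -/
def claims (x : State z) : List (List ℕ) := (letterAt x.1 (x.1.length - 1)).2

theorem claims_node (i : ι) {m : ℕ} (h : m < (z i).1.length) :
    claims (node z i m h) = (letterAt (z i).1 m).2 := by
  rw [claims, node_length]
  simp only [node, Nat.add_sub_cancel]
  rw [letterAt_take (by omega)]

instance [Finite ι] : Finite (State z) := by
  let f : (Σ i : ι, Fin (z i).1.length) → State z := fun q => node z q.1 q.2 q.2.2
  refine Finite.of_surjective f fun x => ?_
  obtain ⟨i, hi⟩ := x.2.2
  exact ⟨⟨i, x.1.length - 1, by have := length_le_of_through hi; have := x.length_pos; omega⟩,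
    (eq_node hi).symm⟩

/-- The state after `x` on the `i`-th lasso. -/
noncomputable def next (hk : ∀ i, (z i).2 < (z i).1.length) (x : State z) (i : ι) : State z :=
  if h : x.1.length < (z i).1.length then node z i x.1.length h else node z i (z i).2 (hk i)

theorem next_of_lt {x : State z} {i : ι} (hk : ∀ i, (z i).2 < (z i).1.length)
    (hx : x.1.length < (z i).1.length) : next hk x i = node z i x.1.length hx := dif_pos hx

theorem next_of_not_lt {x : State z} {i : ι} (hk : ∀ i, (z i).2 < (z i).1.length)
    (hx : ¬ x.1.length < (z i).1.length) : next hk x i = node z i (z i).2 (hk i) := dif_neg hx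

theorem through_next (hk : ∀ i, (z i).2 < (z i).1.length) (x : State z) (i : ι) :
    Through z (next hk x i).1 i := by
  unfold next
  split_ifs <;> exact through_node _ _

variable [Fintype ι]

theorem prefixMass_pos (hp : ∀ i, 0 < p i) (x : State z) : 0 < prefixMass z p x.1 := by
  obtain ⟨i, hi⟩ := x.2.2
  refine Finset.sum_pos' (fun j _ => ?_) ⟨i, Finset.mem_univ i, ?_⟩
  · split_ifs
    exacts [(hp j).le, le_rfl]
  · rw [if_pos hi]; exact hp i

/-- The conditional distribution of the lasso, given that it passes through `x`. -/
noncomputable def conditional (hp : ∀ i, 0 < p i) (x : State z) : PMF ι :=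
  PMF.ofFintype (fun i => ENNReal.ofReal (if Through z x.1 i then p i / prefixMass z p x.1 else 0))
    (by
      have h0 := prefixMass_pos hp x
      rw [← ENNReal.ofReal_sum_of_nonneg]
      · have : ∑ i, (if Through z x.1 i then p i / prefixMass z p x.1 else 0) = 1 := by
          refine Eq.trans ?_ (div_self h0.ne')
          nth_rw 2 [prefixMass]
          rw [Finset.sum_div]
          refine Finset.sum_congr rfl fun i _ => ?_
          rw [ite_div, zero_div]
        rw [this, ENNReal.ofReal_one]
      · intro i _
        split_ifs
        exacts [(div_pos (hp i) h0).le, le_rfl])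

theorem conditional_ne_zero {hp : ∀ i, 0 < p i} {x : State z} {i : ι} :
    conditional hp x i ≠ 0 ↔ Through z x.1 i := by
  have h0 := prefixMass_pos hp x
  rw [conditional, PMF.ofFintype_apply]
  by_cases h : Through z x.1 i
  · simp [h, div_pos (hp i) h0]
  · simp [h]

/-- The Markov chain of a certificate. -/
noncomputable abbrev chain {A : Type u} (name : A → ℕ) {subs : List (List ℕ)}
    (h : IsCertificate z p subs) : MarkovChain A where
  S := State z
  countable := Finite.to_countable
  P x := (conditional h.pos x).map (next (fun i => (h.coherent i).loop_lt) x)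
  s₀ := node z h.nonempty.some 0 (by have := (h.coherent h.nonempty.some).loop_lt; omega)
  L x := {a | [0, name a] ∈ claims x}

variable {A : Type u} {name : A → ℕ} {subs : List (List ℕ)}
  (h : IsCertificate z p subs)

theorem chain_P_ne_zero {x t : State z} : (chain name h).P x t ≠ 0 ↔
    ∃ i, Through z x.1 i ∧ next (fun i => (h.coherent i).loop_lt) x i = t := by
  rw [← PMF.mem_support_iff]
  simp [PMF.support_map, conditional_ne_zero]

theorem chain_sum {x : State z} [Fintype (State z)] (f : State z → ℝ) :
    ∑ t, ((chain name h).P x t).toReal * f t = ∑ i, if Through z x.1 i then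
      p i / prefixMass z p x.1 * f (next (fun i => (h.coherent i).loop_lt) x i) else 0 := by
  have h0 := prefixMass_pos h.pos x
  have h1 : ∀ t, (chain name h).P x t = ∑ i, if t = next (fun i => (h.coherent i).loop_lt) x i then
      conditional h.pos x i else 0 := fun t => by
    rw [PMF.map_apply, tsum_fintype]
    refine Finset.sum_congr rfl fun i _ => ?_
    congr
  have h2 : ∀ i, (conditional h.pos x i).toReal =
      if Through z x.1 i then p i / prefixMass z p x.1 else 0 := fun i => by
    rw [conditional, PMF.ofFintype_apply, ENNReal.toReal_ofReal]
    split_ifs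
    exacts [(div_pos (h.pos i) h0).le, le_rfl]
  have h3 : ∀ t, ((chain name h).P x t).toReal * f t =
      ∑ i, if t = next (fun i => (h.coherent i).loop_lt) x i then
        (if Through z x.1 i then p i / prefixMass z p x.1 else 0) * f t else 0 := fun t => by
    rw [h1, ENNReal.toReal_sum fun i _ => by
      split_ifs
      exacts [PMF.apply_ne_top _ _, ENNReal.zero_ne_top], Finset.sum_mul]
    refine Finset.sum_congr rfl fun i _ => ?_
    rw [← h2]
    split_ifs <;> simp
  simp only [h3]
  rw [Finset.sum_comm]
  refine Finset.sum_congr rfl fun i _ => ?_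
  rw [Finset.sum_ite_eq' Finset.univ]
  simp [ite_mul]

include h in
/-- At the end of a word, or anywhere in its loop, only copies of the same lasso are left. -/
theorem eq_of_through_end {x : List Letter} {i j : ι} (hi : Through z x i) (hj : Through z x j)
    (hx : (z i).2 < x.length) : z i = z j := by
  apply h.loop
  unfold Through at hi hj
  have h1 : ∀ l : List Letter, l.take ((z i).2 + 1) = (l.take x.length).take ((z i).2 + 1) :=
    fun l => by rw [List.take_take, min_eq_left (by omega)]
  rw [h1 (z i).1, h1 (z j).1, hi, hj]

omit [Fintype ι] in
theorem through_node_iff {i j : ι} {m : ℕ} (hm : m < (z i).1.length) :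
    Through z (node z i m hm).1 j ↔ (z j).1.take (m + 1) = (z i).1.take (m + 1) := by
  rw [Through, node_length]; rfl

include h in
/-- The lassos through the next node are those that pass through the present node and have the
same next node. -/
theorem through_next_iff {x : State z} {i j : ι} (hi : Through z x.1 i) :
    Through z (next (fun i => (h.coherent i).loop_lt) x i).1 j ↔
      Through z x.1 j ∧ next (fun i => (h.coherent i).loop_lt) x j =
        next (fun i => (h.coherent i).loop_lt) x i := by
  have hk := fun i => (h.coherent i).loop_lt
  refine ⟨fun hj => ?_, fun hj => hj.2 ▸ through_next hk x j⟩
  by_cases hx : x.1.length < (z i).1.length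
  · rw [next_of_lt hk hx, through_node_iff] at hj
    have h1 := congrArg (List.take x.1.length) hj
    rw [List.take_take, List.take_take, min_eq_left (by omega)] at h1
    have h2 : x.1.length < (z j).1.length := by
      have := congrArg List.length hj
      simp only [List.length_take] at this
      omega
    refine ⟨h1.trans hi, ?_⟩
    rw [next_of_lt hk hx, next_of_lt hk h2]
    exact Subtype.ext hj
  · rw [next_of_not_lt hk hx, through_node_iff] at hj
    have h1 : z i = z j := h.loop i j hj.symm
    refine ⟨by unfold Through at hi ⊢; rwa [← h1], ?_⟩
    rw [next_of_not_lt hk hx, next_of_not_lt hk (h1 ▸ hx)]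
    apply Subtype.ext
    simp only [node, h1]

omit [Fintype ι] in
theorem visits_next {x : State z} {i : ι} (hk : ∀ i, (z i).2 < (z i).1.length) {y : List ℕ}
    (hi : Through z x.1 i) (hx : y ∉ claims x) (hv : (z i).Visits (x.1.length - 1) y) :
    (z i).Visits ((next hk x i).1.length - 1) y := by
  have hpos := x.length_pos
  obtain ⟨a, ha, hya⟩ := hv
  obtain ⟨j, hj, hjl, rfl⟩ := exists_letterAt_of_mem_drop ha
  by_cases hxl : x.1.length < (z i).1.length
  · rw [next_of_lt hk hxl, node_length, Nat.add_sub_cancel]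
    refine ⟨_, letterAt_mem_drop hjl ?_, hya⟩
    have : j ≠ x.1.length - 1 := by
      rintro rfl
      rw [eq_node hi, claims_node] at hx
      exact hx hya
    omega
  · rw [next_of_not_lt hk hxl, node_length, Nat.add_sub_cancel]
    have := hk i
    have := length_le_of_through hi
    exact ⟨_, letterAt_mem_drop hjl (by omega), hya⟩

theorem visitMass_le (hp : ∀ i, 0 < p i) (x : List Letter) (y : List ℕ) :
    visitMass z p x y ≤ prefixMass z p x := by
  refine Finset.sum_le_sum fun i _ => ?_
  have := (hp i).le
  split_ifs with h1 h2 h2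
  exacts [le_rfl, absurd h1.1 h2, this, le_rfl]

/-- One step of the chain is a draw of the lasso followed by a move along it, so that the
conditional probability of a future visit is averaged over the next nodes. -/
theorem visitMass_subharmonic {x : State z} {y : List ℕ} (hx : y ∉ claims x) :
    visitMass z p x.1 y / prefixMass z p x.1 ≤ ∑ i, if Through z x.1 i then
      p i / prefixMass z p x.1 *
        (visitMass z p (next (fun i => (h.coherent i).loop_lt) x i).1 y /
          prefixMass z p (next (fun i => (h.coherent i).loop_lt) x i).1) else 0 := by
  have hk := fun i => (h.coherent i).loop_lt
  set n := next hk x with hn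
  have hpos := fun x : State z => prefixMass_pos h.pos x
  have hmass : ∀ i, Through z x.1 i → prefixMass z p (n i).1 =
      ∑ j, if Through z x.1 j ∧ n j = n i then p j else 0 := fun i hi => by
    refine Finset.sum_congr rfl fun j _ => ?_
    simp only [hn, through_next_iff h hi]
  have hvisit : ∀ i, Through z x.1 i →
      (∑ j, if (Through z x.1 j ∧ n j = n i) ∧ (z j).Visits (x.1.length - 1) y then p j else 0) ≤
        visitMass z p (n i).1 y := fun i hi => by
    refine Finset.sum_le_sum fun j _ => ?_
    have := (h.pos j).le
    split_ifs with h1 h2 h2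
    · exact le_rfl
    · refine absurd ⟨(through_next_iff h hi).2 h1.1, ?_⟩ h2
      rw [← h1.1.2]
      exact visits_next hk h1.1.1 hx h1.2
    · exact this
    · exact le_rfl
  calc visitMass z p x.1 y / prefixMass z p x.1
      = ∑ j, (if Through z x.1 j ∧ (z j).Visits (x.1.length - 1) y then
          p j / prefixMass z p x.1 * (prefixMass z p (n j).1 / prefixMass z p (n j).1) else 0) := by
        rw [visitMass, Finset.sum_div]
        refine Finset.sum_congr rfl fun j _ => ?_
        rw [div_self (hpos (n j)).ne', mul_one, ite_div, zero_div]
    _ = ∑ j, ∑ i, (if Through z x.1 j ∧ (z j).Visits (x.1.length - 1) y ∧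
        Through z x.1 i ∧ n i = n j
          then p j / prefixMass z p x.1 * (p i / prefixMass z p (n j).1) else 0) := by
        refine Finset.sum_congr rfl fun j _ => ?_
        split_ifs with hj
        · conv_lhs => rw [hmass j hj.1, Finset.sum_div, Finset.mul_sum]
          refine Finset.sum_congr rfl fun i _ => ?_
          rw [← hmass j hj.1]
          simp only [hj.1, hj.2, true_and, ite_div, zero_div, mul_ite, mul_zero]
        · rw [eq_comm]
          refine Finset.sum_eq_zero fun i _ => if_neg fun h => hj ⟨h.1, h.2.1⟩
    _ = ∑ i, ∑ j, (if Through z x.1 j ∧ (z j).Visits (x.1.length - 1) y ∧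
        Through z x.1 i ∧ n i = n j
          then p j / prefixMass z p x.1 * (p i / prefixMass z p (n j).1) else 0) :=
        Finset.sum_comm
    _ ≤ _ := by
        refine Finset.sum_le_sum fun i _ => ?_
        split_ifs with hi
        · refine le_trans (le_of_eq ?_) (mul_le_mul_of_nonneg_left
            (div_le_div_of_nonneg_right (hvisit i hi) (hpos (n i)).le)
            (div_pos (h.pos i) (hpos x)).le)
          rw [Finset.sum_div, Finset.mul_sum]
          refine Finset.sum_congr rfl fun j _ => ?_
          by_cases hj : (Through z x.1 j ∧ n j = n i) ∧ (z j).Visits (x.1.length - 1) y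
          · rw [if_pos hj, if_pos ⟨hj.1.1, hj.2, hi, hj.1.2.symm⟩, hj.1.2]
            ring
          · rw [if_neg hj, if_neg fun h => hj ⟨⟨h.1, h.2.2.2.symm⟩, h.2.1⟩]
            simp
        · refine (Finset.sum_eq_zero fun j _ => if_neg fun h => hi h.2.2.1).le

theorem reach_node {i : ι} {m n : ℕ} (hmn : m ≤ n) (hn : n < (z i).1.length) :
    (chain name h).Reach (node z i m (by omega)) (node z i n hn) := by
  induction n, hmn using Nat.le_induction with
  | base => exact .refl
  | succ n hmn ih =>
    refine .tail (ih (by omega)) ?_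
    rw [chain_P_ne_zero]
    refine ⟨i, through_node i _, ?_⟩
    have hl := node_length (z := z) i (m := n) (by omega)
    rw [next_of_lt _ (by omega)]
    apply Subtype.ext
    simp only [node, List.length_take]
    rw [min_eq_left (by omega)]

theorem reach_loop (i : ι) {m : ℕ} (hm : m < (z i).1.length) :
    (chain name h).Reach (node z i m hm) (node z i (z i).2 (h.coherent i).loop_lt) := by
  refine .tail (reach_node h (show m ≤ (z i).1.length - 1 by omega) (by omega)) ?_
  rw [chain_P_ne_zero]
  refine ⟨i, through_node i _, ?_⟩
  have hl := node_length (z := z) i (m := (z i).1.length - 1) (by omega)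
  rw [next_of_not_lt _ (by omega)]

theorem reach_of_visits {x : State z} {i : ι} {y : List ℕ} (hi : Through z x.1 i)
    (hv : (z i).Visits (x.1.length - 1) y) :
    ∃ t : State z, y ∈ claims t ∧ (chain name h).Reach x t := by
  obtain ⟨a, ha, hya⟩ := hv
  obtain ⟨j, hj, hjl, rfl⟩ := exists_letterAt_of_mem_drop ha
  refine ⟨node z i j hjl, by rwa [claims_node], ?_⟩
  rw [eq_node hi]
  by_cases hxj : x.1.length - 1 ≤ j
  · exact reach_node h hxj hjl
  · exact (reach_loop h i _).trans (reach_node h (by omega) hjl)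

/-- Claims of `G`-formulas are inherited along transitions, also when a lasso returns to the start
of its loop. -/
theorem always_of_reach {x t : State z} (hxt : (chain name h).Reach x t) {y : List ℕ}
    (hy : y.head? = some 5) (hx : y ∈ claims x) : y ∈ claims t ∧ y.drop 4 ∈ claims t := by
  have hk := fun i => (h.coherent i).loop_lt
  have hstep : ∀ (x : State z) i, Through z x.1 i → y ∈ claims x →
      (y ∈ claims x ∧ y.drop 4 ∈ claims x) ∧ y ∈ claims (next hk x i) := by
    intro x i hi hx
    have hx' := hx
    rw [eq_node hi, claims_node] at hx
    have h1 := (h.coherent i).always _ (by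
      have := length_le_of_through hi; have := x.length_pos; omega) y hx hy
    have hlt : x.1.length - 1 < (z i).1.length := by
      have := length_le_of_through hi; have := x.length_pos; omega
    refine ⟨⟨hx', ?_⟩, ?_⟩
    · rw [eq_node hi, claims_node]
      exact (h1 _ (letterAt_mem_drop hlt (min_le_left _ _))).2
    · by_cases hxl : x.1.length < (z i).1.length
      · rw [next_of_lt hk hxl, claims_node]
        exact (h1 _ (letterAt_mem_drop hxl (by omega))).1
      · rw [next_of_not_lt hk hxl, claims_node]
        exact (h1 _ (letterAt_mem_drop (hk i) (min_le_right _ _))).1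
  induction hxt using Relation.ReflTransGen.head_induction_on with
  | refl =>
    obtain ⟨i, hi⟩ := t.2.2
    exact (hstep t i hi hx).1
  | head hP _ ih =>
    obtain ⟨i, hi, rfl⟩ := (chain_P_ne_zero h).1 hP
    exact ih (hstep _ i hi hx).2

/-- The conditional weight of the lassos that claim `y` later is a lower bound of the probability to
visit a state that claims `y`. -/
theorem le_hit {x : State z} {y : List ℕ} : visitMass z p x.1 y / prefixMass z p x.1 ≤
    ((chain name h).hit {t | y ∈ claims t} x).toReal := by
  have : Fintype (State z) := Fintype.ofFinite _
  refine (chain name h).le_hit_of_subharmonic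
    (f := fun x : State z => visitMass z p x.1 y / prefixMass z p x.1) ?_ ?_ ?_ x
  · exact fun x _ => div_le_one_of_le₀ (visitMass_le h.pos _ _) (prefixMass_pos h.pos x).le
  · intro x hx
    rw [chain_sum h (fun x : State z => visitMass z p x.1 y / prefixMass z p x.1)]
    exact visitMass_subharmonic h hx
  · intro x hx
    have h1 : visitMass z p x.1 y ≠ 0 := fun h0 => by simp [h0] at hx
    obtain ⟨i, -, hi⟩ := Finset.exists_ne_zero_of_sum_ne_zero h1
    have hi' : Through z x.1 i ∧ (z i).Visits (x.1.length - 1) y := by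
      by_contra hn
      simp [hn] at hi
    obtain ⟨t, ht, hxt⟩ := reach_of_visits h hi'.1 hi'.2
    exact ⟨t, ht, hxt⟩

/-- Claims are true in the chain of a certificate. -/
theorem sat_of_claim (χ : Formula A) (hχ : χ.InFqG1) : ∀ x : State z, χ.encode name ∈ claims x →
    (chain name h).Sat χ x := by
  -- the claims of a state are those of a letter of some lasso
  have hmem : ∀ x : State z, ∃ i, ∃ a ∈ (z i).1, claims x = a.2 := fun x => by
    obtain ⟨i, hi⟩ := x.2.2
    rw [eq_node hi, claims_node]
    exact ⟨i, _, letterAt_mem (by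
      have := length_le_of_through hi; have := x.length_pos; omega), rfl⟩
  induction χ with
  | atom a => exact fun x hx => hx
  | negAtom a =>
    intro x hx
    obtain ⟨i, a', ha, hc⟩ := hmem x
    have := (h.coherent i).literal a' ha _ (hc ▸ hx) rfl
    simpa [MarkovChain.Sat, hc, Formula.encode] using this
  | and φ ψ ih₁ ih₂ =>
    intro x hx
    obtain ⟨i, a', ha, hc⟩ := hmem x
    obtain ⟨u, hu, v, hv, huv⟩ := (h.coherent i).conj a' ha _ (hc ▸ hx) rfl
    simp only [Formula.encode, List.cons.injEq, true_and] at huv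
    have h1 := h.subClosed.eq_encode name φ u ((h.coherent i).mem_subs a' ha u hu) _ _ huv.symm
    rw [h1] at huv
    have h2 := List.append_cancel_left huv
    exact ⟨ih₁ hχ.1 x (by rw [hc, ← h1]; exact hu), ih₂ hχ.2 x (by rw [hc, h2]; exact hv)⟩
  | or φ ψ ih₁ ih₂ => exact hχ.elim
  | future c q φ ih =>
    intro x hx
    have h1 : ((chain name h).hit {t | φ.encode name ∈ claims t} x).toReal ≤
        ((chain name h).runMeasure x).real {π | ∃ i, (chain name h).Sat φ (π i)} := by
      rw [measureReal_def]
      refine ENNReal.toReal_mono (measure_ne_top _ _) (measure_mono ?_)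
      rintro π ⟨i, hi⟩
      exact ⟨i, ih hχ _ hi⟩
    have h2 := le_hit (name := name) h (x := x) (y := φ.encode name)
    obtain ⟨i, hi⟩ := x.2.2
    have hxn := eq_node hi
    have h3 := h.future i (x.1.length - 1) _ (by
      rw [hxn, claims_node] at hx; exact hx) rfl
    have h4 : (z i).1.take (x.1.length - 1 + 1) = x.1 := by
      rw [Nat.sub_add_cancel x.length_pos]; exact hi
    rw [h4] at h3
    have h0 := prefixMass_pos h.pos x
    have hden : (0 : ℝ) < (q : ℚ).den := by exact_mod_cast (q : ℚ).den_pos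
    have hq : ((q : ℚ) : ℝ) = ((q : ℚ).num.toNat : ℝ) / (q : ℚ).den := by
      have hn : (((q : ℚ).num.toNat : ℤ) : ℝ) = ((q : ℚ).num : ℝ) := by
        rw [Int.toNat_of_nonneg (Rat.num_nonneg.2 q.2.1)]
      conv_lhs => rw [Rat.cast_def]
      rw [← hn]; rfl
    cases c with
    | ge =>
      refine le_trans ?_ (h2.trans h1)
      have := h3.1 rfl
      rw [hq, div_le_div_iff₀ hden h0]
      simpa [Formula.encode, mul_comm] using this
    | gt =>
      refine lt_of_lt_of_le ?_ (h2.trans h1)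
      have := h3.2 rfl
      rw [hq, div_lt_div_iff₀ hden h0]
      simpa [Formula.encode, mul_comm] using this
  | globally c q φ ih =>
    intro x hx
    obtain ⟨rfl, hq, hφ⟩ := hχ
    change ((q : ℚ) : ℝ) ≤ _
    rw [hq, Rat.cast_one]
    refine ((chain name h).always_iff {s | (chain name h).Sat φ s} x).2 fun t hxt => ih hφ t ?_
    have := (always_of_reach h hxt rfl hx).2
    simpa [Formula.encode] using this

theorem isModel (φ : Formula A) (hφ : φ.InFqG1) (hc : ∀ i, φ.encode name ∈ (letterAt (z i).1 0).2) :
    (chain name h).IsModel φ := by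
  refine sat_of_claim h φ hφ _ ?_
  rw [claims_node]
  exact hc _

end Certificate
end PCTL

namespace PCTL

/-! ### Height, branching and size -/
namespace Certificate

/-- The numbers of the letters are smaller than `b` and tell siblings of the prefix tree apart, and
the words have length at most `n`. -/
structure IsNumbered {ι : Type} (z : ι → Lasso) (b n : ℕ) : Prop where
  length_le : ∀ i, (z i).1.length ≤ n
  lt : ∀ i, ∀ a ∈ (z i).1, a.1 < b
  inj : ∀ i i' j, j < (z i).1.length → j < (z i').1.length →
    (z i).1.take j = (z i').1.take j → (letterAt (z i).1 j).1 = (letterAt (z i').1 j).1 →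
    letterAt (z i).1 j = letterAt (z i').1 j

theorem take_succ_eq {l : List Letter} {j : ℕ} (h : j < l.length) :
    l.take (j + 1) = l.take j ++ [letterAt l j] := by
  rw [List.take_succ_eq_append_getElem h]
  simp [letterAt, List.getD_eq_getElem?_getD, h]

variable {ι : Type} {z : ι → Lasso} {p : ι → ℝ} {b n : ℕ}

theorem IsNumbered.eq_of_numbers (hz : IsNumbered z b n) {i i' : ι} {m : ℕ}
    (hi : m ≤ (z i).1.length) (hi' : m ≤ (z i').1.length)
    (h : ∀ j < m, (letterAt (z i).1 j).1 = (letterAt (z i').1 j).1) :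
    (z i).1.take m = (z i').1.take m := by
  induction m with
  | zero => simp
  | succ m ih =>
    have h1 := ih (by omega) (by omega) fun j hj => h j (by omega)
    rw [take_succ_eq hi, take_succ_eq hi', h1, hz.inj i i' m hi hi' h1 (h m (by omega))]

theorem IsNumbered.card_state_le (hz : IsNumbered z b n) [Finite ι] :
    Nat.card (State z) ≤ (b + 1) ^ n := by
  classical
  let f : State z → Fin n → Fin (b + 1) := fun x j =>
    if h : j < x.1.length then ⟨min (letterAt x.1 j).1 b, by omega⟩ else ⟨b, by omega⟩
  have hf : Function.Injective f := by
    intro x x' hxx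
    obtain ⟨i, hi⟩ := x.2.2
    obtain ⟨i', hi'⟩ := x'.2.2
    have hl := length_le_of_through hi
    have hl' := length_le_of_through hi'
    have hn := hz.length_le i
    have hn' := hz.length_le i'
    -- the letters of a state are letters of the lassos through it
    have hlet : ∀ (x : State z) (i : ι), Through z x.1 i → ∀ j < x.1.length,
        letterAt x.1 j = letterAt (z i).1 j := fun x i hi j hj => by
      unfold Through at hi
      conv_lhs => rw [← hi]
      exact letterAt_take hj
    have hb : ∀ (x : State z) (i : ι), Through z x.1 i → ∀ j < x.1.length,
        (letterAt x.1 j).1 < b := fun x i hi j hj => by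
      rw [hlet x i hi j hj]
      exact hz.lt i _ (letterAt_mem (lt_of_lt_of_le hj (length_le_of_through hi)))
    have hlen : ∀ (x x' : State z) (i : ι), Through z x.1 i → f x = f x' →
        x.1.length ≤ x'.1.length := by
      intro x x' i hi hxx
      by_contra hlt
      push Not at hlt
      have hn := hz.length_le i
      have hl := length_le_of_through hi
      have := congrArg Fin.val (congrFun hxx ⟨x'.1.length, by omega⟩)
      have h2 := hb x i hi _ hlt
      simp [f, hlt] at this
      omega
    have hleq := le_antisymm (hlen x x' i hi hxx) (hlen x' x i' hi' hxx.symm)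
    apply Subtype.ext
    unfold Through at hi hi'
    rw [← hi, ← hi', ← hleq]
    refine hz.eq_of_numbers hl (hleq ▸ hl') fun j hj => ?_
    have := congrArg Fin.val (congrFun hxx ⟨j, by omega⟩)
    have h2 := hb x i hi _ hj
    have h3 := hb x' i' hi' j (by omega)
    rw [← hlet x i hi j hj, ← hlet x' i' hi' j (by omega)]
    simp [f, hj, show j < x'.1.length by omega] at this
    omega
  calc Nat.card (State z) ≤ Nat.card (Fin n → Fin (b + 1)) := Nat.card_le_card_of_injective f hf
    _ = (b + 1) ^ n := by simp

variable [Fintype ι] {A : Type u} (name : A → ℕ) {subs : List (List ℕ)}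
  (h : IsCertificate z p subs)

/-- The parent of a node in the prefix tree; the parent of the root is the root. -/
def parent (x : State z) : State z :=
  if hx : 1 < x.1.length then ⟨x.1.take (x.1.length - 1), by
    refine ⟨by simp [List.take_eq_nil_iff, x.2.1]; omega, ?_⟩
    obtain ⟨i, hi⟩ := x.2.2
    refine ⟨i, ?_⟩
    unfold Through at hi ⊢
    have h := congrArg (List.take (x.1.length - 1)) hi
    rw [List.take_take, min_eq_left (by omega)] at h
    rwa [List.length_take, min_eq_left (by omega)]⟩ else x

omit [Fintype ι] in
theorem parent_node {i : ι} {m : ℕ} (hm : m + 1 < (z i).1.length) :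
    parent (node z i (m + 1) hm) = node z i m (by omega) := by
  have hl := node_length (z := z) i hm
  rw [parent, dif_pos (by omega)]
  apply Subtype.ext
  simp only [hl]
  simp [node, List.take_take]

omit [Fintype ι] in
theorem parent_iterate {i : ι} {m k : ℕ} (hm : m + k < (z i).1.length) :
    parent^[k] (node z i (m + k) hm) = node z i m (by omega) := by
  induction k with
  | zero => rfl
  | succ k ih =>
    rw [Function.iterate_succ_apply]
    have := parent_node (z := z) (i := i) (m := m + k) hm
    rw [show node z i (m + (k + 1)) hm = node z i (m + k + 1) hm from rfl, this]
    exact ih _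

include h in
theorem node_zero_eq (i j : ι) (hi : 0 < (z i).1.length) (hj : 0 < (z j).1.length) :
    node z i 0 hi = node z j 0 hj := Subtype.ext (h.root i j)

theorem isTree : (chain name h).IsTreeWithBackEdges (parent (z := z))
    (fun x : State z => x.1.length - 1) := by
  have hk := fun i => (h.coherent i).loop_lt
  have hroot : ((chain name h).s₀).1.length = 1 :=
    node_length h.nonempty.some (by have := hk h.nonempty.some; omega)
  have hne : ∀ t : State z, t ≠ (chain name h).s₀ → 1 < t.1.length := by
    intro t ht
    by_contra hlt
    have hpos := t.length_pos
    obtain ⟨i, hi⟩ := t.2.2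
    apply ht
    rw [eq_node hi]
    have h0 : t.1.length - 1 = 0 := by omega
    simp only [h0]
    exact node_zero_eq h _ _ _ _
  refine ⟨?_, ?_, ?_, ?_, ?_⟩
  · rw [parent, dif_neg (by omega)]
  · simp only [hroot]
  · intro t ht
    have h1 := hne t ht
    rw [parent, dif_pos h1]
    simp only [List.length_take]
    omega
  · intro t ht
    have h1 := hne t ht
    obtain ⟨i, hi⟩ := t.2.2
    have hle := length_le_of_through hi
    change (chain name h).P (parent t) t ≠ 0
    rw [chain_P_ne_zero]
    obtain ⟨m, hm⟩ : ∃ m, t.1.length - 1 = m + 1 := ⟨t.1.length - 2, by omega⟩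
    have ht' := eq_node hi
    simp only [hm] at ht'
    rw [ht', parent_node]
    refine ⟨i, through_node i _, ?_⟩
    have hl := node_length (z := z) i (m := m) (by omega)
    rw [next_of_lt _ (by omega)]
    apply Subtype.ext
    simp only [node, List.length_take]
    rw [min_eq_left (by omega)]
  · intro s t hst
    obtain ⟨i, hi, rfl⟩ := (chain_P_ne_zero h).1 hst
    have hle := length_le_of_through hi
    have hpos := s.length_pos
    have hs := eq_node hi
    by_cases hx : s.1.length < (z i).1.length
    · left
      rw [next_of_lt hk hx]
      refine ⟨fun he => ?_, ?_⟩
      · have := node_length (z := z) i hx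
        rw [he, hroot] at this
        omega
      · obtain ⟨m, hm⟩ : ∃ m, s.1.length = m + 1 := ⟨s.1.length - 1, by omega⟩
        simp only [hm] at hs ⊢
        rw [parent_node]
        exact hs.symm
    · right
      rw [next_of_not_lt hk hx]
      have h1 := hk i
      refine ⟨s.1.length - 1 - (z i).2, ?_⟩
      have h2 : s.1.length - 1 = (z i).2 + (s.1.length - 1 - (z i).2) := by omega
      have h3 := parent_iterate (z := z) (i := i) (m := (z i).2) (k := s.1.length - 1 - (z i).2)
        (by omega)
      refine Eq.trans (congrArg _ (hs.trans ?_)) h3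
      simp only [← h2]

theorem heightAtMost (hz : IsNumbered z b n) : (chain name h).HeightAtMost n := by
  refine ⟨_, _, isTree name h, fun s => ?_⟩
  obtain ⟨i, hi⟩ := s.2.2
  have := length_le_of_through hi
  have := hz.length_le i
  have := State.length_pos s
  omega

theorem branchingAtMost (hz : IsNumbered z b n) : (chain name h).BranchingAtMost (b + 1) := by
  intro s
  have hk := fun i => (h.coherent i).loop_lt
  have hmem : ∀ t ∈ (chain name h).post s, ∃ i, Through z s.1 i ∧ next hk s i = t :=
    fun t ht => (chain_P_ne_zero h).1 ht
  by_cases hend : ∃ i, Through z s.1 i ∧ ¬ s.1.length < (z i).1.length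
  · obtain ⟨i, hi, hs⟩ := hend
    have : (chain name h).post s ⊆ {next hk s i} := by
      intro t ht
      obtain ⟨j, hj, rfl⟩ := hmem t ht
      have hij : z i = z j := eq_of_through_end h hi hj (by have := hk i; omega)
      rw [Set.mem_singleton_iff, next_of_not_lt hk hs, next_of_not_lt hk (hij ▸ hs)]
      apply Subtype.ext
      simp only [node, hij]
    refine (Set.encard_le_encard this).trans ?_
    rw [Set.encard_singleton]
    exact_mod_cast Nat.le_add_left 1 b
  · push Not at hend
    let f : State z → ℕ := fun t => (letterAt t.1 s.1.length).1
    have hf : ∀ i, Through z s.1 i → letterAt (next hk s i).1 s.1.length =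
        letterAt (z i).1 s.1.length := fun i hi => by
      rw [next_of_lt hk (hend i hi)]
      exact letterAt_take (by omega)
    have hinj : Set.InjOn f ((chain name h).post s) := by
      intro t ht t' ht' htt
      obtain ⟨i, hi, rfl⟩ := hmem t ht
      obtain ⟨j, hj, rfl⟩ := hmem t' ht'
      have h1 := hend i hi
      have h2 := hend j hj
      simp only [f, hf i hi, hf j hj] at htt
      have htake : (z i).1.take s.1.length = (z j).1.take s.1.length := hi.trans hj.symm
      have := hz.inj i j _ h1 h2 htake htt
      rw [next_of_lt hk h1, next_of_lt hk h2]
      apply Subtype.ext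
      simp only [node]
      rw [take_succ_eq h1, take_succ_eq h2, this, htake]
    rw [← hinj.encard_image]
    have hsub : f '' (chain name h).post s ⊆ (Finset.range b : Set ℕ) := by
      rintro _ ⟨t, ht, rfl⟩
      obtain ⟨i, hi, rfl⟩ := hmem t ht
      simp only [f, hf i hi, Finset.coe_range, Set.mem_Iio]
      exact hz.lt i _ (letterAt_mem (hend i hi))
    refine (Set.encard_le_encard hsub).trans ?_
    rw [Set.encard_coe_eq_coe_finsetCard, Finset.card_range]
    exact_mod_cast Nat.le_succ b

theorem sizeAtMost (hz : IsNumbered z b n) : (chain name h).SizeAtMost ((b + 1) ^ n) :=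
  ⟨inferInstanceAs (Finite (State z)), hz.card_state_le⟩

end Certificate
end PCTL

namespace PCTL

/-! ### Obligations -/

theorem Cmp.Holds.mono {c : Cmp} {p p' q : ℝ} (h : c.Holds p q) (hp : p ≤ p') : c.Holds p' q := by
  cases c
  · exact le_trans (show q ≤ p from h) hp
  · exact lt_of_lt_of_le (show q < p from h) hp

namespace Formula
variable {A : Type u}

/-- The formula `G_{≥1} ψ`. -/
def box (ψ : Formula A) : Formula A := globally .ge ⟨1, by norm_num, le_rfl⟩ ψ

theorem globally_eq_box {c : Cmp} {q : Set.Icc (0 : ℚ) 1} {ψ : Formula A}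
    (h : (globally c q ψ).InFqG1) : globally c q ψ = ψ.box := by
  obtain ⟨rfl, hq, -⟩ := h
  have : q = ⟨1, by norm_num, le_rfl⟩ := Subtype.ext hq
  rw [this, box]

/-- The subformulas of a formula. -/
def subs : Formula A → List (Formula A)
  | atom a => [atom a]
  | negAtom a => [negAtom a]
  | and φ ψ => and φ ψ :: (φ.subs ++ ψ.subs)
  | or φ ψ => or φ ψ :: (φ.subs ++ ψ.subs)
  | future c q φ => future c q φ :: φ.subs
  | globally c q φ => globally c q φ :: φ.subs

theorem self_mem_subs (φ : Formula A) : φ ∈ φ.subs := by cases φ <;> simp [subs]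

theorem subs_trans {φ χ θ : Formula A} (h : χ ∈ φ.subs) (h' : θ ∈ χ.subs) : θ ∈ φ.subs := by
  induction φ with
  | atom a | negAtom a => simp only [subs, List.mem_singleton] at h; exact h ▸ h'
  | and φ ψ ih₁ ih₂ | or φ ψ ih₁ ih₂ =>
    simp only [subs, List.mem_cons, List.mem_append] at h ⊢
    rcases h with rfl | h | h
    · simpa [subs] using h'
    · exact .inr (.inl (ih₁ h))
    · exact .inr (.inr (ih₂ h))
  | future c q φ ih | globally c q φ ih =>
    simp only [subs, List.mem_cons] at h ⊢
    rcases h with rfl | h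
    · simpa [subs] using h'
    · exact .inr (ih h)

theorem length_subs (φ : Formula A) : φ.subs.length = φ.length := by
  induction φ <;> simp_all [subs, length]

theorem InFqG1.of_mem_subs {φ χ : Formula A} (hφ : φ.InFqG1) (h : χ ∈ φ.subs) : χ.InFqG1 := by
  induction φ with
  | atom a | negAtom a => simp only [subs, List.mem_singleton] at h; exact h ▸ hφ
  | and φ ψ ih₁ ih₂ =>
    simp only [subs, List.mem_cons, List.mem_append] at h
    rcases h with rfl | h | h
    exacts [hφ, ih₁ hφ.1 h, ih₂ hφ.2 h]
  | or φ ψ => exact hφ.elim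
  | future c q φ ih =>
    simp only [subs, List.mem_cons] at h
    rcases h with rfl | h
    exacts [hφ, ih hφ h]
  | globally c q φ ih =>
    simp only [subs, List.mem_cons] at h
    rcases h with rfl | h
    exacts [hφ, ih hφ.2.2 h]

theorem one_le_length (φ : Formula A) : 1 ≤ φ.length := by cases φ <;> simp [length]

/-- The bodies of the `F`-subformulas of a formula. -/
def bodies : Formula A → List (Formula A)
  | atom _ => []
  | negAtom _ => []
  | and φ ψ => φ.bodies ++ ψ.bodies
  | or φ ψ => φ.bodies ++ ψ.bodies
  | future _ _ φ => φ :: φ.bodies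
  | globally _ _ φ => φ.bodies

theorem length_bodies_le (φ : Formula A) : φ.bodies.length ≤ φ.length := by
  induction φ <;> simp_all [bodies, length] <;> omega

theorem mem_bodies {φ χ : Formula A} {c : Cmp} {q : Set.Icc (0 : ℚ) 1}
    (h : future c q χ ∈ φ.subs) : χ ∈ φ.bodies := by
  induction φ with
  | atom a | negAtom a => simp [subs] at h
  | and φ ψ ih₁ ih₂ | or φ ψ ih₁ ih₂ =>
    simp only [subs, List.mem_cons, List.mem_append, reduceCtorEq, false_or] at h
    simp only [bodies, List.mem_append]
    exact h.imp ih₁ ih₂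
  | future c' q' φ ih =>
    simp only [subs, List.mem_cons, future.injEq] at h
    simp only [bodies, List.mem_cons]
    exact h.imp (fun h => h.2.2) ih
  | globally c' q' φ ih =>
    simp only [subs, List.mem_cons, reduceCtorEq, false_or] at h
    exact ih h

/-- The formulas that a state has to satisfy in its own right if it satisfies the given one: they
are found by splitting conjunctions and by instantiating `G` at the state itself. -/
def core : Formula A → List (Formula A)
  | atom a => [atom a]
  | negAtom a => [negAtom a]
  | and φ ψ => and φ ψ :: (φ.core ++ ψ.core)
  | or φ ψ => [or φ ψ]
  | future c q φ => [future c q φ]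
  | globally c q φ => globally c q φ :: φ.core

theorem self_mem_core (φ : Formula A) : φ ∈ φ.core := by cases φ <;> simp [core]

theorem core_subset_subs (φ : Formula A) : φ.core ⊆ φ.subs := by
  induction φ with
  | atom a | negAtom a | or φ ψ => simp [core, subs]
  | and φ ψ ih₁ ih₂ =>
    simp only [core, subs]
    exact List.cons_subset_cons _ (List.append_subset.2
      ⟨List.Subset.trans ih₁ (List.subset_append_left _ _), List.Subset.trans ih₂
        (List.subset_append_right _ _)⟩)
  | future c q φ => simp [core, subs]
  | globally c q φ ih => exact List.cons_subset_cons _ ih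

/-- A list of formulas that splits conjunctions. -/
def SplitsAnd (l : List (Formula A)) : Prop := ∀ φ ψ, and φ ψ ∈ l → φ ∈ l ∧ ψ ∈ l

theorem core_split (θ : Formula A) : SplitsAnd θ.core := by
  intro φ ψ h
  induction θ with
  | atom a | negAtom a | or φ ψ | future c q φ => simp [core] at h
  | and φ' ψ' ih₁ ih₂ =>
    simp only [core, List.mem_cons, List.mem_append, and.injEq] at h ⊢
    rcases h with ⟨rfl, rfl⟩ | h | h
    · exact ⟨.inr (.inl (self_mem_core _)), .inr (.inr (self_mem_core _))⟩
    · exact ⟨.inr (.inl (ih₁ h).1), .inr (.inl (ih₁ h).2)⟩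
    · exact ⟨.inr (.inr (ih₂ h).1), .inr (.inr (ih₂ h).2)⟩
  | globally c q φ' ih =>
    simp only [core, List.mem_cons, reduceCtorEq, false_or] at h ⊢
    exact ⟨.inr (ih h).1, .inr (ih h).2⟩

theorem core_globally {θ φ : Formula A} {c : Cmp} {q : Set.Icc (0 : ℚ) 1}
    (h : globally c q φ ∈ θ.core) : φ ∈ θ.core := by
  induction θ with
  | atom a | negAtom a | or φ ψ | future c q φ => simp [core] at h
  | and φ' ψ' ih₁ ih₂ =>
    simp only [core, List.mem_cons, List.mem_append, reduceCtorEq, false_or] at h ⊢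
    exact .inr (h.imp ih₁ ih₂)
  | globally c q φ' ih =>
    simp only [core, List.mem_cons, globally.injEq] at h ⊢
    rcases h with ⟨-, -, rfl⟩ | h
    · exact .inr (self_mem_core _)
    · exact .inr (ih h)

end Formula

namespace MarkovChain
open Formula
variable {A : Type u} (M : MarkovChain A)

theorem sat_future {c : Cmp} {q : Set.Icc (0 : ℚ) 1} {χ : Formula A} {s : M.S} :
    M.Sat (future c q χ) s ↔ c.Holds (M.hit {t | M.Sat χ t} s).toReal ((q : ℚ) : ℝ) := Iff.rfl

theorem sat_box {ψ : Formula A} {s : M.S} :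
    M.Sat ψ.box s ↔ ∀ t, M.Reach s t → M.Sat ψ t := by
  have h := M.always_iff {t | M.Sat ψ t} s
  rw [← Rat.cast_one] at h
  exact h

theorem sat_box_of_reach {ψ : Formula A} {s t : M.S} (h : M.Sat ψ.box s) (hst : M.Reach s t) :
    M.Sat ψ.box t :=
  M.sat_box.2 fun r hr => M.sat_box.1 h r (hst.trans hr)

theorem toReal_hit_le_one (B : Set M.S) (s : M.S) : (M.hit B s).toReal ≤ 1 :=
  ENNReal.toReal_le_of_le_ofReal zero_le_one (by simpa using M.hit_le_one B s)

theorem sat_core {θ χ : Formula A} {s : M.S} (hθ : θ.InFqG1) (h : M.Sat θ s) (hχ : χ ∈ θ.core) :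
    M.Sat χ s := by
  induction θ with
  | atom a | negAtom a | future c q φ => simp only [core, List.mem_singleton] at hχ; exact hχ ▸ h
  | or φ ψ => exact hθ.elim
  | and φ ψ ih₁ ih₂ =>
    simp only [core, List.mem_cons, List.mem_append] at hχ
    rcases hχ with rfl | hχ | hχ
    exacts [h, ih₁ hθ.1 h.1 hχ, ih₂ hθ.2 h.2 hχ]
  | globally c q φ ih =>
    simp only [core, List.mem_cons] at hχ
    rcases hχ with rfl | hχ
    · exact h
    · rw [globally_eq_box hθ] at h
      exact ih hθ.2.2 (M.sat_box.1 h s .refl) hχ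

open Classical in
/-- The formulas that are claimed in the state `s` in order to make a formula true there. The body
of an `F`-formula is among them if it holds in `s` already. -/
noncomputable def now (s : M.S) : Formula A → List (Formula A)
  | atom a => [atom a]
  | negAtom a => [negAtom a]
  | .and φ ψ => .and φ ψ :: (now s φ ++ now s ψ)
  | .or φ ψ => [.or φ ψ]
  | future c q φ => future c q φ :: if M.Sat φ s then now s φ else []
  | globally c q φ => globally c q φ :: φ.core

open Classical in
/-- The bodies of the `F`-formulas that have to be made true later on. -/
noncomputable def pending (s : M.S) : Formula A → List (Formula A)
  | atom _ => []
  | negAtom _ => []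
  | .and φ ψ => pending s φ ++ pending s ψ
  | .or _ _ => []
  | future _ _ φ => if M.Sat φ s then pending s φ else [φ]
  | globally _ _ _ => []

open Classical in
/-- The bodies of the `G`-formulas that have to be true from now on. -/
noncomputable def boxes (s : M.S) : Formula A → List (Formula A)
  | atom _ => []
  | negAtom _ => []
  | .and φ ψ => boxes s φ ++ boxes s ψ
  | .or _ _ => []
  | future _ _ φ => if M.Sat φ s then boxes s φ else []
  | globally _ _ φ => [φ]

variable {M} {s : M.S} {θ : Formula A}

theorem self_mem_now : θ ∈ M.now s θ := by cases θ <;> simp [now]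

theorem now_subset_subs : M.now s θ ⊆ θ.subs := by
  induction θ with
  | atom a | negAtom a | or φ ψ => simp [now, subs]
  | and φ ψ ih₁ ih₂ =>
    simp only [now, subs]
    exact List.cons_subset_cons _ (List.append_subset.2
      ⟨List.Subset.trans ih₁ (List.subset_append_left _ _), List.Subset.trans ih₂
        (List.subset_append_right _ _)⟩)
  | future c q φ ih =>
    simp only [now, subs]
    refine List.cons_subset_cons _ ?_
    split_ifs
    exacts [ih, List.nil_subset _]
  | globally c q φ => exact List.cons_subset_cons _ (core_subset_subs φ)

theorem sat_now {χ : Formula A} (hθ : θ.InFqG1) (h : M.Sat θ s) (hχ : χ ∈ M.now s θ) :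
    M.Sat χ s := by
  induction θ with
  | atom a | negAtom a => simp only [now, List.mem_singleton] at hχ; exact hχ ▸ h
  | or φ ψ => exact hθ.elim
  | and φ ψ ih₁ ih₂ =>
    simp only [now, List.mem_cons, List.mem_append] at hχ
    rcases hχ with rfl | hχ | hχ
    exacts [h, ih₁ hθ.1 h.1 hχ, ih₂ hθ.2 h.2 hχ]
  | future c q φ ih =>
    simp only [now, List.mem_cons] at hχ
    rcases hχ with rfl | hχ
    · exact h
    · split_ifs at hχ with hs
      · exact ih hθ hs hχ
      · simp at hχ
  | globally c q φ ih => exact M.sat_core (θ := globally c q φ) hθ h hχ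

theorem now_split : SplitsAnd (M.now s θ) := by
  intro φ ψ h
  induction θ with
  | atom a | negAtom a | or φ ψ => simp [now] at h
  | and φ' ψ' ih₁ ih₂ =>
    simp only [now, List.mem_cons, List.mem_append, and.injEq] at h ⊢
    rcases h with ⟨rfl, rfl⟩ | h | h
    · exact ⟨.inr (.inl self_mem_now), .inr (.inr self_mem_now)⟩
    · exact ⟨.inr (.inl (ih₁ h).1), .inr (.inl (ih₁ h).2)⟩
    · exact ⟨.inr (.inr (ih₂ h).1), .inr (.inr (ih₂ h).2)⟩
  | future c q φ' ih =>
    simp only [now, List.mem_cons, reduceCtorEq, false_or] at h ⊢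
    split_ifs at h ⊢
    · exact ⟨.inr (ih h).1, .inr (ih h).2⟩
    · simp at h
  | globally c q φ' ih => exact core_split (globally c q φ') φ ψ h

theorem now_globally {φ : Formula A} {c : Cmp} {q : Set.Icc (0 : ℚ) 1} (hθ : θ.InFqG1)
    (h : globally c q φ ∈ M.now s θ) :
    ∃ ψ ∈ M.boxes s θ, globally c q φ ∈ ψ.box.core := by
  induction θ with
  | atom a | negAtom a => simp [now] at h
  | or φ ψ => exact hθ.elim
  | and φ' ψ' ih₁ ih₂ =>
    simp only [now, List.mem_cons, List.mem_append, reduceCtorEq, false_or] at h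
    simp only [boxes, List.mem_append]
    rcases h with h | h
    · obtain ⟨ψ, h1, h2⟩ := ih₁ hθ.1 h
      exact ⟨ψ, .inl h1, h2⟩
    · obtain ⟨ψ, h1, h2⟩ := ih₂ hθ.2 h
      exact ⟨ψ, .inr h1, h2⟩
  | future c q φ' ih =>
    simp only [now, List.mem_cons, reduceCtorEq, false_or] at h
    simp only [boxes]
    split_ifs at h ⊢
    · exact ih hθ h
    · simp at h
  | globally c' q' φ' ih =>
    exact ⟨φ', by simp [boxes], by rw [← globally_eq_box hθ]; exact h⟩

theorem now_future {χ : Formula A} {c : Cmp} {q : Set.Icc (0 : ℚ) 1} (hθ : θ.InFqG1)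
    (h : future c q χ ∈ M.now s θ) :
    χ ∈ M.now s θ ∨ χ ∈ M.pending s θ ∨ ∃ ψ ∈ M.boxes s θ, future c q χ ∈ ψ.box.core := by
  induction θ with
  | atom a | negAtom a => simp [now] at h
  | or φ ψ => exact hθ.elim
  | and φ' ψ' ih₁ ih₂ =>
    simp only [now, List.mem_cons, List.mem_append, reduceCtorEq, false_or] at h
    simp only [now, pending, boxes, List.mem_append, List.mem_cons]
    rcases h with h | h
    · rcases ih₁ hθ.1 h with h1 | h1 | ⟨ψ, h1, h2⟩
      exacts [.inl (.inr (.inl h1)), .inr (.inl (.inl h1)), .inr (.inr ⟨ψ, .inl h1, h2⟩)]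
    · rcases ih₂ hθ.2 h with h1 | h1 | ⟨ψ, h1, h2⟩
      exacts [.inl (.inr (.inr h1)), .inr (.inl (.inr h1)), .inr (.inr ⟨ψ, .inr h1, h2⟩)]
  | future c' q' φ' ih =>
    simp only [now, List.mem_cons, future.injEq] at h
    simp only [now, pending, boxes, List.mem_cons]
    split_ifs at h ⊢ with hs
    · rcases h with ⟨-, -, rfl⟩ | h
      · exact .inl (.inr self_mem_now)
      · rcases ih hθ h with h1 | h1
        exacts [.inl (.inr h1), .inr h1]
    · rcases h with ⟨-, -, rfl⟩ | h
      · simp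
      · simp at h
  | globally c' q' φ' ih =>
    exact .inr (.inr ⟨φ', by simp [boxes], by rw [← globally_eq_box hθ]; exact h⟩)

theorem pending_subset_subs : M.pending s θ ⊆ θ.subs := by
  induction θ with
  | atom a | negAtom a | or φ ψ | globally c q φ => simp [pending]
  | and φ ψ ih₁ ih₂ =>
    simp only [pending, subs]
    exact List.subset_cons_of_subset _ (List.append_subset.2
      ⟨List.Subset.trans ih₁ (List.subset_append_left _ _), List.Subset.trans ih₂
        (List.subset_append_right _ _)⟩)
  | future c q φ ih =>
    simp only [pending, subs]
    refine List.subset_cons_of_subset _ ?_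
    split_ifs
    · exact ih
    · simpa using self_mem_subs φ

theorem box_mem_subs {ψ : Formula A} (hθ : θ.InFqG1) (h : ψ ∈ M.boxes s θ) :
    ψ.box ∈ θ.subs := by
  induction θ with
  | atom a | negAtom a | or φ ψ => simp [boxes] at h
  | and φ ψ ih₁ ih₂ =>
    simp only [boxes, List.mem_append] at h
    simp only [subs, List.mem_cons, List.mem_append]
    exact .inr (h.imp (ih₁ hθ.1) (ih₂ hθ.2))
  | future c q φ ih =>
    simp only [boxes] at h
    split_ifs at h
    · exact List.mem_cons_of_mem _ (ih hθ h)
    · simp at h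
  | globally c q φ ih =>
    simp only [boxes, List.mem_singleton] at h
    rw [h, ← globally_eq_box hθ]
    exact self_mem_subs _

theorem sat_box_of_mem {ψ : Formula A} (hθ : θ.InFqG1) (h : M.Sat θ s) (hψ : ψ ∈ M.boxes s θ) :
    M.Sat ψ.box s := by
  induction θ with
  | atom a | negAtom a | or φ ψ => simp [boxes] at hψ
  | and φ ψ ih₁ ih₂ =>
    simp only [boxes, List.mem_append] at hψ
    exact hψ.elim (ih₁ hθ.1 h.1) (ih₂ hθ.2 h.2)
  | future c q φ ih =>
    simp only [boxes] at hψ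
    split_ifs at hψ with hs
    · exact ih hθ hs hψ
    · simp at hψ
  | globally c q φ ih =>
    simp only [boxes, List.mem_singleton] at hψ
    rw [hψ, ← globally_eq_box hθ]
    exact h

/-- The total length of a list of formulas under an additional operator each. -/
def weight (l : List (Formula A)) : ℕ := (l.map fun χ => χ.length + 1).sum

theorem weight_append (l l' : List (Formula A)) : weight (l ++ l') = weight l + weight l' := by
  simp [weight]

/-- The obligations that a formula leaves for the future are not longer than the formula. -/
theorem weight_pending_add_weight_boxes_le :
    weight (M.pending s θ) + weight (M.boxes s θ) ≤ θ.length := by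
  induction θ with
  | atom a | negAtom a | or φ ψ => simp [pending, boxes, weight]
  | and φ ψ ih₁ ih₂ =>
    simp only [pending, boxes, weight_append, Formula.length]
    omega
  | future c q φ ih =>
    simp only [pending, boxes, Formula.length]
    split_ifs
    · omega
    · simp [weight]
  | globally c q φ ih => simp [pending, boxes, weight, Formula.length]

end MarkovChain
end PCTL

namespace PCTL

/-! ### Composing certificates -/
namespace Certificate

theorem letterAt_cons_succ {a : Letter} {l : List Letter} {j : ℕ} :
    letterAt (a :: l) (j + 1) = letterAt l j := by
  simp [letterAt]

theorem letterAt_of_length_le {l : List Letter} {j : ℕ} (h : l.length ≤ j) :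
    letterAt l j = (0, []) := by
  simp [letterAt, List.getD_eq_getElem?_getD, h]

theorem lt_length_of_mem {l : List Letter} {j : ℕ} {y : List ℕ} (h : y ∈ (letterAt l j).2) :
    j < l.length := by
  by_contra hn
  rw [letterAt_of_length_le (by omega)] at h
  simp at h

theorem futureHolds_mul {y : List ℕ} {N H c : ℝ} (hc : 0 < c) (h : FutureHolds y N H) :
    FutureHolds y (c * N) (c * H) := by
  refine ⟨fun h1 => ?_, fun h1 => ?_⟩
  · have := mul_le_mul_of_nonneg_left (h.1 h1) hc.le
    linarith
  · have := mul_lt_mul_of_pos_left (h.2 h1) hc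
    linarith

theorem futureHolds_of_holds {A : Type u} {name : A → ℕ} {c : Cmp} {q : Set.Icc (0 : ℚ) 1}
    {χ : Formula A} {H : ℝ} (h : c.Holds H ((q : ℚ) : ℝ)) :
    FutureHolds ((Formula.future c q χ).encode name) 1 H := by
  have hden : (0 : ℝ) < (q : ℚ).den := by exact_mod_cast (q : ℚ).den_pos
  have hq : ((q : ℚ) : ℝ) * (q : ℚ).den = ((q : ℚ).num.toNat : ℝ) := by
    have hn : (((q : ℚ).num.toNat : ℤ) : ℝ) = ((q : ℚ).num : ℝ) := by
      rw [Int.toNat_of_nonneg (Rat.num_nonneg.2 q.2.1)]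
    have h2 : (((q : ℚ).num.toNat : ℕ) : ℝ) = ((q : ℚ).num : ℝ) := by rw [← hn]; rfl
    conv_lhs => rw [Rat.cast_def]
    rw [h2]; field_simp
  cases c with
  | ge =>
    refine ⟨fun _ => ?_, fun h1 => by simp [Formula.encode, Formula.cmpCode] at h1⟩
    have h' : ((q : ℚ) : ℝ) ≤ H := h
    simp only [Formula.encode, List.getD_cons_succ, List.getD_cons_zero]
    rw [← hq]; nlinarith
  | gt =>
    refine ⟨fun h1 => by simp [Formula.encode, Formula.cmpCode] at h1, fun _ => ?_⟩
    have h' : ((q : ℚ) : ℝ) < H := h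
    simp only [Formula.encode, List.getD_cons_succ, List.getD_cons_zero]
    rw [← hq]; nlinarith

/-- A lasso that makes good its claims alone is a certificate. -/
theorem isCertificate_single {z : Lasso} {subs : List (List ℕ)} (hsub : SubClosed subs)
    (hz : z.Coherent subs)
    (hf : ∀ j, ∀ y ∈ (letterAt z.1 j).2, y.head? = some 4 →
      ∃ H : ℝ, 0 ≤ H ∧ H ≤ 1 ∧ FutureHolds y 1 H ∧ (H = 0 ∨ z.Visits j (y.drop 4))) :
    IsCertificate (fun _ : Unit => z) (fun _ => 1) subs where
  nonempty := ⟨()⟩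
  pos _ := one_pos
  subClosed := hsub
  coherent _ := hz
  root _ _ := rfl
  loop _ _ _ := rfl
  future _ j y hy h4 := by
    have hj := lt_length_of_mem hy
    have hT : Through (fun _ : Unit => z) (z.1.take (j + 1)) () := by
      simp [Through]
    have hl : (z.1.take (j + 1)).length - 1 = j := by simp; omega
    obtain ⟨H, h0, h1, h2, h3⟩ := hf j y hy h4
    have hN : prefixMass (fun _ : Unit => z) (fun _ => 1) (z.1.take (j + 1)) = 1 := by
      simp [prefixMass, hT]
    have hV : H ≤ visitMass (fun _ : Unit => z) (fun _ => 1) (z.1.take (j + 1)) (y.drop 4) := by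
      rw [visitMass, Fintype.sum_unique]
      rcases h3 with rfl | h3
      · split_ifs
        exacts [zero_le_one, le_rfl]
      · rw [if_pos ⟨hT, by rwa [hl]⟩]
        exact h1
    rw [hN]
    refine ⟨fun h => (h2.1 h).trans ?_, fun h => (h2.2 h).trans_le ?_⟩ <;> gcongr

section Join

variable {m : ℕ} {κ : Fin m → Type} (a : Letter) (z : ∀ j, κ j → Lasso)
  (c : Fin m → ℝ) (p : ∀ j, κ j → ℝ)

/-- The lassos of several families, each preceded by the letter `a`. -/
def join : (Σ j, κ j) → Lasso := fun q => (a :: (z q.1 q.2).1, (z q.1 q.2).2 + 1)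

/-- The weights of several families, mixed with the weights `c`. -/
def joinWeight : (Σ j, κ j) → ℝ := fun q => c q.1 * p q.1 q.2

variable {a z c p}

theorem visits_join_succ {q : Σ j, κ j} {n : ℕ} {y : List ℕ} :
    (join a z q).Visits (n + 1) y ↔ (z q.1 q.2).Visits n y := by
  simp only [Lasso.Visits, join]
  rw [show min (n + 1) ((z q.1 q.2).2 + 1) = min n (z q.1 q.2).2 + 1 by omega, List.drop_succ_cons]

theorem visits_join_zero {q : Σ j, κ j} {y : List ℕ} :
    (join a z q).Visits 0 y ↔ y ∈ a.2 ∨ (z q.1 q.2).Visits 0 y := by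
  simp [Lasso.Visits, join]

theorem through_join {q : Σ j, κ j} {x : List Letter} :
    Through (join a z) (a :: x) q ↔ Through (z q.1) x q.2 := by
  simp [Through, join]

theorem through_join_root (q : Σ j, κ j) : Through (join a z) [a] q := by
  simp [Through, join]

variable [∀ j, Fintype (κ j)] {r : Fin m → Letter}

omit [∀ j, Fintype (κ j)] in
/-- The lassos through a node below the root belong to a single family, which is the one that is
given by the number of the second letter. -/
theorem through_family (hr : ∀ j i, letterAt (z j i).1 0 = r j) {j j' : Fin m}
    (hrn : ∀ j, (r j).1 = j) {x : List Letter} (hx : letterAt x 0 = r j) (hx0 : x ≠ [])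
    {i : κ j'} (h : Through (z j') x i) : j' = j := by
  have h1 : letterAt (z j' i).1 0 = letterAt x 0 := by
    rw [← h, letterAt_take (List.length_pos_of_ne_nil hx0)]
  rw [hr, hx] at h1
  have := congrArg Prod.fst h1
  rw [hrn, hrn] at this
  exact Fin.ext this

theorem prefixMass_join (hr : ∀ j i, letterAt (z j i).1 0 = r j) (hrn : ∀ j, (r j).1 = j)
    {j : Fin m} {x : List Letter} (hx : letterAt x 0 = r j) (hx0 : x ≠ []) :
    prefixMass (join a z) (joinWeight c p) (a :: x) = c j * prefixMass (z j) (p j) x := by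
  rw [prefixMass, Fintype.sum_sigma, Fintype.sum_eq_single j]
  · rw [prefixMass, Finset.mul_sum]
    refine Finset.sum_congr rfl fun i _ => ?_
    rw [mul_ite, mul_zero]
    classical exact if_congr through_join rfl rfl
  · intro j' hj'
    refine Finset.sum_eq_zero fun i _ => if_neg fun h => hj' ?_
    exact through_family hr hrn hx hx0 (through_join.1 h)

theorem visitMass_join (hr : ∀ j i, letterAt (z j i).1 0 = r j) (hrn : ∀ j, (r j).1 = j)
    {j : Fin m} {x : List Letter} (hx : letterAt x 0 = r j) (hx0 : x ≠ []) (y : List ℕ) :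
    visitMass (join a z) (joinWeight c p) (a :: x) y = c j * visitMass (z j) (p j) x y := by
  have hl : (a :: x).length - 1 = x.length - 1 + 1 := by
    have := List.length_pos_of_ne_nil hx0
    simp; omega
  rw [visitMass, Fintype.sum_sigma, Fintype.sum_eq_single j]
  · rw [visitMass, Finset.mul_sum]
    refine Finset.sum_congr rfl fun i _ => ?_
    rw [mul_ite, mul_zero, hl]
    classical exact if_congr (and_congr through_join visits_join_succ) rfl rfl
  · intro j' hj'
    refine Finset.sum_eq_zero fun i _ => if_neg fun h => hj' ?_
    exact through_family hr hrn hx hx0 (through_join.1 h.1)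

/-- The total weight of the lassos of a family that claim `y` somewhere. -/
noncomputable def totalVisit {ι : Type} [Fintype ι] (z : ι → Lasso) (p : ι → ℝ) (y : List ℕ) : ℝ :=
  open Classical in ∑ i, if (z i).Visits 0 y then p i else 0

theorem prefixMass_join_root : prefixMass (join a z) (joinWeight c p) [a] =
    ∑ j, c j * ∑ i, p j i := by
  rw [prefixMass, Fintype.sum_sigma]
  refine Finset.sum_congr rfl fun j _ => ?_
  rw [Finset.mul_sum]
  refine Finset.sum_congr rfl fun i _ => ?_
  rw [if_pos (through_join_root _)]
  rfl

theorem totalVisit_join (hc : ∀ j, 0 < c j) (hp : ∀ j i, 0 < p j i) (y : List ℕ) :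
    ∑ j, c j * totalVisit (z j) (p j) y ≤ totalVisit (join a z) (joinWeight c p) y := by
  rw [totalVisit, Fintype.sum_sigma]
  refine Finset.sum_le_sum fun j _ => ?_
  rw [totalVisit, Finset.mul_sum]
  refine Finset.sum_le_sum fun i _ => ?_
  have h0 := mul_pos (hc j) (hp j i)
  by_cases h1 : (z j i).Visits 0 y
  · rw [if_pos h1, if_pos (visits_join_zero.2 (.inr h1))]
    exact le_rfl
  · rw [if_neg h1, mul_zero]
    split_ifs
    exacts [h0.le, le_rfl]

theorem visitMass_join_root (y : List ℕ) : visitMass (join a z) (joinWeight c p) [a] y =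
    totalVisit (join a z) (joinWeight c p) y := by
  classical exact Finset.sum_congr rfl fun q _ =>
    if_congr (and_iff_right (through_join_root q)) rfl rfl

omit [∀ j, Fintype (κ j)] in
theorem coherent_join {subs : List (List ℕ)} {q : Σ j, κ j} (hz : (z q.1 q.2).Coherent subs)
    (h1 : ∀ y ∈ a.2, y ∈ subs) (h2 : ∀ y ∈ a.2, y.head? = some 1 → 0 :: y.drop 1 ∉ a.2)
    (h3 : ∀ y ∈ a.2, y.head? = some 2 → ∃ u ∈ a.2, ∃ v ∈ a.2, y = 2 :: (u ++ v))
    (h4 : ∀ y ∈ a.2, y.head? = some 5 → y.drop 4 ∈ a.2 ∧ y ∈ (letterAt (z q.1 q.2).1 0).2) :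
    (join a z q).Coherent subs where
  loop_lt := by simpa [join] using hz.loop_lt
  mem_subs b hb := by
    rcases List.mem_cons.1 hb with rfl | hb
    exacts [h1, hz.mem_subs b hb]
  literal b hb := by
    rcases List.mem_cons.1 hb with rfl | hb
    exacts [h2, hz.literal b hb]
  conj b hb := by
    rcases List.mem_cons.1 hb with rfl | hb
    exacts [h3, hz.conj b hb]
  always j hj y hy h5 b hb := by
    cases j with
    | zero =>
      have hy' := h4 y hy h5
      rcases List.mem_cons.1 (List.mem_of_mem_drop hb) with rfl | hb
      · exact ⟨hy, hy'.1⟩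
      · exact hz.always 0 (by have := hz.loop_lt; omega) y hy'.2 h5 b (by simpa using hb)
    | succ j =>
      simp only [join] at hy hb hj
      rw [letterAt_cons_succ] at hy
      rw [show min (j + 1) ((z q.1 q.2).2 + 1) = min j (z q.1 q.2).2 + 1 by omega,
        List.drop_succ_cons] at hb
      exact hz.always j (by simpa using hj) y hy h5 b hb

/-- Certificates for the children of a node, mixed with weights and preceded by a letter for the
node, form a certificate if the claims of the node are accounted for. -/
theorem isCertificate_join {subs : List (List ℕ)} (hm : 0 < m) (hc : ∀ j, 0 < c j)
    (hz : ∀ j, IsCertificate (z j) (p j) subs) (hr : ∀ j i, letterAt (z j i).1 0 = r j)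
    (hrn : ∀ j, (r j).1 = j) (hsum : ∑ j, c j * ∑ i, p j i = 1)
    (h1 : ∀ y ∈ a.2, y ∈ subs) (h2 : ∀ y ∈ a.2, y.head? = some 1 → 0 :: y.drop 1 ∉ a.2)
    (h3 : ∀ y ∈ a.2, y.head? = some 2 → ∃ u ∈ a.2, ∃ v ∈ a.2, y = 2 :: (u ++ v))
    (h4 : ∀ y ∈ a.2, y.head? = some 5 → y.drop 4 ∈ a.2 ∧ ∀ j, y ∈ (r j).2)
    (h5 : ∀ y ∈ a.2, y.head? = some 4 →
      FutureHolds y 1 (totalVisit (join a z) (joinWeight c p) (y.drop 4))) :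
    IsCertificate (join a z) (joinWeight c p) subs where
  nonempty := ⟨⟨⟨0, hm⟩, (hz ⟨0, hm⟩).nonempty.some⟩⟩
  pos q := mul_pos (hc _) ((hz _).pos _)
  subClosed := (hz ⟨0, hm⟩).subClosed
  coherent q := coherent_join ((hz q.1).coherent q.2) h1 h2 h3 fun y hy h => by
    rw [hr]; exact ⟨(h4 y hy h).1, (h4 y hy h).2 _⟩
  root _ _ := by simp [join]
  loop := by
    rintro ⟨j, i⟩ ⟨j', i'⟩ h
    simp only [join, List.take_succ_cons, List.cons.injEq, true_and] at h ⊢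
    have hl := ((hz j).coherent i).loop_lt
    obtain rfl : j' = j := by
      have h1 := congrArg (letterAt · 0) h
      simp only [letterAt_take (Nat.succ_pos _), hr] at h1
      have := congrArg Prod.fst h1
      rw [hrn, hrn] at this
      exact Fin.ext this.symm
    have := (hz j').loop i i' h
    simp [this]
  future := by
    rintro ⟨j, i⟩ n y hy hy4
    cases n with
    | zero =>
      have h0 : (join a z ⟨j, i⟩).1.take (0 + 1) = [a] := by simp [join]
      rw [h0, prefixMass_join_root, hsum, visitMass_join_root]
      exact h5 y hy hy4
    | succ n =>
      simp only [join] at hy ⊢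
      rw [letterAt_cons_succ] at hy
      have hlt := lt_length_of_mem hy
      have hx : letterAt ((z j i).1.take (n + 1)) 0 = r j := by
        rw [letterAt_take (by omega), hr]
      have hx0 : (z j i).1.take (n + 1) ≠ [] := by
        intro h
        have := congrArg List.length h
        simp at this
        simp [this] at hlt
      rw [List.take_succ_cons, prefixMass_join hr hrn hx hx0, visitMass_join hr hrn hx hx0]
      exact futureHolds_mul (hc j) ((hz j).future i n y hy hy4)

omit [∀ j, Fintype (κ j)] in
theorem isNumbered_join {b n : ℕ} (ha : a.1 < b) (hz : ∀ j, IsNumbered (z j) b n)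
    (hr : ∀ j i, letterAt (z j i).1 0 = r j) (hrn : ∀ j, (r j).1 = j) :
    IsNumbered (join a z) b (n + 1) where
  length_le q := by simpa [join] using (hz q.1).length_le q.2
  lt q x hx := by
    rcases List.mem_cons.1 hx with rfl | hx
    exacts [ha, (hz q.1).lt q.2 x hx]
  inj := by
    rintro ⟨j, i⟩ ⟨j', i'⟩ k hk hk' ht hn
    cases k with
    | zero => rfl
    | succ k =>
      simp only [join, List.take_succ_cons, List.cons.injEq, true_and, letterAt_cons_succ,
        List.length_cons, Nat.add_lt_add_iff_right] at ht hn hk hk' ⊢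
      -- the numbers of the second letters agree, so that both lassos belong to the same family
      obtain rfl : j = j' := by
        have h1 : (letterAt (z j i).1 0).1 = (letterAt (z j' i').1 0).1 := by
          cases k with
          | zero => exact hn
          | succ k =>
            have := congrArg (letterAt · 0) ht
            simp only [letterAt_take (Nat.succ_pos _)] at this
            rw [this]
        rw [hr, hr, hrn, hrn] at h1
        exact Fin.ext h1
      exact (hz j).inj i i' k hk hk' ht hn

end Join
end Certificate
end PCTL

namespace PCTL

/-! ### Nodes without pending formulas -/
namespace Certificate
open Formula

variable {A : Type u} {M : MarkovChain A} {name : A → ℕ} {φ : Formula A} {s : M.S}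

open Classical in
/-- The letter with the number `j` that claims those formulas of `l` that are subformulas of `φ`. -/
noncomputable def mkLetter (name : A → ℕ) (φ : Formula A) (j : ℕ) (l : List (Formula A)) : Letter :=
  (j, (φ.subs.filter (· ∈ l)).map (Formula.encode name))

theorem mem_mkLetter {j : ℕ} {l : List (Formula A)} {y : List ℕ} :
    y ∈ (mkLetter name φ j l).2 ↔ ∃ χ, (χ ∈ φ.subs ∧ χ ∈ l) ∧ χ.encode name = y := by
  simp [mkLetter]

theorem length_mkLetter_le {j : ℕ} {l : List (Formula A)} :
    (mkLetter name φ j l).2.length ≤ φ.length := by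
  rw [← length_subs]
  simpa [mkLetter] using List.length_filter_le _ _

theorem encode_mem_mkLetter (hname : Function.Injective name) {j : ℕ} {l : List (Formula A)}
    {χ : Formula A} : χ.encode name ∈ (mkLetter name φ j l).2 ↔ χ ∈ φ.subs ∧ χ ∈ l := by
  rw [mem_mkLetter]
  refine ⟨?_, fun h => ⟨χ, h, rfl⟩⟩
  rintro ⟨χ', h, he⟩
  rwa [Formula.encode_injective hname he] at h

theorem head_encode_one {χ : Formula A} (h : (χ.encode name).head? = some 1) :
    ∃ a, χ = negAtom a := by
  cases χ <;> simp [Formula.encode] at h ⊢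

theorem head_encode_two {χ : Formula A} (h : (χ.encode name).head? = some 2) :
    ∃ θ ψ, χ = Formula.and θ ψ := by
  cases χ <;> simp [Formula.encode] at h ⊢

theorem head_encode_four {χ : Formula A} (h : (χ.encode name).head? = some 4) :
    ∃ c q ψ, χ = future c q ψ := by
  cases χ <;> simp [Formula.encode] at h ⊢

theorem head_encode_five {χ : Formula A} (h : (χ.encode name).head? = some 5) :
    ∃ c q ψ, χ = globally c q ψ := by
  cases χ <;> simp [Formula.encode] at h ⊢

theorem subClosed_subs (hφ : φ.InFqG1) : SubClosed (φ.subs.map (Formula.encode name)) := by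
  intro y hy
  obtain ⟨χ, hχ, rfl⟩ := List.mem_map.1 hy
  have hsub : ∀ θ ∈ χ.subs, θ.encode name ∈ φ.subs.map (Formula.encode name) := fun θ hθ =>
    List.mem_map_of_mem (subs_trans hχ hθ)
  have hin := hφ.of_mem_subs hχ
  cases χ with
  | atom a => simp [Formula.encode]
  | negAtom a => simp [Formula.encode]
  | and θ ψ =>
    exact .inr (.inl ⟨_, hsub θ (by simp [subs, self_mem_subs]), _,
      hsub ψ (by simp [subs, self_mem_subs]), rfl⟩)
  | or θ ψ => exact hin.elim
  | future c q ψ =>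
    exact .inr (.inr ⟨by simp [Formula.encode], .inl rfl,
      hsub ψ (by simp [subs, self_mem_subs])⟩)
  | globally c q ψ =>
    exact .inr (.inr ⟨by simp [Formula.encode], .inr rfl,
      hsub ψ (by simp [subs, self_mem_subs])⟩)

theorem mkLetter_mem_subs {j : ℕ} {l : List (Formula A)} {y : List ℕ}
    (h : y ∈ (mkLetter name φ j l).2) : y ∈ φ.subs.map (Formula.encode name) := by
  obtain ⟨χ, h', rfl⟩ := mem_mkLetter.1 h
  exact List.mem_map_of_mem h'.1

theorem mkLetter_literal (hname : Function.Injective name) {j : ℕ} {l : List (Formula A)}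
    (hl : ∀ χ ∈ l, M.Sat χ s) {y : List ℕ} (h : y ∈ (mkLetter name φ j l).2)
    (h1 : y.head? = some 1) : 0 :: y.drop 1 ∉ (mkLetter name φ j l).2 := by
  obtain ⟨χ, h', rfl⟩ := mem_mkLetter.1 h
  obtain ⟨a, rfl⟩ := head_encode_one h1
  intro h0
  have h2 := (encode_mem_mkLetter hname (χ := atom a)).1 h0
  exact hl _ h'.2 (hl _ h2.2)

theorem mkLetter_conj (hname : Function.Injective name) {j : ℕ} {l : List (Formula A)}
    (hl : SplitsAnd l) {y : List ℕ} (h : y ∈ (mkLetter name φ j l).2)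
    (h1 : y.head? = some 2) : ∃ u ∈ (mkLetter name φ j l).2, ∃ v ∈ (mkLetter name φ j l).2,
      y = 2 :: (u ++ v) := by
  obtain ⟨χ, h', rfl⟩ := mem_mkLetter.1 h
  obtain ⟨θ, ψ, rfl⟩ := head_encode_two h1
  have h2 := hl _ _ h'.2
  exact ⟨_, (encode_mem_mkLetter hname).2 ⟨subs_trans h'.1 (by simp [subs, self_mem_subs]), h2.1⟩,
    _, (encode_mem_mkLetter hname).2 ⟨subs_trans h'.1 (by simp [subs, self_mem_subs]), h2.2⟩, rfl⟩

/-- The bodies of the `G`-formulas that hold from the state `s` on: those given and those that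
arise from the formulas `N` to be satisfied in `s`. -/
noncomputable def nodeBoxes (M : MarkovChain A) (s : M.S) (N Γ : List (Formula A)) :
    List (Formula A) := Γ ++ N.flatMap (M.boxes s)

/-- The formulas claimed in a node for the state `s` in order to satisfy the formulas `N` there, and
`G ψ` for the formulas `ψ` of `Γ`. -/
noncomputable def nodeClaims (M : MarkovChain A) (s : M.S) (N Γ : List (Formula A)) :
    List (Formula A) :=
  N.flatMap (M.now s) ++ (nodeBoxes M s N Γ).flatMap fun ψ => ψ.box.core

/-- The formulas `N` and `G ψ` for `ψ ∈ Γ` are subformulas of `φ` that hold in `s`. -/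
structure IsTask (M : MarkovChain A) (φ : Formula A) (s : M.S) (N Γ : List (Formula A)) :
    Prop where
  now : ∀ χ ∈ N, χ ∈ φ.subs ∧ M.Sat χ s
  boxes : ∀ ψ ∈ Γ, ψ.box ∈ φ.subs ∧ M.Sat ψ.box s

namespace IsTask
variable {N Γ : List (Formula A)} (h : IsTask M φ s N Γ) (hφ : φ.InFqG1)
include h hφ

theorem nodeBoxes {ψ : Formula A} (hψ : ψ ∈ nodeBoxes M s N Γ) :
    ψ.box ∈ φ.subs ∧ M.Sat ψ.box s := by
  rcases List.mem_append.1 hψ with hψ | hψ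
  · exact h.boxes ψ hψ
  · obtain ⟨χ, hχ, hψ⟩ := List.mem_flatMap.1 hψ
    have h1 := h.now χ hχ
    have h2 := hφ.of_mem_subs h1.1
    exact ⟨subs_trans h1.1 (MarkovChain.box_mem_subs h2 hψ), MarkovChain.sat_box_of_mem h2 h1.2 hψ⟩

theorem mem_subs {χ : Formula A} (hχ : χ ∈ nodeClaims M s N Γ) : χ ∈ φ.subs := by
  rcases List.mem_append.1 hχ with hχ | hχ
  · obtain ⟨θ, hθ, hχ⟩ := List.mem_flatMap.1 hχ
    exact subs_trans (h.now θ hθ).1 (MarkovChain.now_subset_subs hχ)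
  · obtain ⟨θ, hθ, hχ⟩ := List.mem_flatMap.1 hχ
    exact subs_trans (h.nodeBoxes hφ hθ).1 (core_subset_subs _ hχ)

theorem sat {χ : Formula A} (hχ : χ ∈ nodeClaims M s N Γ) : M.Sat χ s := by
  rcases List.mem_append.1 hχ with hχ | hχ
  · obtain ⟨θ, hθ, hχ⟩ := List.mem_flatMap.1 hχ
    have h1 := h.now θ hθ
    exact MarkovChain.sat_now (hφ.of_mem_subs h1.1) h1.2 hχ
  · obtain ⟨θ, hθ, hχ⟩ := List.mem_flatMap.1 hχ
    have h1 := h.nodeBoxes hφ hθ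
    exact M.sat_core (hφ.of_mem_subs h1.1) h1.2 hχ

omit h hφ in
theorem split : SplitsAnd (nodeClaims M s N Γ) := by
  intro θ ψ hχ
  rcases List.mem_append.1 hχ with hχ | hχ
  · obtain ⟨η, hη, hχ⟩ := List.mem_flatMap.1 hχ
    have := MarkovChain.now_split _ _ hχ
    exact ⟨List.mem_append_left _ (List.mem_flatMap.2 ⟨η, hη, this.1⟩),
      List.mem_append_left _ (List.mem_flatMap.2 ⟨η, hη, this.2⟩)⟩
  · obtain ⟨η, hη, hχ⟩ := List.mem_flatMap.1 hχ
    have := core_split _ _ _ hχ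
    exact ⟨List.mem_append_right _ (List.mem_flatMap.2 ⟨η, hη, this.1⟩),
      List.mem_append_right _ (List.mem_flatMap.2 ⟨η, hη, this.2⟩)⟩

omit h hφ in
theorem mem_of_core {ψ χ : Formula A} (hψ : ψ ∈ Certificate.nodeBoxes M s N Γ)
    (hχ : χ ∈ ψ.box.core) : χ ∈ nodeClaims M s N Γ :=
  List.mem_append_right _ (List.mem_flatMap.2 ⟨ψ, hψ, hχ⟩)

theorem globally {c : Cmp} {q : Set.Icc (0 : ℚ) 1} {χ : Formula A}
    (hχ : globally c q χ ∈ nodeClaims M s N Γ) :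
    ∃ ψ ∈ Certificate.nodeBoxes M s N Γ, Formula.globally c q χ ∈ ψ.box.core := by
  rcases List.mem_append.1 hχ with hχ | hχ
  · obtain ⟨η, hη, hχ⟩ := List.mem_flatMap.1 hχ
    obtain ⟨ψ, h1, h2⟩ := MarkovChain.now_globally (hφ.of_mem_subs (h.now η hη).1) hχ
    exact ⟨ψ, List.mem_append_right _ (List.mem_flatMap.2 ⟨η, hη, h1⟩), h2⟩
  · exact List.mem_flatMap.1 hχ

theorem future {c : Cmp} {q : Set.Icc (0 : ℚ) 1} {χ : Formula A}
    (hχ : future c q χ ∈ nodeClaims M s N Γ) :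
    χ ∈ nodeClaims M s N Γ ∨ χ ∈ N.flatMap (M.pending s) ∨
      ∃ ψ ∈ Certificate.nodeBoxes M s N Γ, Formula.future c q χ ∈ ψ.box.core := by
  rcases List.mem_append.1 hχ with hχ | hχ
  · obtain ⟨η, hη, hχ⟩ := List.mem_flatMap.1 hχ
    rcases MarkovChain.now_future (hφ.of_mem_subs (h.now η hη).1) hχ with h1 | h1 | ⟨ψ, h1, h2⟩
    · exact .inl (List.mem_append_left _ (List.mem_flatMap.2 ⟨η, hη, h1⟩))
    · exact .inr (.inl (List.mem_flatMap.2 ⟨η, hη, h1⟩))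
    · exact .inr (.inr ⟨ψ, List.mem_append_right _ (List.mem_flatMap.2 ⟨η, hη, h1⟩), h2⟩)
  · exact .inr (.inr (List.mem_flatMap.1 hχ))

end IsTask

/-- The family `z` with the weights `p` unfolds the state `s` into a certificate: the formulas `N`
and `G ψ` for `ψ ∈ Γ` are claimed at its root, the formulas of `Fs` are visited at least as
probably as in the original chain, and the `F`-formulas that `Γ` requires everywhere hold because
the loops of all lassos visit their bodies, unless they hold for trivial reasons. -/
structure Realizes (M : MarkovChain A) (name : A → ℕ) (φ : Formula A) (s : M.S) (j : ℕ)
    (N Fs Γ : List (Formula A)) (b n : ℕ) {ι : Type} [Fintype ι] (z : ι → Lasso) (p : ι → ℝ) :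
    Prop where
  cert : IsCertificate z p (φ.subs.map (Formula.encode name))
  numbered : IsNumbered z b n
  claims_le : ∀ i, ∀ a ∈ (z i).1, a.2.length ≤ φ.length
  total : ∑ i, p i = 1
  root : ∀ i, letterAt (z i).1 0 = mkLetter name φ j (nodeClaims M s N Γ)
  visit : ∀ χ ∈ Fs, (M.hit {t | M.Sat χ t} s).toReal ≤ totalVisit z p (χ.encode name)
  recur : ∀ ψ ∈ Γ, ∀ c q χ, future c q χ ∈ ψ.box.core → c.Holds 0 ((q : ℚ) : ℝ) ∨
    ∀ i, (z i).Visits (z i).2 (χ.encode name)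

/-- From every state a state can be reached after which no further `G`-formula becomes true. -/
theorem exists_stable (M : MarkovChain A) (s : M.S) (l : List (Formula A)) :
    ∃ r, M.Reach s r ∧ ∀ t, M.Reach r t → ∀ ψ ∈ l, M.Sat ψ.box t → M.Sat ψ.box r := by
  induction l with
  | nil => exact ⟨s, .refl, by simp⟩
  | cons ψ l ih =>
    obtain ⟨r, hr, hst⟩ := ih
    by_cases h : ∃ t, M.Reach r t ∧ M.Sat ψ.box t
    · obtain ⟨t, hrt, ht⟩ := h
      refine ⟨t, hr.trans hrt, fun t' ht' θ hθ hs => ?_⟩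
      rcases List.mem_cons.1 hθ with rfl | hθ
      · exact ht
      · exact M.sat_box_of_reach (hst t' (hrt.trans ht') θ hθ hs) hrt
    · refine ⟨r, hr, fun t ht θ hθ hs => ?_⟩
      rcases List.mem_cons.1 hθ with rfl | hθ
      · exact absurd ⟨t, ht, hs⟩ h
      · exact hst t ht θ hθ hs

/-- Finitely many reachable states witness all the formulas of a list that hold in some reachable
state. -/
theorem exists_witnesses (M : MarkovChain A) (r : M.S) (l : List (Formula A)) :
    ∃ w : List M.S, w.length ≤ l.length ∧ (∀ t ∈ w, M.Reach r t) ∧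
      ∀ χ ∈ l, (∃ t, M.Reach r t ∧ M.Sat χ t) → ∃ t ∈ w, M.Sat χ t := by
  induction l with
  | nil => exact ⟨[], by simp⟩
  | cons ψ l ih =>
    obtain ⟨w, hw, hr, hl⟩ := ih
    by_cases h : ∃ t, M.Reach r t ∧ M.Sat ψ t
    · obtain ⟨t, hrt, ht⟩ := h
      refine ⟨t :: w, by simpa using hw, by simpa using ⟨hrt, hr⟩, fun χ hχ hex => ?_⟩
      rcases List.mem_cons.1 hχ with rfl | hχ
      · exact ⟨t, by simp, ht⟩
      · obtain ⟨t', ht', hs⟩ := hl χ hχ hex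
        exact ⟨t', by simp [ht'], hs⟩
    · refine ⟨w, by simp; omega, hr, fun χ hχ hex => ?_⟩
      rcases List.mem_cons.1 hχ with rfl | hχ
      · exact absurd hex h
      · exact hl χ hχ hex

theorem length_flatMap_bodies_add_length_le (l : List (Formula A)) :
    (l.flatMap bodies).length + l.length ≤ MarkovChain.weight l := by
  induction l with
  | nil => simp
  | cons ψ l ih =>
    have := length_bodies_le ψ
    simp only [List.flatMap_cons, List.length_append, List.length_cons, MarkovChain.weight,
      List.map_cons, List.sum_cons] at ih ⊢
    omega

/-- A node without pending formulas is followed by a loop through witnesses, taken from a part of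
the chain in which the true `G`-formulas no longer change, for all the `F`-formulas that could be
required there. -/
theorem exists_realizes_of_no_pending (hname : Function.Injective name) (hφ : φ.InFqG1)
    {N Γ : List (Formula A)} {j b n : ℕ} (h : IsTask M φ s N Γ)
    (hpend : N.flatMap (M.pending s) = []) (hj : j < b) (hn : 1 ≤ n)
    (hw : MarkovChain.weight (nodeBoxes M s N Γ) ≤ n) :
    ∃ (z : Unit → Lasso) (p : Unit → ℝ), Realizes M name φ s j N [] Γ b n z p := by
  classical
  set Γ' := nodeBoxes M s N Γ with hΓ'
  set W := Γ'.flatMap (fun ψ => ψ.box.subs) with hW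
  obtain ⟨r, hsr, hstable⟩ := exists_stable M s W
  obtain ⟨w, hwl, hwr, hwit⟩ := exists_witnesses M r (Γ'.flatMap bodies)
  set cl : M.S → List (Formula A) := fun t => W.filter (M.Sat · t) with hcl
  set root := mkLetter name φ j (nodeClaims M s N Γ) with hroot
  set loop := w.map (fun t => mkLetter name φ 0 (cl t)) with hloop
  set k := min 1 w.length with hk
  have hWsub : ∀ χ ∈ W, χ ∈ φ.subs := fun χ hχ => by
    obtain ⟨ψ, hψ, hχ⟩ := List.mem_flatMap.1 hχ
    exact subs_trans (h.nodeBoxes hφ hψ).1 hχ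
  have hWtrans : ∀ χ ∈ W, ∀ θ ∈ χ.subs, θ ∈ W := fun χ hχ θ hθ => by
    obtain ⟨ψ, hψ, hχ⟩ := List.mem_flatMap.1 hχ
    exact List.mem_flatMap.2 ⟨ψ, hψ, subs_trans hχ hθ⟩
  have hcore : ∀ ψ ∈ Γ', ∀ χ ∈ ψ.box.core, χ ∈ W ∧ M.Sat χ r := fun ψ hψ χ hχ => by
    have h1 := h.nodeBoxes hφ hψ
    exact ⟨List.mem_flatMap.2 ⟨ψ, hψ, core_subset_subs _ hχ⟩,
      M.sat_core (hφ.of_mem_subs h1.1) (M.sat_box_of_reach h1.2 hsr) hχ⟩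
  have hmemcl : ∀ t χ, χ ∈ cl t ↔ χ ∈ W ∧ M.Sat χ t := fun t χ => by simp [hcl]
  have hmemloop : ∀ t ∈ w, ∀ χ ∈ W, M.Sat χ t →
      χ.encode name ∈ (mkLetter name φ 0 (cl t)).2 := fun t ht χ hχ hs =>
    (encode_mem_mkLetter hname).2 ⟨hWsub χ hχ, (hmemcl t χ).2 ⟨hχ, hs⟩⟩
  -- an `F`-formula that is true in the stable part is trivial or has a witness on the loop
  have hfut : ∀ c q χ, future c q χ ∈ W → ∀ u, M.Reach r u → M.Sat (future c q χ) u →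
      c.Holds 0 ((q : ℚ) : ℝ) ∨ (c.Holds 1 ((q : ℚ) : ℝ) ∧
        Lasso.Visits (root :: loop, k) k (χ.encode name)) := by
    intro c q χ hχ u hu hs
    rw [M.sat_future] at hs
    by_cases h0 : M.hit {t | M.Sat χ t} u = 0
    · rw [h0] at hs
      exact .inl (by simpa using hs)
    · right
      refine ⟨hs.mono (M.toReal_hit_le_one _ _), ?_⟩
      obtain ⟨t, ht, hut⟩ := M.hit_ne_zero_iff.1 h0
      obtain ⟨ψ, hψ, hχψ⟩ := List.mem_flatMap.1 hχ
      obtain ⟨t', ht', hs'⟩ := hwit χ (List.mem_flatMap.2 ⟨ψ, hψ, mem_bodies (φ := ψ) (by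
        simpa [box, subs] using hχψ)⟩) ⟨t, hu.trans hut, ht⟩
      have hwpos := List.length_pos_of_mem ht'
      have hk1 : k = 1 := by omega
      refine ⟨_, ?_, hmemloop t' ht' χ (hWtrans _ hχ _ (by simp [subs, self_mem_subs])) hs'⟩
      simp only [hk1, min_self, List.drop_succ_cons, List.drop_zero]
      exact List.mem_map_of_mem ht'
  -- the letters of the word
  have hlet : ∀ i, ∀ y ∈ (letterAt (root :: loop) i).2, (i = 0 ∧ y ∈ root.2) ∨
      (k = 1 ∧ 1 ≤ i ∧ ∃ t ∈ w, y ∈ (mkLetter name φ 0 (cl t)).2) := by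
    intro i y hy
    cases i with
    | zero => exact .inl ⟨rfl, hy⟩
    | succ i =>
      right
      rw [letterAt_cons_succ] at hy
      have hlt := lt_length_of_mem hy
      have hmem := letterAt_mem hlt
      obtain ⟨t, ht, he⟩ := List.mem_map.1 hmem
      have hwpos := List.length_pos_of_mem ht
      exact ⟨by omega, by omega, t, ht, he ▸ hy⟩
  have hletters : ∀ a ∈ root :: loop, a = root ∨ ∃ t ∈ w, a = mkLetter name φ 0 (cl t) := by
    intro a ha
    rcases List.mem_cons.1 ha with rfl | ha
    · exact .inl rfl
    · obtain ⟨t, ht, rfl⟩ := List.mem_map.1 ha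
      exact .inr ⟨t, ht, rfl⟩
  have hsplit : ∀ t, SplitsAnd (cl t) := fun t θ ψ hθ => by
    rw [hmemcl] at hθ
    exact ⟨(hmemcl _ _).2 ⟨hWtrans _ hθ.1 _ (by simp [subs, self_mem_subs]), hθ.2.1⟩,
      (hmemcl _ _).2 ⟨hWtrans _ hθ.1 _ (by simp [subs, self_mem_subs]), hθ.2.2⟩⟩
  have hcoh : Lasso.Coherent (φ.subs.map (Formula.encode name)) (root :: loop, k) := by
    refine ⟨?_, ?_, ?_, ?_, ?_⟩
    · simp only [List.length_cons, hloop, List.length_map]; omega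
    · intro a ha y hy
      rcases hletters a ha with rfl | ⟨t, ht, rfl⟩ <;> exact mkLetter_mem_subs hy
    · intro a ha y hy h1
      rcases hletters a ha with rfl | ⟨t, ht, rfl⟩
      · exact mkLetter_literal hname (fun χ hχ => h.sat hφ hχ) hy h1
      · exact mkLetter_literal hname (fun χ hχ => ((hmemcl t χ).1 hχ).2) hy h1
    · intro a ha y hy h1
      rcases hletters a ha with rfl | ⟨t, ht, rfl⟩
      · exact mkLetter_conj hname IsTask.split hy h1
      · exact mkLetter_conj hname (hsplit t) hy h1
    · intro i hi y hy h5 a ha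
      -- a claimed `G`-formula holds in the whole stable part
      have key : ∀ ψ : Formula A, ψ.box ∈ W → M.Sat ψ.box r → ∀ t ∈ w,
          ψ.box.encode name ∈ (mkLetter name φ 0 (cl t)).2 ∧
            ψ.encode name ∈ (mkLetter name φ 0 (cl t)).2 := fun ψ hψ hs t ht =>
        ⟨hmemloop t ht _ hψ (M.sat_box_of_reach hs (hwr t ht)),
          hmemloop t ht _ (hWtrans _ hψ _ (by simp [box, subs, self_mem_subs]))
            (M.sat_box.1 hs t (hwr t ht))⟩
      have hdrop : ∀ ψ : Formula A, (ψ.box.encode name).drop 4 = ψ.encode name := fun ψ => by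
        simp [box, Formula.encode]
      rcases hlet i y hy with ⟨rfl, hy⟩ | ⟨hk1, hi1, t, ht, hy⟩
      · obtain ⟨χ, ⟨hχs, hχ⟩, rfl⟩ := mem_mkLetter.1 hy
        obtain ⟨c, q, ψ, rfl⟩ := head_encode_five h5
        obtain ⟨θ, hθ, hψθ⟩ := h.globally hφ hχ
        have hbox := globally_eq_box (hφ.of_mem_subs hχs)
        rcases hletters a (List.mem_of_mem_drop ha) with rfl | ⟨t, ht, rfl⟩
        · refine ⟨hy, ?_⟩
          rw [hbox, hdrop, hroot, encode_mem_mkLetter hname]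
          have := IsTask.mem_of_core (M := M) hθ (core_globally hψθ)
          exact ⟨h.mem_subs hφ this, this⟩
        · rw [hbox] at hψθ ⊢
          rw [hdrop]
          have := hcore θ hθ _ hψθ
          exact key ψ this.1 this.2 t ht
      · obtain ⟨χ, ⟨hχs, hχ⟩, rfl⟩ := mem_mkLetter.1 hy
        obtain ⟨c, q, ψ, rfl⟩ := head_encode_five h5
        have hbox := globally_eq_box (hφ.of_mem_subs hχs)
        rw [hbox] at hχ ⊢
        rw [hdrop]
        rw [hmemcl] at hχ
        have hr := hstable t (hwr t ht) ψ (hWtrans _ hχ.1 _ (by simp [box, subs, self_mem_subs]))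
          hχ.2
        simp only [hk1, min_eq_right hi1, List.drop_succ_cons, List.drop_zero] at ha
        obtain ⟨t', ht', rfl⟩ := List.mem_map.1 ha
        exact key ψ hχ.1 hr t' ht'
  have hmono : ∀ i y, Lasso.Visits (root :: loop, k) k y → Lasso.Visits (root :: loop, k) i y := by
    rintro i y ⟨a, ha, hy⟩
    refine ⟨a, ?_, hy⟩
    simp only [min_self] at ha ⊢
    have hd := List.drop_drop (i := k - min i k) (j := min i k) (l := root :: loop)
    rw [show min i k + (k - min i k) = k by omega] at hd
    rw [← hd] at ha
    exact List.mem_of_mem_drop ha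
  have hnil : ∀ χ, χ ∉ N.flatMap (M.pending s) := fun χ hχ => by simp [hpend] at hχ
  refine ⟨fun _ => (root :: loop, k), fun _ => 1,
    isCertificate_single (subClosed_subs hφ) hcoh fun i y hy h4 => ?_, ⟨?_, ?_, ?_⟩, ?_, by simp,
    fun _ => rfl, by simp, ?_⟩
  · -- the `F`-formulas at the root and on the loop
    have hgoal : ∀ c q χ, (c.Holds 0 ((q : ℚ) : ℝ) ∨ (c.Holds 1 ((q : ℚ) : ℝ) ∧
        Lasso.Visits (root :: loop, k) i (χ.encode name))) →
        ∃ H : ℝ, 0 ≤ H ∧ H ≤ 1 ∧ FutureHolds ((future c q χ).encode name) 1 H ∧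
          (H = 0 ∨ Lasso.Visits (root :: loop, k) i (((future c q χ).encode name).drop 4)) := by
      rintro c q χ (h0 | ⟨h1, hv⟩)
      · exact ⟨0, le_rfl, zero_le_one, futureHolds_of_holds h0, .inl rfl⟩
      · exact ⟨1, zero_le_one, le_rfl, futureHolds_of_holds h1, .inr hv⟩
    rcases hlet i y hy with ⟨rfl, hy⟩ | ⟨hk1, hi1, t, ht, hy⟩
    · obtain ⟨χ, ⟨hχs, hχ⟩, rfl⟩ := mem_mkLetter.1 hy
      obtain ⟨c, q, ψ, rfl⟩ := head_encode_four h4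
      refine hgoal c q ψ ?_
      rcases h.future hφ hχ with h1 | h1 | ⟨θ, hθ, h1⟩
      · refine .inr ⟨Cmp.Holds.mono (h.sat hφ hχ) (M.toReal_hit_le_one _ _), ?_⟩
        refine ⟨root, by simp, ?_⟩
        exact (encode_mem_mkLetter hname).2 ⟨h.mem_subs hφ h1, h1⟩
      · exact absurd h1 (hnil _)
      · have := hcore θ hθ _ h1
        exact (hfut c q ψ this.1 r .refl this.2).imp id fun h => ⟨h.1, hmono _ _ h.2⟩
    · obtain ⟨χ, ⟨hχs, hχ⟩, rfl⟩ := mem_mkLetter.1 hy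
      obtain ⟨c, q, ψ, rfl⟩ := head_encode_four h4
      refine hgoal c q ψ ?_
      rw [hmemcl] at hχ
      exact (hfut c q ψ hχ.1 t (hwr t ht) hχ.2).imp id fun h => ⟨h.1, hmono _ _ h.2⟩
  · intro _
    have h1 := length_flatMap_bodies_add_length_le Γ'
    simp only [List.length_cons, hloop, List.length_map]
    rcases Nat.eq_zero_or_pos Γ'.length with h0 | h0
    · rw [List.length_eq_zero_iff] at h0
      simp [h0] at hwl
      simp [hwl]; omega
    · omega
  · intro _ a ha
    rcases hletters a ha with rfl | ⟨t, ht, rfl⟩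
    · exact hj
    · exact lt_of_le_of_lt (Nat.zero_le j) hj
  · intro _ _ i _ _ _ _
    rfl
  · intro _ a ha
    rcases hletters a ha with rfl | ⟨t, ht, rfl⟩ <;> exact length_mkLetter_le
  · intro ψ hψ c q χ hχ
    have := hcore ψ (List.mem_append_left _ hψ) _ hχ
    exact (hfut c q χ this.1 r .refl this.2).imp id fun h _ => h.2

end Certificate
end PCTL

namespace PCTL

/-! ### Unfolding a model -/
namespace Certificate
open Formula

variable {A : Type u} {M : MarkovChain A} {name : A → ℕ} {φ : Formula A} {s : M.S}

section totalVisit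
variable {ι : Type} [Fintype ι] {z : ι → Lasso} {p : ι → ℝ} {y : List ℕ}

theorem totalVisit_nonneg (hp : ∀ i, 0 < p i) : 0 ≤ totalVisit z p y :=
  Finset.sum_nonneg fun i _ => by split_ifs; exacts [(hp i).le, le_rfl]

theorem totalVisit_of_forall_visits (h : ∀ i, (z i).Visits 0 y) : totalVisit z p y = ∑ i, p i :=
  Finset.sum_congr rfl fun i _ => if_pos (h i)

theorem visits_of_le {z : Lasso} {m n : ℕ} (h : z.Visits n y) (hmn : m ≤ n) : z.Visits m y := by
  obtain ⟨a, ha, hy⟩ := h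
  refine ⟨a, ?_, hy⟩
  have hd := List.drop_drop (i := min n z.2 - min m z.2) (j := min m z.2) (l := z.1)
  rw [show min m z.2 + (min n z.2 - min m z.2) = min n z.2 by omega] at hd
  rw [← hd] at ha
  exact List.mem_of_mem_drop ha

theorem visits_zero_of_mem_root {z : Lasso} (h : y ∈ (letterAt z.1 0).2) : z.Visits 0 y :=
  ⟨letterAt z.1 0, by simpa using letterAt_mem (lt_length_of_mem h), h⟩

end totalVisit

theorem weight_flatMap_pending_add_weight_flatMap_boxes_le (N : List (Formula A)) :
    MarkovChain.weight (N.flatMap (M.pending s)) + MarkovChain.weight (N.flatMap (M.boxes s)) ≤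
      (N.map Formula.length).sum := by
  induction N with
  | nil => simp [MarkovChain.weight]
  | cons θ N ih =>
    have := MarkovChain.weight_pending_add_weight_boxes_le (M := M) (s := s) (θ := θ)
    simp only [List.flatMap_cons, MarkovChain.weight_append, List.map_cons, List.sum_cons]
    omega

theorem two_mul_length_le_weight (l : List (Formula A)) :
    2 * l.length ≤ MarkovChain.weight l := by
  induction l with
  | nil => simp
  | cons θ l ih =>
    have := one_le_length θ
    simp only [MarkovChain.weight, List.length_cons, List.map_cons, List.sum_cons] at ih ⊢
    omega

open Classical in
/-- Formulas that become true leave the list of pending ones and lose the weight of an `F` each. -/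
theorem sum_filter_add_weight_filter_le (P : Formula A → Prop) (l : List (Formula A)) :
    ((l.filter (P ·)).map Formula.length).sum + MarkovChain.weight (l.filter (¬ P ·)) ≤
      MarkovChain.weight l ∧ ((∃ χ ∈ l, P χ) →
    ((l.filter (P ·)).map Formula.length).sum + MarkovChain.weight (l.filter (¬ P ·)) <
      MarkovChain.weight l) := by
  induction l with
  | nil => simp [MarkovChain.weight]
  | cons θ l ih =>
    by_cases hθ : P θ
    · simp only [MarkovChain.weight] at ih ⊢
      simp [hθ]
      simp at ih
      omega
    · simp only [MarkovChain.weight] at ih ⊢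
      simp [hθ]
      simp at ih
      refine ⟨by omega, fun χ h1 h2 => ?_⟩
      have := ih.2 χ h1 h2
      omega

/-- A node with pending formulas: the first visits to states that satisfy one of them form a
subdistribution, which by convexity can be replaced by one with few states. The chosen states become
the children of the node. A child carries fewer obligations, as one of the pending formulas is
true in it and its outermost `F` is discharged; the missing probability goes to a child that only
has to maintain the `G`-formulas. -/
theorem exists_realizes_of_pending (hname : Function.Injective name) (hφ : φ.InFqG1)
    {N Fs Γ : List (Formula A)} {j b k : ℕ} (h : IsTask M φ s N Γ)
    (hF : ∀ χ ∈ Fs, χ ∈ φ.subs)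
    (hI : Fs ++ N.flatMap (M.pending s) ≠ []) (hj : j < b)
    (hk : (N.map Formula.length).sum + MarkovChain.weight Fs + MarkovChain.weight Γ ≤ k + 1)
    (hb : k + 1 < b)
    (ih : ∀ (s : M.S) (N Fs Γ : List (Formula A)) (j : ℕ), IsTask M φ s N Γ →
      (∀ χ ∈ Fs, χ ∈ φ.subs) →
      (N.map Formula.length).sum + MarkovChain.weight Fs + MarkovChain.weight Γ ≤ k → j < b →
      ∃ (ι : Type) (_ : Fintype ι) (z : ι → Lasso) (p : ι → ℝ),
        Realizes M name φ s j N Fs Γ b (max 1 k) z p) :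
    ∃ (ι : Type) (_ : Fintype ι) (z : ι → Lasso) (p : ι → ℝ),
      Realizes M name φ s j N Fs Γ b (max 1 (k + 1)) z p := by
  classical
  set I := Fs ++ N.flatMap (M.pending s) with hIdef
  set Γ' := nodeBoxes M s N Γ with hΓ'
  have hIsub : ∀ χ ∈ I, χ ∈ φ.subs := fun χ hχ => by
    rcases List.mem_append.1 hχ with hχ | hχ
    · exact hF χ hχ
    · obtain ⟨θ, hθ, hχ⟩ := List.mem_flatMap.1 hχ
      exact subs_trans (h.now θ hθ).1 (MarkovChain.pending_subset_subs hχ)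
  have hwt : MarkovChain.weight I + MarkovChain.weight Γ' ≤ k + 1 := by
    have := weight_flatMap_pending_add_weight_flatMap_boxes_le (M := M) (s := s) N
    simp only [hIdef, hΓ', nodeBoxes, MarkovChain.weight_append]
    omega
  have hIlen := two_mul_length_le_weight I
  have hIpos := List.length_pos_of_ne_nil hI
  set T : Set M.S := {t | ∃ χ ∈ I, M.Sat χ t} with hT
  obtain ⟨m, hm, τ, c, hc, hcsum, hτ, hval⟩ := exists_finite_subconvex
    (fun t => M.firstHit T s t) (M.tsum_firstHit_le T s)
    (fun t (i : Fin I.length) => M.hit {t | M.Sat (I.get i) t} t) (fun t i => M.hit_le_one _ _)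
  rw [Fintype.card_fin] at hm
  have hchild : ∀ i : Fin m, ∃ (s' : M.S) (N' Fs' : List (Formula A)) (κ : Type)
      (_ : Fintype κ) (z : κ → Lasso) (p : κ → ℝ),
      Realizes M name φ s' i N' Fs' Γ' b (max 1 k) z p ∧
      ∀ χ ∈ I, ((τ i).elim 0 fun t => (M.hit {t | M.Sat χ t} t).toReal) ≤
        totalVisit z p (χ.encode name) := by
    intro i
    -- there are at most `|I| + 1` children, and every formula of `I` has weight at least two
    have hib : (i : ℕ) < b := by have := i.2; omega
    rcases hi : τ i with _ | t
    -- the child for the missing probability stays in `s` and only keeps up the `G`-formulas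
    · obtain ⟨κ, inst, z, p, hR⟩ := ih s [] [] Γ' i ⟨by simp, fun ψ hψ => h.nodeBoxes hφ hψ⟩
        (by simp) (by
          rw [show MarkovChain.weight ([] : List (Formula A)) = 0 from rfl, List.map_nil,
            List.sum_nil]
          omega) hib
      exact ⟨s, [], [], κ, inst, z, p, hR, fun χ _ => totalVisit_nonneg hR.cert.pos⟩
    · obtain ⟨hχt, hst⟩ := M.firstHit_ne_zero (hτ i t hi)
      obtain ⟨hle, hlt⟩ := sum_filter_add_weight_filter_le (M.Sat · t) I
      have hlt := hlt hχt
      obtain ⟨κ, inst, z, p, hR⟩ := ih t (I.filter (M.Sat · t)) (I.filter (¬ M.Sat · t)) Γ' i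
        ⟨fun χ hχ => by
          have hχ := List.mem_filter.1 hχ
          exact ⟨hIsub χ hχ.1, by simpa using hχ.2⟩,
          fun ψ hψ => ⟨(h.nodeBoxes hφ hψ).1, M.sat_box_of_reach (h.nodeBoxes hφ hψ).2 hst⟩⟩
        (fun χ hχ => by
          exact hIsub χ (List.mem_filter.1 hχ).1) (by omega) hib
      refine ⟨t, _, _, κ, inst, z, p, hR, fun χ hχ => ?_⟩
      by_cases hs : M.Sat χ t
      · rw [totalVisit_of_forall_visits, hR.total]
        · exact M.toReal_hit_le_one _ _
        · intro l
          refine visits_zero_of_mem_root ?_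
          rw [hR.root, encode_mem_mkLetter hname]
          refine ⟨hIsub χ hχ, List.mem_append_left _ (List.mem_flatMap.2 ⟨χ, ?_,
            MarkovChain.self_mem_now⟩)⟩
          simpa using ⟨hχ, hs⟩
      · exact hR.visit χ (by simpa using ⟨hχ, hs⟩)
  choose s' N' Fs' κ inst z p hR hV using hchild
  set a := mkLetter name φ j (nodeClaims M s N Γ) with ha
  set r : Fin m → Letter := fun i => mkLetter name φ i (nodeClaims M (s' i) (N' i) Γ') with hr
  have hroot : ∀ i l, letterAt (z i l).1 0 = r i := fun i l => (hR i).root l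
  have hrn : ∀ i, (r i).1 = i := fun i => rfl
  have hp : ∀ i l, 0 < p i l := fun i => (hR i).cert.pos
  have hpos : ∀ q, 0 < joinWeight c p q := fun q => mul_pos (hc _) (hp _ _)
  have hsum : ∑ i, c i * ∑ l, p i l = 1 := by
    simp only [(hR _).total, mul_one, hcsum]
  have htotal : ∑ q, joinWeight c p q = 1 := by
    rw [Fintype.sum_sigma, ← hsum]
    exact Finset.sum_congr rfl fun i _ => by rw [Finset.mul_sum]; rfl
  have hm0 : 0 < m := by
    rcases Nat.eq_zero_or_pos m with rfl | h0
    · simp at hcsum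
    · exact h0
  have hvisit : ∀ χ ∈ I, (M.hit {t | M.Sat χ t} s).toReal ≤
      totalVisit (join a z) (joinWeight c p) (χ.encode name) := by
    intro χ hχ
    obtain ⟨i, rfl⟩ := List.mem_iff_get.1 hχ
    refine le_trans ?_ (totalVisit_join (a := a) hc hp _)
    have h1 : (M.hit {t | M.Sat (I.get i) t} s).toReal ≤ (∑' t, M.firstHit T s t *
        M.hit {t | M.Sat (I.get i) t} t).toReal := by
      refine ENNReal.toReal_mono ?_ (M.hit_le_tsum_firstHit (T := T) (fun t ht => ⟨_, hχ, ht⟩) s)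
      refine ne_top_of_le_ne_top ENNReal.one_ne_top
        (le_trans (ENNReal.tsum_le_tsum fun t => ?_) (M.tsum_firstHit_le T s))
      exact mul_le_of_le_one_right' (M.hit_le_one _ _)
    rw [hval i] at h1
    refine h1.trans (Finset.sum_le_sum fun l _ => ?_)
    exact mul_le_mul_of_nonneg_left (hV l _ hχ) (hc l).le
  -- every child has inherited the `G`-formulas of the node, and each of its lassos makes good their
  -- `F`-formulas on its loop
  have hrecur : ∀ ψ ∈ Γ', ∀ c' q χ, future c' q χ ∈ ψ.box.core → c'.Holds 0 ((q : ℚ) : ℝ) ∨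
      ∀ l, (join a z l).Visits (join a z l).2 (χ.encode name) := by
    intro ψ hψ c' q χ hχ
    by_cases h0 : c'.Holds 0 ((q : ℚ) : ℝ)
    · exact .inl h0
    · refine .inr fun l => visits_join_succ.2 ?_
      exact ((hR l.1).recur ψ hψ c' q χ hχ).resolve_left h0 l.2
  have hfuture : ∀ y ∈ a.2, y.head? = some 4 →
      FutureHolds y 1 (totalVisit (join a z) (joinWeight c p) (y.drop 4)) := by
    intro y hy h4
    obtain ⟨χ', ⟨hχs, hχ⟩, rfl⟩ := mem_mkLetter.1 hy
    obtain ⟨c', q, χ, rfl⟩ := head_encode_four h4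
    refine futureHolds_of_holds ?_
    simp only [Formula.encode, List.drop_succ_cons, List.drop_zero]
    have hsat := h.sat hφ hχ
    rw [M.sat_future] at hsat
    have hall : (∀ l, (join a z l).Visits 0 (χ.encode name)) →
        c'.Holds (totalVisit (join a z) (joinWeight c p) (χ.encode name)) ((q : ℚ) : ℝ) := by
      intro hl
      rw [totalVisit_of_forall_visits hl, htotal]
      exact hsat.mono (M.toReal_hit_le_one _ _)
    rcases h.future hφ hχ with h1 | h1 | ⟨ψ, hψ, h1⟩
    · exact hall fun l => visits_zero_of_mem_root
        ((encode_mem_mkLetter hname).2 ⟨h.mem_subs hφ h1, h1⟩)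
    · exact hsat.mono (hvisit χ (List.mem_append_right _ h1))
    · rcases hrecur ψ hψ c' q χ h1 with h2 | h2
      · exact h2.mono (totalVisit_nonneg hpos)
      · exact hall fun l => visits_of_le (h2 l) (Nat.zero_le _)
  have hglob : ∀ y ∈ a.2, y.head? = some 5 → y.drop 4 ∈ a.2 ∧ ∀ i, y ∈ (r i).2 := by
    intro y hy h5
    obtain ⟨χ', ⟨hχs, hχ⟩, rfl⟩ := mem_mkLetter.1 hy
    obtain ⟨c', q, χ, rfl⟩ := head_encode_five h5
    obtain ⟨θ, hθ, hχθ⟩ := h.globally hφ hχ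
    simp only [Formula.encode, List.drop_succ_cons, List.drop_zero]
    have h1 := IsTask.mem_of_core (M := M) hθ (core_globally hχθ)
    refine ⟨(encode_mem_mkLetter hname).2 ⟨h.mem_subs hφ h1, h1⟩, fun i => ?_⟩
    exact (encode_mem_mkLetter hname (χ := globally c' q χ)).2 ⟨hχs, IsTask.mem_of_core
      (List.mem_append_left _ hθ) hχθ⟩
  refine ⟨Σ i, κ i, inferInstance, join a z, joinWeight c p,
    isCertificate_join hm0 hc (fun i => (hR i).cert) hroot hrn hsum
      (fun y hy => mkLetter_mem_subs hy)
      (fun y hy h1 => mkLetter_literal hname (fun χ hχ => h.sat hφ hχ) hy h1)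
      (fun y hy h1 => mkLetter_conj hname IsTask.split hy h1) hglob hfuture, ?_, ?_, htotal,
    fun _ => rfl, fun χ hχ => hvisit χ (List.mem_append_left _ hχ),
    fun ψ hψ => hrecur ψ (List.mem_append_left _ hψ)⟩
  · have := isNumbered_join (a := a) hj (fun i => (hR i).numbered) hroot hrn
    rwa [show max 1 k + 1 = max 1 (k + 1) by omega] at this
  · intro q x hx
    rcases List.mem_cons.1 hx with rfl | hx
    exacts [length_mkLetter_le, (hR q.1).claims_le q.2 x hx]

/-- Every state can be unfolded into a certificate whose height is bounded by the total length of
the obligations. -/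
theorem exists_realizes (hname : Function.Injective name) (hφ : φ.InFqG1) {b : ℕ} (k : ℕ)
    (hb : k < b) : ∀ (s : M.S) (N Fs Γ : List (Formula A)) (j : ℕ), IsTask M φ s N Γ →
      (∀ χ ∈ Fs, χ ∈ φ.subs) →
      (N.map Formula.length).sum + MarkovChain.weight Fs + MarkovChain.weight Γ ≤ k → j < b →
      ∃ (ι : Type) (_ : Fintype ι) (z : ι → Lasso) (p : ι → ℝ),
        Realizes M name φ s j N Fs Γ b (max 1 k) z p := by
  induction k with
  | zero =>
    intro s N Fs Γ j h hF hk hj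
    have hFs : Fs = [] := by
      have := two_mul_length_le_weight Fs
      exact List.length_eq_zero_iff.1 (by omega)
    have h1 := weight_flatMap_pending_add_weight_flatMap_boxes_le (M := M) (s := s) N
    have h2 := two_mul_length_le_weight (N.flatMap (M.pending s))
    subst hFs
    refine ⟨Unit, inferInstance, exists_realizes_of_no_pending hname hφ h
      (List.length_eq_zero_iff.1 (by omega)) hj (le_max_left _ _) ?_⟩
    simp only [nodeBoxes, MarkovChain.weight_append]
    omega
  | succ k ih =>
    intro s N Fs Γ j h hF hk hj
    by_cases hI : Fs ++ N.flatMap (M.pending s) = []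
    · obtain ⟨rfl, hp⟩ := List.append_eq_nil_iff.1 hI
      have h1 := weight_flatMap_pending_add_weight_flatMap_boxes_le (M := M) (s := s) N
      refine ⟨Unit, inferInstance, exists_realizes_of_no_pending hname hφ h hp hj
        (le_max_left _ _) ?_⟩
      simp only [nodeBoxes, MarkovChain.weight_append]
      omega
    · exact exists_realizes_of_pending hname hφ h hF hI hj hk hb (ih (by omega))

/-- A satisfiable formula has a certificate of small height and branching. -/
theorem exists_certificate (hname : Function.Injective name) (hφ : φ.InFqG1) (h : Satisfiable φ) :
    ∃ (ι : Type) (_ : Fintype ι) (z : ι → Lasso) (p : ι → ℝ),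
      IsCertificate z p (φ.subs.map (Formula.encode name)) ∧
      IsNumbered z (φ.length + 1) φ.length ∧ (∀ i, φ.encode name ∈ (letterAt (z i).1 0).2) ∧
      ∀ i, ∀ a ∈ (z i).1, a.2.length ≤ φ.length := by
  obtain ⟨M, hM⟩ := h
  have hlen := one_le_length φ
  obtain ⟨ι, inst, z, p, hR⟩ := exists_realizes (M := M) hname hφ φ.length
    (Nat.lt_succ_self _) M.s₀ [φ] [] [] 0 ⟨by
      simpa [self_mem_subs] using show M.Sat φ M.s₀ from hM, by simp⟩ (by simp)
    (by simp [MarkovChain.weight]) (Nat.succ_pos _)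
  have hn := hR.numbered
  rw [max_eq_right hlen] at hn
  refine ⟨ι, inst, z, p, hR.cert, hn, fun i => ?_, hR.claims_le⟩
  rw [hR.root, encode_mem_mkLetter hname]
  exact ⟨self_mem_subs _, List.mem_append_left _ (by simp [MarkovChain.self_mem_now])⟩

end Certificate
end PCTL

namespace PCTL

/-! ### Bounded search is primitive recursive -/

section Primrec
variable {α β : Type*} [Primcodable α] [Primcodable β]

theorem primrecPred_exists_mem {f : α → List β} {R : α → β → Prop} (hf : Primrec f)
    (hR : PrimrecRel R) : PrimrecPred fun a => ∃ b ∈ f a, R a b :=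
  hR.swap.exists_mem_list.comp hf .id

theorem primrecPred_forall_mem {f : α → List β} {R : α → β → Prop} (hf : Primrec f)
    (hR : PrimrecRel R) : PrimrecPred fun a => ∀ b ∈ f a, R a b :=
  hR.swap.forall_mem_list.comp hf .id

theorem primrecPred_forall_lt {f : α → ℕ} {R : α → ℕ → Prop} (hf : Primrec f)
    (hR : PrimrecRel R) : PrimrecPred fun a => ∀ n < f a, R a n :=
  (primrecPred_forall_mem (Primrec.list_range.comp hf) hR).of_eq fun a => by simp

theorem primrecPred_imp {p q : α → Prop} (hp : PrimrecPred p) (hq : PrimrecPred q) :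
    PrimrecPred fun a => p a → q a :=
  (hp.not.or hq).of_eq fun _ => imp_iff_not_or.symm

theorem primrecPred_mem {f : α → β} {g : α → List β} (hf : Primrec f) (hg : Primrec g) :
    PrimrecPred fun a => f a ∈ g a :=
  (primrecPred_exists_mem (R := fun a b => b = f a) hg (Primrec.eq.comp Primrec.snd
    (hf.comp Primrec.fst))).of_eq
    fun a => by simp

/-- All lists of length at most `n` with elements from `l`. -/
def allLists (l : List β) : ℕ → List (List β)
  | 0 => [[]]
  | n + 1 => [] :: (allLists l n).flatMap fun t => l.map fun b => b :: t

omit [Primcodable β] in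
theorem mem_allLists {l : List β} {n : ℕ} {t : List β} :
    t ∈ allLists l n ↔ t.length ≤ n ∧ ∀ b ∈ t, b ∈ l := by
  induction n generalizing t with
  | zero => cases t <;> simp [allLists]
  | succ n ih =>
    cases t with
    | nil => simp [allLists]
    | cons a t => simp [allLists, ih]; tauto

theorem primrec_allLists {f : α → List β} {g : α → ℕ} (hf : Primrec f) (hg : Primrec g) :
    Primrec fun a => allLists (f a) (g a) := by
  have hstep : Primrec₂ fun (a : α) (q : ℕ × List (List β)) =>
      ([] : List β) :: q.2.flatMap fun t => (f a).map fun b => b :: t := by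
    refine Primrec.list_cons.comp (.const []) (Primrec.list_flatMap (.comp .snd .snd) ?_)
    exact Primrec.list_map (hf.comp (.comp .fst .fst))
      (Primrec.list_cons.comp .snd (.comp .snd .fst))
  refine (Primrec.nat_rec' hg (.const [[]]) hstep).of_eq fun a => ?_
  induction g a with
  | zero => rfl
  | succ n ih => simp only [allLists, ← ih]

theorem primrec_pow {f g : α → ℕ} (hf : Primrec f) (hg : Primrec g) :
    Primrec fun a => f a ^ g a :=
  (Primrec₂.unpaired'.1 Nat.Primrec.pow).comp hf hg

end Primrec

/-! ### Checking a certificate -/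

/-- The inequality `H / N ▷ q` for natural numbers. -/
def FutureHoldsNat (y : List ℕ) (N H : ℕ) : Prop :=
  (y.getD 1 0 = 0 → y.getD 2 0 * N ≤ y.getD 3 0 * H) ∧
    (y.getD 1 0 = 1 → y.getD 2 0 * N < y.getD 3 0 * H)

/-- The number of the lassos in a list that begin with `x`. -/
def prefixCount (c : List Lasso) (x : List Letter) : ℕ :=
  (c.filter fun z => z.1.take x.length = x).length

open Classical in
/-- The number of the lassos in a list that begin with `x` and claim `y` at the end of `x` or
later. -/
noncomputable def visitCount (c : List Lasso) (x : List Letter) (y : List ℕ) : ℕ :=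
  (c.filter fun z => z.1.take x.length = x ∧ z.Visits (x.length - 1) y).length

/-- A list of lassos that is, when all its entries have the same weight, a certificate for the
formula with the code `w`. -/
structure IsListCertificate (w : List ℕ) (subs : List (List ℕ)) (c : List Lasso) : Prop where
  nonempty : c ≠ []
  subClosed : SubClosed subs
  coherent : ∀ z ∈ c, z.Coherent subs
  root : ∀ z ∈ c, ∀ z' ∈ c, z.1.take 1 = z'.1.take 1
  loop : ∀ z ∈ c, ∀ z' ∈ c, z.1.take (z.2 + 1) = z'.1.take (z.2 + 1) → z = z'
  claim : ∀ z ∈ c, w ∈ (letterAt z.1 0).2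
  future : ∀ z ∈ c, ∀ j < z.1.length, ∀ y ∈ (letterAt z.1 j).2, y.head? = some 4 →
    FutureHoldsNat y (prefixCount c (z.1.take (j + 1)))
      (visitCount c (z.1.take (j + 1)) (y.drop 4))

section Primrec
open Primrec
variable {α : Type*} [Primcodable α]

theorem primrecPred_head {f : α → List ℕ} (hf : Primrec f) (n : ℕ) :
    PrimrecPred fun a => (f a).head? = some n :=
  Primrec.eq.comp (list_head?.comp hf) (.const _)

theorem primrec_letterAt {f : α → List Letter} {g : α → ℕ} (hf : Primrec f) (hg : Primrec g) :
    Primrec fun a => letterAt (f a) (g a) :=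
  (list_getD ((0, []) : Letter)).comp hf hg

theorem primrec_drop {β : Type*} [Primcodable β] {f : α → List β} {g : α → ℕ} (hf : Primrec f)
    (hg : Primrec g) : Primrec fun a => (f a).drop (g a) :=
  list_drop.comp hg hf

theorem primrec_take {β : Type*} [Primcodable β] {f : α → List β} {g : α → ℕ} (hf : Primrec f)
    (hg : Primrec g) : Primrec fun a => (f a).take (g a) :=
  list_take.comp hg hf

theorem primrecPred_visits {f : α → Lasso} {g : α → ℕ} {h : α → List ℕ} (hf : Primrec f)
    (hg : Primrec g) (hh : Primrec h) : PrimrecPred fun a => (f a).Visits (g a) (h a) :=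
  primrecPred_exists_mem (primrec_drop (fst.comp hf) (nat_min.comp hg (snd.comp hf)))
    (primrecPred_mem (hh.comp fst) (snd.comp snd))

theorem primrecPred_futureHoldsNat {f : α → List ℕ} {g h : α → ℕ} (hf : Primrec f)
    (hg : Primrec g) (hh : Primrec h) : PrimrecPred fun a => FutureHoldsNat (f a) (g a) (h a) := by
  have hget : ∀ n, Primrec fun a => (f a).getD n 0 := fun n => (list_getD 0).comp hf (.const n)
  exact (primrecPred_imp (Primrec.eq.comp (hget 1) (.const 0))
      (nat_le.comp (nat_mul.comp (hget 2) hg) (nat_mul.comp (hget 3) hh))).and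
    (primrecPred_imp (Primrec.eq.comp (hget 1) (.const 1))
      (nat_lt.comp (nat_mul.comp (hget 2) hg) (nat_mul.comp (hget 3) hh)))

open Classical in
theorem primrec_prefixCount {f : α → List Lasso} {g : α → List Letter} (hf : Primrec f)
    (hg : Primrec g) : Primrec fun a => prefixCount (f a) (g a) := by
  have h : PrimrecRel fun (z : Lasso) (x : List Letter) => z.1.take x.length = x :=
    Primrec.eq.comp (primrec_take (fst.comp fst) (list_length.comp snd)) snd
  refine (list_length.comp (h.listFilter.comp hf hg)).of_eq fun a => ?_
  unfold prefixCount
  congr!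

open Classical in
theorem primrec_visitCount {f : α → List Lasso} {g : α → List Letter} {h : α → List ℕ}
    (hf : Primrec f) (hg : Primrec g) (hh : Primrec h) :
    Primrec fun a => visitCount (f a) (g a) (h a) := by
  have hR : PrimrecRel fun (z : Lasso) (q : List Letter × List ℕ) =>
      z.1.take q.1.length = q.1 ∧ z.Visits (q.1.length - 1) q.2 := by
    have hl : Primrec fun r : Lasso × List Letter × List ℕ => r.2.1.length :=
      list_length.comp (fst.comp snd)
    exact (Primrec.eq.comp (primrec_take (fst.comp fst) hl) (fst.comp snd)).and
      (primrecPred_visits fst (nat_sub.comp hl (.const 1)) (snd.comp snd))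
  exact list_length.comp (hR.listFilter.comp hf (hg.pair hh))

theorem primrecPred_subClosed {f : α → List (List ℕ)} (hf : Primrec f) :
    PrimrecPred fun a => SubClosed (f a) := by
  refine primrecPred_forall_mem hf (.or (.and ?_ (.or ?_ ?_)) (.or ?_ (.and ?_ (.and
    (.or ?_ ?_) ?_))))
  · exact Primrec.eq.comp (list_length.comp snd) (.const 2)
  · exact primrecPred_head snd 0
  · exact primrecPred_head snd 1
  · refine primrecPred_exists_mem (hf.comp fst) (primrecPred_exists_mem (hf.comp (fst.comp fst)) ?_)
    exact Primrec.eq.comp (snd.comp (fst.comp fst))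
      (list_cons.comp (.const 2) (list_append.comp (snd.comp fst) snd))
  · exact nat_le.comp (.const 4) (list_length.comp snd)
  · exact primrecPred_head snd 4
  · exact primrecPred_head snd 5
  · exact primrecPred_mem (primrec_drop snd (.const 4)) (hf.comp fst)

theorem Lasso.coherent_iff (subs : List (List ℕ)) (z : Lasso) : z.Coherent subs ↔
    z.2 < z.1.length ∧ (∀ a ∈ z.1, ∀ y ∈ a.2, y ∈ subs) ∧
    (∀ a ∈ z.1, ∀ y ∈ a.2, y.head? = some 1 → 0 :: y.drop 1 ∉ a.2) ∧
    (∀ a ∈ z.1, ∀ y ∈ a.2, y.head? = some 2 → ∃ u ∈ a.2, ∃ v ∈ a.2, y = 2 :: (u ++ v)) ∧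
    (∀ j < z.1.length, ∀ y ∈ (letterAt z.1 j).2, y.head? = some 5 →
      ∀ b ∈ z.1.drop (min j z.2), y ∈ b.2 ∧ y.drop 4 ∈ b.2) :=
  ⟨fun h => ⟨h.1, h.2, h.3, h.4, h.5⟩, fun h => ⟨h.1, h.2.1, h.2.2.1, h.2.2.2.1, h.2.2.2.2⟩⟩

theorem primrecPred_coherent {f : α → List (List ℕ)} {g : α → Lasso} (hf : Primrec f)
    (hg : Primrec g) : PrimrecPred fun a => (g a).Coherent (f a) := by
  refine PrimrecPred.of_eq ?_ fun a => (Lasso.coherent_iff (f a) (g a)).symm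
  have hw : Primrec fun a => (g a).1 := fst.comp hg
  have hl : Primrec fun a => (g a).1.length := list_length.comp hw
  refine .and (nat_lt.comp (snd.comp hg) hl) (.and ?_ (.and ?_ (.and ?_ ?_)))
  · exact primrecPred_forall_mem hw (primrecPred_forall_mem (snd.comp snd) (primrecPred_mem snd
      (hf.comp (fst.comp fst))))
  · refine primrecPred_forall_mem hw (primrecPred_forall_mem (snd.comp snd) (primrecPred_imp
      (primrecPred_head snd 1) (.not ?_)))
    exact primrecPred_mem (list_cons.comp (.const 0) (primrec_drop snd (.const 1))) (snd.comp
      (snd.comp fst))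
  · refine primrecPred_forall_mem hw (primrecPred_forall_mem (snd.comp snd) (primrecPred_imp
      (primrecPred_head snd 2) ?_))
    refine primrecPred_exists_mem (snd.comp (snd.comp fst)) (primrecPred_exists_mem (snd.comp
      (snd.comp (fst.comp fst))) ?_)
    exact Primrec.eq.comp (snd.comp (fst.comp fst))
      (list_cons.comp (.const 2) (list_append.comp (snd.comp fst) snd))
  · refine primrecPred_forall_lt hl (primrecPred_forall_mem (snd.comp (primrec_letterAt
      (hw.comp fst) snd))
      (primrecPred_imp (primrecPred_head snd 5) (primrecPred_forall_mem (primrec_drop (hw.comp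
        (fst.comp fst))
        (nat_min.comp (snd.comp fst) (snd.comp (hg.comp (fst.comp fst))))) (.and ?_ ?_))))
    · exact primrecPred_mem (snd.comp fst) (snd.comp snd)
    · exact primrecPred_mem (primrec_drop (snd.comp fst) (.const 4)) (snd.comp snd)

theorem isListCertificate_iff (w : List ℕ) (subs : List (List ℕ)) (c : List Lasso) :
    IsListCertificate w subs c ↔ c ≠ [] ∧ SubClosed subs ∧ (∀ z ∈ c, z.Coherent subs) ∧
    (∀ z ∈ c, ∀ z' ∈ c, z.1.take 1 = z'.1.take 1) ∧
    (∀ z ∈ c, ∀ z' ∈ c, z.1.take (z.2 + 1) = z'.1.take (z.2 + 1) → z = z') ∧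
    (∀ z ∈ c, w ∈ (letterAt z.1 0).2) ∧
    (∀ z ∈ c, ∀ j < z.1.length, ∀ y ∈ (letterAt z.1 j).2, y.head? = some 4 →
      FutureHoldsNat y (prefixCount c (z.1.take (j + 1)))
        (visitCount c (z.1.take (j + 1)) (y.drop 4))) :=
  ⟨fun h => ⟨h.1, h.2, h.3, h.4, h.5, h.6, h.7⟩,
    fun h => ⟨h.1, h.2.1, h.2.2.1, h.2.2.2.1, h.2.2.2.2.1, h.2.2.2.2.2.1, h.2.2.2.2.2.2⟩⟩

theorem primrecPred_isListCertificate {w : α → List ℕ} {f : α → List (List ℕ)}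
    {c : α → List Lasso} (hw : Primrec w) (hf : Primrec f) (hc : Primrec c) :
    PrimrecPred fun a => IsListCertificate (w a) (f a) (c a) := by
  refine PrimrecPred.of_eq ?_ fun a => (isListCertificate_iff (w a) (f a) (c a)).symm
  refine .and (.not (Primrec.eq.comp hc (.const []))) (.and (primrecPred_subClosed hf)
    (.and ?_ (.and ?_ (.and ?_ (.and ?_ ?_)))))
  · exact primrecPred_forall_mem hc (primrecPred_coherent (hf.comp fst) snd)
  · refine primrecPred_forall_mem hc (primrecPred_forall_mem (hc.comp fst) (Primrec.eq.comp ?_ ?_))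
    · exact primrec_take (fst.comp (snd.comp fst)) (.const 1)
    · exact primrec_take (fst.comp snd) (.const 1)
  · refine primrecPred_forall_mem hc (primrecPred_forall_mem (hc.comp fst) (primrecPred_imp
      (Primrec.eq.comp ?_ ?_)
      (Primrec.eq.comp (snd.comp fst) snd)))
    · exact primrec_take (fst.comp (snd.comp fst)) (succ.comp (snd.comp (snd.comp fst)))
    · exact primrec_take (fst.comp snd) (succ.comp (snd.comp (snd.comp fst)))
  · exact primrecPred_forall_mem hc (primrecPred_mem (hw.comp fst) (snd.comp (primrec_letterAt
      (fst.comp snd) (.const 0))))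
  · refine primrecPred_forall_mem hc (primrecPred_forall_lt (list_length.comp (fst.comp snd))
      (primrecPred_forall_mem (snd.comp (primrec_letterAt (fst.comp (snd.comp fst)) snd))
        (primrecPred_imp (primrecPred_head snd 4) ?_)))
    have hc' : Primrec fun q : ((α × Lasso) × ℕ) × List ℕ => c q.1.1.1 :=
      hc.comp (fst.comp (fst.comp fst))
    have hx : Primrec fun q : ((α × Lasso) × ℕ) × List ℕ => q.1.1.2.1.take (q.1.2 + 1) :=
      primrec_take (fst.comp (snd.comp (fst.comp fst))) (succ.comp (snd.comp fst))
    exact primrecPred_futureHoldsNat snd (primrec_prefixCount hc' hx)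
      (primrec_visitCount hc' hx (primrec_drop snd (.const 4)))

end Primrec
end PCTL

namespace PCTL

/-! ### Certificates with natural weights -/

theorem length_filter_eq_sum (c : List Lasso) (Q : Lasso → Prop)
    {hQ : DecidablePred Q} {hQ' : ∀ i, Decidable (Q (c.get i))} :
    ((c.filter fun z => @decide (Q z) (hQ z)).length : ℝ) =
      ∑ i, @ite _ (Q (c.get i)) (hQ' i) 1 0 := by
  have h : ((c.filter fun z => @decide (Q z) (hQ z)).length : ℝ) =
      (c.map fun z => if Q z then (1 : ℝ) else 0).sum := by
    induction c with
    | nil => simp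
    | cons a c ih => by_cases ha : Q a <;> simp [ha, ih, add_comm]
  rw [h, ← Fin.sum_univ_fun_getElem]
  exact Finset.sum_congr rfl fun i _ => by congr

theorem prefixMass_get (c : List Lasso) (x : List Letter) :
    prefixMass c.get (fun _ => 1) x = prefixCount c x := by
  unfold prefixMass prefixCount Through
  exact (length_filter_eq_sum c fun z => z.1.take x.length = x).symm

theorem visitMass_get (c : List Lasso) (x : List Letter) (y : List ℕ) :
    visitMass c.get (fun _ => 1) x y = visitCount c x y := by
  unfold visitMass visitCount Through
  exact (length_filter_eq_sum c fun z => z.1.take x.length = x ∧ z.Visits (x.length - 1) y).symm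

theorem futureHoldsNat_iff {y : List ℕ} {N H : ℕ} :
    FutureHoldsNat y N H ↔ FutureHolds y N H := by
  simp only [FutureHoldsNat, FutureHolds]
  norm_cast

theorem IsListCertificate.isCertificate {w : List ℕ} {subs : List (List ℕ)} {c : List Lasso}
    (h : IsListCertificate w subs c) : IsCertificate c.get (fun _ => 1) subs where
  nonempty := ⟨⟨0, List.length_pos_iff.2 h.nonempty⟩⟩
  pos _ := one_pos
  subClosed := h.subClosed
  coherent i := h.coherent _ (c.get_mem i)
  root i j := h.root _ (c.get_mem i) _ (c.get_mem j)
  loop i j := h.loop _ (c.get_mem i) _ (c.get_mem j)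
  future i j y hy h4 := by
    rw [prefixMass_get, visitMass_get]
    exact futureHoldsNat_iff.1
      (h.future _ (c.get_mem i) j (Certificate.lt_length_of_mem hy) y hy h4)

namespace IsCertificate
variable {ι : Type} [Fintype ι] {z : ι → Lasso} {p : ι → ℝ} {subs : List (List ℕ)}

/-- Equal lassos of a certificate can be merged. -/
theorem exists_injective (h : IsCertificate z p subs) :
    ∃ (N : ℕ) (v : Fin N → Lasso) (p' : Fin N → ℝ), Function.Injective v ∧
      (∀ l, ∃ i, v l = z i) ∧ IsCertificate v p' subs := by
  classical
  let e := Fintype.equivFin (Set.range z)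
  let v : Fin (Fintype.card (Set.range z)) → Lasso := fun l => (e.symm l).1
  let p' : Fin (Fintype.card (Set.range z)) → ℝ := fun l => ∑ i, if v l = z i then p i else 0
  have hv : ∀ l, ∃ i, v l = z i := fun l => (e.symm l).2.imp fun i hi => hi.symm
  have hvi : Function.Injective v := Subtype.val_injective.comp e.symm.injective
  have hz : ∀ i, ∃ l, v l = z i := fun i => ⟨e ⟨z i, i, rfl⟩, by simp [v]⟩
  have hsum : ∀ (Q : Lasso → Prop) {_ : ∀ l, Decidable (Q (v l))}
      {_ : ∀ i, Decidable (Q (z i))}, (∑ l, if Q (v l) then p' l else 0) =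
      ∑ i, if Q (z i) then p i else 0 := by
    intro Q _ _
    have h1 : ∀ l, (if Q (v l) then p' l else 0) =
        ∑ i, if v l = z i then (if Q (z i) then p i else 0) else 0 := by
      intro l
      by_cases hQ : Q (v l)
      · rw [if_pos hQ]
        refine Finset.sum_congr rfl fun i _ => ?_
        by_cases hi : v l = z i
        · rw [if_pos hi, if_pos hi, if_pos (hi ▸ hQ)]
        · rw [if_neg hi, if_neg hi]
      · rw [if_neg hQ]
        refine (Finset.sum_eq_zero fun i _ => ?_).symm
        by_cases hi : v l = z i
        · rw [if_pos hi, if_neg (hi ▸ hQ)]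
        · rw [if_neg hi]
    rw [Finset.sum_congr rfl fun l _ => h1 l, Finset.sum_comm]
    refine Finset.sum_congr rfl fun i _ => ?_
    obtain ⟨l, hl⟩ := hz i
    rw [Fintype.sum_eq_single l, if_pos hl]
    intro l' hl'
    exact if_neg fun h' => hl' (hvi (h'.trans hl.symm))
  refine ⟨_, v, p', hvi, hv, ?_, fun l => ?_, h.subClosed, fun l => ?_, fun l l' => ?_,
    fun l l' => ?_, fun l j y hy h4 => ?_⟩
  · obtain ⟨i⟩ := h.nonempty
    exact ⟨(hz i).choose⟩
  · obtain ⟨i, hi⟩ := hv l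
    refine Finset.sum_pos' (fun i _ => ?_) ⟨i, Finset.mem_univ _, ?_⟩
    · split_ifs
      exacts [(h.pos i).le, le_rfl]
    · rw [if_pos hi]; exact h.pos i
  · obtain ⟨i, hi⟩ := hv l
    exact hi ▸ h.coherent i
  · obtain ⟨i, hi⟩ := hv l
    obtain ⟨i', hi'⟩ := hv l'
    rw [hi, hi']; exact h.root i i'
  · obtain ⟨i, hi⟩ := hv l
    obtain ⟨i', hi'⟩ := hv l'
    rw [hi, hi']; exact h.loop i i'
  · obtain ⟨i, hi⟩ := hv l
    have hN : ∀ x, prefixMass v p' x = prefixMass z p x := fun x => by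
      unfold prefixMass Through
      exact hsum fun a => a.1.take x.length = x
    have hH : ∀ x y, visitMass v p' x y = visitMass z p x y := fun x y => by
      unfold visitMass Through
      exact hsum fun a => a.1.take x.length = x ∧ a.Visits (x.length - 1) y
    rw [hN, hH, hi]
    exact h.future i j y (hi ▸ hy) h4

/-- The weights of a certificate can be chosen as natural numbers of bounded size, since the
conditions on them are homogeneous linear inequalities with small integer coefficients. -/
theorem exists_nat_weights {N : ℕ} {v : Fin N → Lasso} {p : Fin N → ℝ}
    (h : IsCertificate v p subs) {K : ℕ} (hK1 : 1 ≤ K)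
    (hK : ∀ i, ∀ a ∈ (v i).1, ∀ y ∈ a.2, ∀ n ∈ y, n ≤ K) :
    ∃ m : Fin N → ℕ, (∀ l, m l ≤ (2 * K * (N + 1)) ^ 5 ^ N) ∧
      IsCertificate v (fun l => (m l : ℝ)) subs := by
  classical
  let row : List Letter → List ℕ → Fin N → ℤ := fun x y l =>
    y.getD 3 0 * (if Through v x l ∧ (v l).Visits (x.length - 1) (y.drop 4) then 1 else 0) -
      y.getD 2 0 * (if Through v x l then 1 else 0)
  have hrow : ∀ x y (t : Fin N → ℝ), ∑ l, (row x y l : ℝ) * t l =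
      y.getD 3 0 * visitMass v t x (y.drop 4) - y.getD 2 0 * prefixMass v t x := by
    intro x y t
    rw [visitMass, prefixMass, Finset.mul_sum, Finset.mul_sum, ← Finset.sum_sub_distrib]
    refine Finset.sum_congr rfl fun l _ => ?_
    by_cases h1 : Through v x l <;> by_cases h2 : (v l).Visits (x.length - 1) (y.drop 4) <;>
      simp [row, h1, h2]
    ring
  -- the rows demand positive weights and state the conditions on the claimed `F`-formulas
  let R : Set ((Fin N → ℤ) × Bool) := {r | (∃ i, r = (Pi.single i 1, true)) ∨
    ∃ i j, ∃ y ∈ (letterAt (v i).1 j).2, y.head? = some 4 ∧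
      r.1 = row ((v i).1.take (j + 1)) y ∧
      (y.getD 1 0 = 0 ∧ r.2 = false ∨ y.getD 1 0 = 1 ∧ r.2 = true)}
  have hR : ∀ r ∈ R, ∀ l, |r.1 l| ≤ (K : ℤ) := by
    rintro ⟨r, b⟩ (⟨i, hr⟩ | ⟨i, j, y, hy, -, hr, -⟩) l
    · obtain ⟨rfl, -⟩ := Prod.mk.inj hr
      by_cases hl : l = i
      · subst hl; simpa using hK1
      · simp [hl]
    · have hget : ∀ n, y.getD n 0 ≤ K := fun n => by
        by_cases hn : n < y.length
        · rw [List.getD_eq_getElem _ _ hn]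
          exact hK i _ (letterAt_mem (Certificate.lt_length_of_mem hy)) y hy _ (List.getElem_mem _)
        · rw [List.getD_eq_default _ _ (not_lt.1 hn)]
          exact Nat.zero_le _
      have h2 := hget 2
      have h3 := hget 3
      simp only at hr
      rw [hr, abs_le]
      simp only [row]
      split_ifs <;> constructor <;> omega
  obtain ⟨m, hm, hmR⟩ := exists_small_solution N K hK1 R hR ⟨p, by
    rintro ⟨r, b⟩ (⟨i, hr⟩ | ⟨i, j, y, hy, h4, hr, hb⟩)
    · obtain ⟨rfl, rfl⟩ := Prod.mk.inj hr
      simpa [SignHolds, Pi.single_apply] using h.pos i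
    · have hf := h.future i j y hy h4
      simp only at hr hb ⊢
      rw [hr, hrow]
      rcases hb with ⟨hy1, rfl⟩ | ⟨hy1, rfl⟩
      · simpa [SignHolds] using hf.1 hy1
      · simpa [SignHolds] using hf.2 hy1⟩
  have hpos : ∀ l, 0 < m l := fun l => by
    have := hmR _ (.inl ⟨l, rfl⟩)
    simpa [SignHolds, Pi.single_apply] using this
  have hcast : ∀ l, (((m l).toNat : ℕ) : ℝ) = (m l : ℝ) := fun l => by
    have := Int.toNat_of_nonneg (hpos l).le
    exact_mod_cast congrArg (Int.cast (R := ℝ)) this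
  refine ⟨fun l => (m l).toNat, fun l => ?_, ?_⟩
  · have := hm l
    rw [abs_of_pos (hpos l)] at this
    exact Int.toNat_le.2 this
  · simp only [hcast]
    refine ⟨h.nonempty, fun l => by exact_mod_cast hpos l, h.subClosed, h.coherent, h.root, h.loop,
      fun i j y hy h4 => ⟨fun h1 => ?_, fun h1 => ?_⟩⟩
    · have := hmR (row ((v i).1.take (j + 1)) y, false)
        (.inr ⟨i, j, y, hy, h4, rfl, .inl ⟨h1, rfl⟩⟩)
      rw [hrow] at this
      simpa [SignHolds] using this
    · have := hmR (row ((v i).1.take (j + 1)) y, true)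
        (.inr ⟨i, j, y, hy, h4, rfl, .inr ⟨h1, rfl⟩⟩)
      rw [hrow] at this
      simpa [SignHolds] using this

theorem length_filter_flatMap_replicate {N : ℕ} (v : Fin N → Lasso) (m : Fin N → ℕ)
    (Q : Lasso → Prop) {hQ : DecidablePred Q} {hQ' : ∀ l, Decidable (Q (v l))} :
    ((((List.finRange N).flatMap fun l => List.replicate (m l) (v l)).filter
      fun a => @decide (Q a) (hQ a)).length : ℝ) =
        ∑ l, @ite ℝ (Q (v l)) (hQ' l) (m l) 0 := by
  rw [← List.countP_eq_length_filter, List.countP_flatMap, Fin.sum_univ_def, Nat.cast_list_sum,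
    List.map_map]
  refine congrArg List.sum (List.map_congr_left fun l _ => ?_)
  by_cases hl : Q (v l) <;> simp [List.countP_replicate, hl]

/-- Natural weights can be replaced by repetitions. -/
theorem isListCertificate {N : ℕ} {v : Fin N → Lasso} {m : Fin N → ℕ}
    (h : IsCertificate v (fun l => (m l : ℝ)) subs) {w : List ℕ}
    (hw : ∀ i, w ∈ (letterAt (v i).1 0).2) :
    IsListCertificate w subs ((List.finRange N).flatMap fun l => List.replicate (m l) (v l)) := by
  set c := (List.finRange N).flatMap fun l => List.replicate (m l) (v l) with hc
  have hmem : ∀ {a}, a ∈ c → ∃ l, a = v l := fun ha => by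
    obtain ⟨l, -, hl⟩ := List.mem_flatMap.1 ha
    exact ⟨l, List.eq_of_mem_replicate hl⟩
  refine ⟨?_, h.subClosed, fun a ha => ?_, fun a ha a' ha' => ?_, fun a ha a' ha' => ?_,
    fun a ha => ?_, fun a ha j hj y hy h4 => ?_⟩
  · obtain ⟨l⟩ := h.nonempty
    refine List.ne_nil_of_mem (a := v l) (List.mem_flatMap.2 ⟨l, List.mem_finRange l,
      List.mem_replicate.2 ⟨?_, rfl⟩⟩)
    have := h.pos l
    exact fun h0 => by simp [h0] at this
  · obtain ⟨l, rfl⟩ := hmem ha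
    exact h.coherent l
  · obtain ⟨l, rfl⟩ := hmem ha
    obtain ⟨l', rfl⟩ := hmem ha'
    exact h.root l l'
  · obtain ⟨l, rfl⟩ := hmem ha
    obtain ⟨l', rfl⟩ := hmem ha'
    exact h.loop l l'
  · obtain ⟨l, rfl⟩ := hmem ha
    exact hw l
  · obtain ⟨l, rfl⟩ := hmem ha
    have hN : ∀ x, (prefixCount c x : ℝ) = prefixMass v (fun l => (m l : ℝ)) x := fun x => by
      unfold prefixMass prefixCount Through
      exact length_filter_flatMap_replicate v m fun a => a.1.take x.length = x
    have hH : ∀ x y, (visitCount c x y : ℝ) = visitMass v (fun l => (m l : ℝ)) x y := fun x y => by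
      unfold visitMass visitCount Through
      exact length_filter_flatMap_replicate v m
        fun a => a.1.take x.length = x ∧ a.Visits (x.length - 1) y
    rw [futureHoldsNat_iff, hN, hH]
    exact h.future l j y hy h4

end IsCertificate

/-! ### The search space -/

namespace Formula
variable {A : Type u} {name : A → ℕ} {φ χ : Formula A}

theorem mem_encode_of_mem_subs (h : χ ∈ φ.subs) : ∀ n ∈ χ.encode name, n ∈ φ.encode name := by
  induction φ with
  | atom a | negAtom a => simp only [subs, List.mem_singleton] at h; simp [h]
  | and φ ψ ih₁ ih₂ | or φ ψ ih₁ ih₂ =>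
    simp only [subs, List.mem_cons, List.mem_append] at h
    rcases h with rfl | h | h
    · exact fun n hn => hn
    · exact fun n hn => by simp [encode, ih₁ h n hn]
    · exact fun n hn => by simp [encode, ih₂ h n hn]
  | future c q φ ih | globally c q φ ih =>
    simp only [subs, List.mem_cons] at h
    rcases h with rfl | h
    · exact fun n hn => hn
    · exact fun n hn => by simp [encode, ih h n hn]

theorem length_encode_le_of_mem_subs (h : χ ∈ φ.subs) :
    (χ.encode name).length ≤ (φ.encode name).length := by
  induction φ with
  | atom a | negAtom a => simp only [subs, List.mem_singleton] at h; simp [h]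
  | and φ ψ ih₁ ih₂ | or φ ψ ih₁ ih₂ =>
    simp only [subs, List.mem_cons, List.mem_append] at h
    rcases h with rfl | h | h
    · exact le_rfl
    · have := ih₁ h
      simp only [encode, List.length_cons, List.length_append]; omega
    · have := ih₂ h
      simp only [encode, List.length_cons, List.length_append]; omega
  | future c q φ ih | globally c q φ ih =>
    simp only [subs, List.mem_cons] at h
    rcases h with rfl | h
    · exact le_rfl
    · have := ih h
      simp only [encode, List.length_cons]; omega

theorem length_le_length_encode (φ : Formula A) : φ.length ≤ (φ.encode name).length := by
  induction φ <;> simp [encode, length] at * <;> omega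

end Formula

/-- The words that may be claims in a certificate for the formula with the code `w`. -/
def claimSpace (w : List ℕ) : List (List ℕ) := allLists w w.length

/-- The letters that may occur in a certificate for the formula with the code `w`. -/
def letterSpace (w : List ℕ) : List Letter :=
  (List.range (w.length + 1)).flatMap fun j =>
    (allLists (claimSpace w) w.length).map fun l => (j, l)

/-- The lassos that may occur in a certificate for the formula with the code `w`. -/
def lassoSpace (w : List ℕ) : List Lasso :=
  (allLists (letterSpace w) w.length).flatMap fun x => (List.range w.length).map fun k => (x, k)

/-- A bound for the number of lassos, with repetitions, in a certificate for the formula with the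
code `w`. -/
def lassoBound (w : List ℕ) : ℕ :=
  (lassoSpace w).length *
    (2 * (w.sum + 1) * ((lassoSpace w).length + 1)) ^ 5 ^ (lassoSpace w).length

/-- There is a list certificate within the search space. -/
def HasCertificate (w : List ℕ) : Prop :=
  ∃ subs ∈ allLists (claimSpace w) w.length, ∃ c ∈ allLists (lassoSpace w) (lassoBound w),
    IsListCertificate w subs c

theorem primrecPred_hasCertificate : PrimrecPred HasCertificate := by
  have hlen : Primrec fun w : List ℕ => w.length := Primrec.list_length
  have hclaim : Primrec claimSpace := primrec_allLists .id hlen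
  have hletter : Primrec letterSpace := by
    refine Primrec.list_flatMap (Primrec.list_range.comp (Primrec.succ.comp hlen)) ?_
    refine Primrec.list_map ((primrec_allLists hclaim hlen).comp .fst) ?_
    exact Primrec.pair (.comp .snd .fst) .snd
  have hlasso : Primrec lassoSpace := by
    refine Primrec.list_flatMap (primrec_allLists hletter hlen) ?_
    refine Primrec.list_map (Primrec.list_range.comp (hlen.comp .fst)) ?_
    exact Primrec.pair (.comp .snd .fst) .snd
  have hN : Primrec fun w => (lassoSpace w).length := Primrec.list_length.comp hlasso
  have hsum : Primrec fun w : List ℕ => w.sum := by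
    refine (Primrec.list_foldr .id (.const 0) (h := fun _ q => q.1 + q.2) ?_).of_eq fun w => ?_
    · exact Primrec.nat_add.comp (.comp .fst .snd) (.comp .snd .snd)
    · rfl
  have hbound : Primrec lassoBound := by
    refine Primrec.nat_mul.comp hN (primrec_pow (Primrec.nat_mul.comp (Primrec.nat_mul.comp
      (.const 2) (Primrec.succ.comp hsum)) (Primrec.succ.comp hN)) (primrec_pow (.const 5) hN))
  refine primrecPred_exists_mem (primrec_allLists hclaim hlen) (primrecPred_exists_mem
    ((primrec_allLists hlasso hbound).comp .fst) ?_)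
  exact primrecPred_isListCertificate (.comp .fst .fst) (.comp .snd .fst) .snd

/-- A satisfiable formula has a certificate in the search space. -/
theorem hasCertificate_of_satisfiable {A : Type u} {name : A → ℕ}
    (hname : Function.Injective name) {φ : Formula A} (hφ : φ.InFqG1) (h : Satisfiable φ) :
    HasCertificate (φ.encode name) := by
  obtain ⟨ι, _, z, p, hz, hnum, hroot, hclaims⟩ := Certificate.exists_certificate hname hφ h
  obtain ⟨N, v, p', hinj, hv, hcert⟩ := hz.exists_injective
  set w := φ.encode name with hw
  have hlen : φ.length ≤ w.length := φ.length_le_length_encode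
  have hsubs : ∀ y ∈ φ.subs.map (Formula.encode name), y ∈ claimSpace w := by
    intro y hy
    obtain ⟨χ, hχ, rfl⟩ := List.mem_map.1 hy
    exact mem_allLists.2
      ⟨Formula.length_encode_le_of_mem_subs hχ, Formula.mem_encode_of_mem_subs hχ⟩
  have hspace : ∀ l, v l ∈ lassoSpace w := by
    intro l
    obtain ⟨i, hi⟩ := hv l
    have h1 := hnum.length_le i
    have h2 := (hz.coherent i).loop_lt
    rw [hi]
    refine List.mem_flatMap.2 ⟨(z i).1, mem_allLists.2 ⟨by omega, fun a ha => ?_⟩,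
      List.mem_map.2 ⟨(z i).2, List.mem_range.2 (by omega), rfl⟩⟩
    have h3 := hnum.lt i a ha
    exact List.mem_flatMap.2 ⟨a.1, List.mem_range.2 (by omega), List.mem_map.2 ⟨a.2,
      mem_allLists.2 ⟨(hclaims i a ha).trans hlen,
        fun y hy => hsubs y ((hz.coherent i).mem_subs a ha y hy)⟩, rfl⟩⟩
  -- merging has made the lassos distinct, so that the search space bounds their number
  have hN : N ≤ (lassoSpace w).length := by
    classical
    have h1 := Finset.card_le_card_of_injOn (s := Finset.univ) (t := (lassoSpace w).toFinset) v
      (fun l _ => by simpa using hspace l) hinj.injOn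
    simpa using h1.trans (List.toFinset_card_le _)
  obtain ⟨m, hm, hcert'⟩ := hcert.exists_nat_weights (K := w.sum + 1) (by omega) (by
    intro l a ha y hy n hn
    have h1 := hsubs y ((hcert.coherent l).mem_subs a ha y hy)
    have := List.le_sum_of_mem ((mem_allLists.1 h1).2 n hn)
    omega)
  refine ⟨φ.subs.map (Formula.encode name), mem_allLists.2 ⟨?_, hsubs⟩, _, mem_allLists.2 ⟨?_, ?_⟩,
    hcert'.isListCertificate fun l => ?_⟩
  · rw [List.length_map, Formula.length_subs]
    exact hlen
  · have h1 : ((List.finRange N).flatMap fun l => List.replicate (m l) (v l)).length =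
        ∑ l, m l := by
      simp [List.length_flatMap, Fin.sum_univ_def]
    rw [h1, lassoBound]
    refine (Finset.sum_le_sum fun l _ => hm l).trans ?_
    rw [Finset.sum_const, Finset.card_univ, Fintype.card_fin, smul_eq_mul]
    have h5 : 5 ^ N ≤ 5 ^ (lassoSpace w).length := Nat.pow_le_pow_right (by norm_num) hN
    have hbase : 2 * (w.sum + 1) * (N + 1) ≤ 2 * (w.sum + 1) * ((lassoSpace w).length + 1) :=
      Nat.mul_le_mul_left _ (by omega)
    exact Nat.mul_le_mul hN ((Nat.pow_le_pow_left hbase _).trans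
      (Nat.pow_le_pow_right (by positivity) h5))
  · intro a ha
    obtain ⟨l, -, hl⟩ := List.mem_flatMap.1 ha
    rw [List.eq_of_mem_replicate hl]
    exact hspace l
  · obtain ⟨i, hi⟩ := hv l
    rw [hi]
    exact hroot i

/-! ### Small models and decidability -/

/-- A certificate yields a finite model. -/
theorem finitelySatisfiable_of_hasCertificate {A : Type u} (name : A → ℕ) {φ : Formula A}
    (hφ : φ.InFqG1) (h : HasCertificate (φ.encode name)) : FinitelySatisfiable φ := by
  obtain ⟨subs, -, c, -, hc⟩ := h
  exact ⟨Certificate.chain name hc.isCertificate, inferInstanceAs (Finite (Certificate.State _)),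
    Certificate.isModel hc.isCertificate φ hφ fun i => hc.claim _ (c.get_mem i)⟩

/-- A satisfiable formula has a small model. -/
theorem exists_small_model {A : Type u} [Finite A] {φ : Formula A} (hφ : φ.InFqG1)
    (h : Satisfiable φ) : ∃ M : MarkovChain A, M.IsModel φ ∧ M.HeightAtMost φ.length ∧
      M.BranchingAtMost (φ.length + 2) ∧ M.SizeAtMost ((φ.length + 2) ^ φ.length) := by
  obtain ⟨name, hname⟩ := exists_injective_nat A
  obtain ⟨ι, _, z, p, hz, hnum, hroot, -⟩ := Certificate.exists_certificate hname hφ h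
  exact ⟨Certificate.chain name hz, Certificate.isModel hz φ hφ hroot,
    Certificate.heightAtMost name hz hnum, Certificate.branchingAtMost name hz hnum,
    Certificate.sizeAtMost name hz hnum⟩

end PCTL

theorem mainTheorem5 :
    -- small models: height, branching and size
    (∀ (A : Type u) [Finite A] (φ : PCTL.Formula A), φ.InFqG1 → PCTL.Satisfiable φ →
      ∃ M : PCTL.MarkovChain A, M.IsModel φ ∧ M.HeightAtMost φ.length ∧
        M.BranchingAtMost (φ.length + 2) ∧
        M.SizeAtMost ((φ.length + 2) ^ φ.length)) ∧
    -- finite and general satisfiability coincide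
    (∀ (A : Type u) [Finite A] (φ : PCTL.Formula A), φ.InFqG1 →
      (PCTL.FinitelySatisfiable φ ↔ PCTL.Satisfiable φ)) ∧
    -- one algorithm decides both, for all finite sets of (numbered) atomic propositions
    (∃ d : List ℕ → Bool, Computable d ∧
      ∀ (A : Type u) [Finite A] (name : A → ℕ), Function.Injective name →
        ∀ φ : PCTL.Formula A, φ.InFqG1 →
          (d (φ.encode name) = true ↔ PCTL.Satisfiable φ) ∧
          (d (φ.encode name) = true ↔ PCTL.FinitelySatisfiable φ)) := by
  have hfin : ∀ (A : Type u) (φ : PCTL.Formula A), PCTL.FinitelySatisfiable φ →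
      PCTL.Satisfiable φ := fun A φ ⟨M, _, hM⟩ => ⟨M, hM⟩
  refine ⟨fun A _ φ hφ h => PCTL.exists_small_model hφ h, fun A _ φ hφ =>
    ⟨hfin A φ, fun h => ?_⟩, ?_⟩
  · obtain ⟨M, hM, -, -, hsize⟩ := PCTL.exists_small_model hφ h
    exact ⟨M, hsize.1, hM⟩
  · obtain ⟨_, hd⟩ := PCTL.primrecPred_hasCertificate
    refine ⟨fun w => decide (PCTL.HasCertificate w), hd.to_comp, fun A _ name hname φ hφ => ?_⟩
    rw [decide_eq_true_iff]
    have h1 := PCTL.hasCertificate_of_satisfiable hname hφ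
    have h2 := PCTL.finitelySatisfiable_of_hasCertificate name hφ
    exact ⟨⟨fun h => hfin A φ (h2 h), h1⟩, h2, fun h => h1 (hfin A φ h)⟩
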